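/- **Model.** Let $V$ be a finite, linearly ordered set of $n$ nodes, identified with their ids. Time proceeds in synchronous rounds $1,2,\dots$; a message sent in a round is in the recipient's channel at the beginning of the next round (in an arbitrary order) and is removed once it is read. A node $u$ has the variables: finite lists $u.L=(u.S_l(1),u.S_l(2),\dots)$ and $u.R=(u.S_r(1),u.S_r(2),\dots)$ of ids (left/right shortcuts; $u.S$ is the set of all their entries); an id $u.\mathit{flyID}$; a bit $u.\mathit{exit}$; integers $u.\mathit{vID},u.\textit{c-par},u.\textit{c-dist},u.\mathit{dist},u.t$; a set of ids $u.\textit{c-ids}$; and the set of ids held by a base algorithm $\mathcal A_0$. There is an edge $(u,v)$ in the communication graph if the id $v$ is in a variable or in a message in the channel of $u$. The initial configuration (round $1$) is arbitrary, except that its communication graph is weakly connected. "Memory" of $u$ means all ids of other nodes in its variables and its channel; *flushing* ids means handing them to $\mathcal A_0$; *rejecting* ids means sending RejFlyover to them and flushing them. A supervisor may, in every round, arbitrarily (also maliciously) send each node a request for a snapshot and an advice $(\mathit{par},\mathit{dist},\mathit{vID},\textit{c-par},\textit{c-dist})$. Put $\mathrm{prop}(u)$: $u.\mathit{vID}=1$,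 or $u.\mathit{vID}>1$ and $u.\mathit{flyID}\ne u$. $\mathrm{NextStop}_u(x)$ is undefined if $x<1$, $x=u.\mathit{vID}$, $u.S=\emptyset$, $u.\mathit{vID}<1$, or there is no shortcut in the direction of $x$ (right if $x>u.\mathit{vID}$, left otherwise); else it is a shortcut in that direction of a level $i$ minimizing $\lvert 2^{i-1}-\lvert x-u.\mathit{vID}\rvert\rvert$ (the first one in a fixed search if there are several). A timer limit $\theta\in\{0,1\}$ is fixed. **Protocol.** In every round each node $u$ does the following, in this order. 1. *Checks.* It sets $u.\mathit{exit}:=1$ if its channel contains RejFlyover, or one of these holds: $u.S=\emptyset$ and ($u.\textit{c-ids}\neq\emptyset$ or $u.\mathit{flyID}\ne u$); $u.L=\emptyset\ne u.R$ and ($u.\mathit{vID}\ne1$ or $u.\mathit{flyID}\neq u$); $u.L\ne\emptyset$ and $u.\mathit{vID}\le 1$; $u.\mathit{vID}=1$ and $u.\textit{c-dist}\ne0$; $u.\mathit{vID}>1$ and $u.\textit{c-dist}\le0$; $u.S\neq\emptyset$, $u.\mathit{vID}>1$ and $\mathrm{NextStop}_u(u.\textit{c-par})$ is undefined; $|u.\textit{c-ids}|>2$;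 $|u.\textit{c-ids}|=2$ and $u$ is greater than both or less than both elements. If now $u.\mathit{exit}=1$, it rejects $(u.S\cup\{u.\mathit{flyID}\}\cup u.\textit{c-ids})\setminus\{u\}$ and sets $u.L=u.R=u.\textit{c-ids}=\emptyset$, $u.\mathit{vID}=u.\textit{c-par}=0$, $u.\mathit{flyID}=u$, $u.\textit{c-dist}=-1$, $u.\mathit{exit}=0$. 2. *Tests.* It sends TestLine-R$(u)$ to $u.S_r(1)$ and TestLine-L$(u)$ to $u.S_l(1)$ (if they exist); for $i\le\min(|u.L|,|u.R|)$, FlyConst-R$(u.S_l(i),i,u)$ to $u.S_r(i)$ and FlyConst-L$(u.S_r(i),i,u)$ to $u.S_l(i)$; if $u.\mathit{vID}>1$ and $u.\mathit{flyID}\ne u$, TestCert$(u,u.\textit{c-par},u.\textit{c-dist})$ to $\mathrm{NextStop}_u(u.\textit{c-par})$; TestvID$(u.\mathit{vID}\pm2^{i-1})$ to $u.S_r(i)$, respectively $u.S_l(i)$, for all $i$; TestFlyID$(\bot)$ to its memory if $u.S=\emptyset$ and $u.\mathit{vID}=0$; and TestFlyID$(u.\mathit{flyID})$ to its memory except $u.\mathit{flyID}$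 if $\mathrm{prop}(u)$. 3. *Responses,* in this order of message types. TestLine-R$(s)$: set $\mathit{exit}:=1$ unless $u.L\ne\emptyset$ and $u.S_l(1)=s$; if $u.S=\emptyset$ or $u.\mathit{exit}=1$, reject $s$. FlyConst-R$(w,i,s)$: set $\mathit{exit}:=1$ if $u.L=\emptyset$, or $|u.L|\ge i$ and $u.S_l(i)\ne s$, or $|u.L|\ge i+1$ and $u.S_l(i+1)\ne w$; if $u.\mathit{exit}=0$ and $|u.L|<i$, flush $s,w$; if $u.\mathit{exit}=0$, $|u.L|=i$ and $u.S_l(i)=s$, set $u.S_l(i+1):=w$; if $u.S=\emptyset$ or $u.\mathit{exit}=1$, reject $s,w$. The L-versions are symmetric. TestCert$(w,x,d)$: set $\mathit{exit}:=1$ if $u.\mathit{vID}=x$ and $d-1\ne u.\textit{c-dist}$, or $u.\mathit{vID}\ne x$ and $\mathrm{NextStop}_u(x)$ is undefined; then, if $u.S=\emptyset$ or $u.\mathit{exit}=1$, reject $w$; else if $u.\mathit{vID}=x$, add $w$ to $u.\textit{c-ids}$ and send IntroCert$(u)$ to $w$; else forward the message to $\mathrm{NextStop}_u(x)$ if $\mathrm{prop}(u)$,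 and flush $w$ if not. IntroCert$(w)$: add $w$ to $u.\textit{c-ids}$. TestvID$(x)$: set $\mathit{exit}:=1$ if $u.S=\emptyset$ or $u.\mathit{vID}\ne x$. TestFlyID$(f)$: if $u.L\ne\emptyset$, $u.\mathit{exit}=0$, $u.\mathit{flyID}=u$ and $f\ne\bot$, set $u.\mathit{flyID}:=f$; then set $\mathit{exit}:=1$ if $u.S\ne\emptyset$ and $u.\mathit{flyID}\ne f$, or $u.S=\emptyset$ and $f\ne\bot$; if $u.\mathit{exit}=1$, reject $f$ (if $f\ne\bot$). 4. *Advice.* (Call $u$ *free* if $u.S=\emptyset$ and $u.\mathit{exit}=0$.) The timer $u.t$ is cut off to $[0,5]$ and decremented if positive; if then $u.t\le\theta$ and ($u.S=\emptyset$ or $u.\mathit{exit}=1$), set $u.\mathit{vID}:=0$. If $u$ is free, $u.t=0$ and a snapshot is requested, set $u.t:=5$ and, for every id $v$ held by $\mathcal A_0$ (including its messages), send Intro$(u)$ to $v$ and Intro$(v)$ to itself. Let $\mathit{snap}$ be the set of ids in the received Intro messages. If $u$ is free, $u.t=4$ and an advice arrives with $\textit{c-par}\ge0$ and either $\mathit{par}=\bot,\mathit{dist}=0,\mathit{vID}=1,\textit{c-dist}=0$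 or $\mathit{par}\in\mathit{snap}$, $\mathit{dist}>0,\mathit{vID}>1,\textit{c-dist}>0$, then $u$ adopts these values of $\mathit{dist},\mathit{vID},\textit{c-par},\textit{c-dist}$ and sends TestAdvice$(u.\mathit{dist},u)$ to $\mathit{par}$ (if $\mathit{par}\ne\bot$). It flushes $\mathit{snap}$. Let $u_1<\dots<u_q$ be the ids $v$ in the received messages TestAdvice$(d,v)$. If $u$ is free, $u.t>1$, $q\ge1$ and $d=u.\mathit{dist}+1$ in all of them, it sends Verified(parent, $u$) to all $u_j$, Verified(sib+, $u_{j+1}$) to $u_j$, Verified(sib$-$, $u_j$) to $u_{j+1}$, and Verified(child, $u_j$) to itself. It flushes the $u_j$. If $u$ is free, $u.t>1$, exactly one Verified(parent, $p$), at most one sib+ and at most one sib$-$ message have been received, and $u.\mathit{dist}\ge1$, let $y$ be the largest child id received if $u.\mathit{dist}$ is odd and the smallest if it is even ($y=u$ if there is none), and $x$ the sib+ id, respectively the sib$-$ id ($x=p$ if there is none); $u$ sends Path+$(y)$ to $x$ and Path$-(x)$ to $y$ if $u.\mathit{dist}$ is odd, and Path$-(y)$ to $x$ and Path+$(x)$ to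 $y$ if it is even. It flushes all ids of Verified messages. Finally, if $u$ is free, $u.t>\theta$, at most one Path$-(a)$ and at most one Path+$(b)$ have been received, and no Path$-$ if $u.\mathit{vID}=1$, it sets $u.L:=(a)$ and $u.R:=(b)$ (empty if there is no such message); it flushes all ids of Path messages. 5. *Base algorithm.* $\mathcal A_0$ is an arbitrary algorithm that works by the universal primitives with Delegate-after-Reversal. It holds the set $M$ of the ids $\neq u$ in its variables (including flushed ids), in its ordinary received messages and in $u.\textit{c-ids}$, and performs any finite sequence of the steps: *introduction* (send any ids from $M\cup\{u\}$ to some $v\in M$); *reversal* (send $u$ to $v\in M$ and delete $v$ from $M$); *delegation* of $w_1,\dots,w_k\in M\setminus\{v\}$ to $v\in M$ (send Rev$(v;w_2,\dots,w_k)$ to $w_1$ and Rev$(v;)$ to $w_2,\dots,w_k$, and delete some of the $w_i$ from $M$). Every received message Rev$(v;w_2,\dots)$ is answered by sending the ids $u,w_2,\dots$ to $v$. **Backbones.** A set $B\subseteq V$ with $|B|\ge2$ is a *backbone* in round $r$ if it can be written as $\{v_1,\dots,v_{|B|}\}$ such that, at the beginning of round $r$, $v_i.S_r(1)=v_{i+1}$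 and $v_{i+1}.S_l(1)=v_i$ for all $1\le i<|B|$, ($v_1.L=\emptyset$ or $v_1.S_l(1)\notin B$), and ($v_{|B|}.R=\emptyset$ or $v_{|B|}.S_r(1)\notin B$). It is *maximal* if $B\cup\{u\}$ is not a backbone for any $u\in V\setminus B$. **Lemma.** There is an absolute constant $K$ such that the following holds for every $V$, every initial configuration with weakly connected communication graph, every behaviour of the supervisor and of the base algorithm, and both $\theta\in\{0,1\}$. If $r>5$ and $B$ is a maximal backbone in round $r$ with $|B|<n$, then there are a node $u\in B$ and a round $r'$ with $r\le r'\le r+K\lfloor\log_2 n\rfloor$ such that $u.\mathit{exit}$ has the value $1$ at some moment of round $r'$ (after the checks of that round or at its end). The same holds if $\mathrm{prop}(u)$ requires in addition $u.S\ne\emptyset$ in the case $u.\mathit{vID}=1$. -/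

import Mathlib

namespace Flyover

/-- The two directions along a path. -/
inductive Side
  | left
  | right
  deriving DecidableEq

/-- The opposite direction. -/
def Side.opp : Side → Side
  | .left => .right
  | .right => .left

/-- The relation reported by a `Verified` message: parent, next larger sibling (`sib+`), next
smaller sibling (`sib-`), child. -/
inductive Kin
  | parent
  | sibUp
  | sibDown
  | child
  deriving DecidableEq

/-- Messages between nodes; `V` is the set of node ids. `testLine .right`, `flyConst .right` and
`path .right` are the messages TestLine-R, FlyConst-R and Path+; with `.left` they are TestLine-L,
FlyConst-L and Path-. The number in `flyConst` is the shortcut level minus one. `testFlyID none`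
carries the symbol `⊥`. The last two constructors are the messages of the base algorithm:
`base ids` is any message whose ids are `ids`, and `rev v ws`, sent to a node `w`, asks `w` to send
the message with ids `w :: ws` to `v`. -/
inductive Msg (V : Type*)
  | rejFlyover
  | testLine (d : Side) (sen : V)
  | flyConst (d : Side) (w : V) (i : ℕ) (sen : V)
  | testCert (w : V) (vID : ℤ) (dist : ℤ)
  | introCert (w : V)
  | testvID (vID : ℤ)
  | testFlyID (flyID : Option V)
  | intro (v : V)
  | testAdvice (dist : ℤ) (v : V)
  | verified (k : Kin) (v : V)
  | path (d : Side) (v : V)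
  | base (ids : List V)
  | rev (v : V) (ws : List V)

/-- The node ids contained in a message. -/
def Msg.ids {V : Type*} : Msg V → List V
  | .rejFlyover => []
  | .testLine _ sen => [sen]
  | .flyConst _ w _ sen => [w, sen]
  | .testCert w _ _ => [w]
  | .introCert w => [w]
  | .testvID _ => []
  | .testFlyID f => f.toList
  | .intro v => [v]
  | .testAdvice _ v => [v]
  | .verified _ v => [v]
  | .path _ v => [v]
  | .base ids => ids
  | .rev v ws => v :: ws

/-- The node ids contained in a message of the base algorithm. -/
def Msg.baseIds {V : Type*} : Msg V → List V
  | .base ids => ids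
  | .rev v ws => v :: ws
  | _ => []

/-- An advice message of the supervisor. -/
structure Advice (V : Type*) where
  par : Option V
  dist : ℤ
  vID : ℤ
  cPar : ℤ
  cDist : ℤ

/-- What the (possibly malicious) supervisor sends to one node in one round: possibly a request for
a snapshot and possibly an advice message. Its messages are not part of the communication graph, and
an id in an advice is used only if the node has received it from a node. -/
structure Supervision (V : Type*) where
  request : Bool
  advice : Option (Advice V)

/-- The variables of a node. `sc .left` and `sc .right` list the left and right shortcuts by level,
so that the `i`-level shortcut has index `i - 1`; `base` is the set of ids that are stored in the
address variables of the base algorithm. -/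
structure Node (V : Type*) where
  sc : Side → List V
  vID : ℤ
  flyID : V
  exit : Bool
  cPar : ℤ
  cDist : ℤ
  cIds : Finset V
  t : ℤ
  dist : ℤ
  base : Finset V

/-- A configuration: the variables and the channel of every node. -/
structure Config (V : Type*) where
  node : V → Node V
  ch : V → List (Msg V)

/-- Two places of the protocol in which two readings are covered. A node accepts `Path` messages
while its timer exceeds `joinLimit`, and resets its virtual id outside a flyover when the timer is
at most `joinLimit`. If `rootDual` holds, a node with virtual id `1` announces its flyover id only
if it has a shortcut. -/
structure Variant where
  joinLimit : ℤ
  rootDual : Bool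

/-- Messages that have been sent, with their recipients. -/
abbrev Out (V : Type*) := Multiset (V × Msg V)

section Protocol

variable {V : Type*} [LinearOrder V]

/-- The set `S` of all shortcuts. -/
def Node.S (s : Node V) : Finset V := (s.sc .left ++ s.sc .right).toFinset

/-- The ids in the channel. -/
def chIds (ch : List (Msg V)) : Finset V := (ch.flatMap Msg.ids).toFinset

/-- The ids in the part of the channel that belongs to the base algorithm. -/
def chBaseIds (ch : List (Msg V)) : Finset V := (ch.flatMap Msg.baseIds).toFinset

/-- The ids stored in address variables. -/
def Node.addr (s : Node V) : Finset V := s.S ∪ {s.flyID} ∪ s.cIds ∪ s.base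

/-- All ids of other nodes in the memory of `u`, including the channel. -/
def memory (u : V) (s : Node V) (ch : List (Msg V)) : Finset V := (s.addr ∪ chIds ch).erase u

/-- The operation Flush: hand ids over to the base algorithm. -/
def flush (u : V) (ids : Finset V) (s : Node V) : Node V :=
  { s with base := s.base ∪ ids.erase u }

/-- Send `m` to all ids in a set. -/
def sendAll (ids : Finset V) (m : Msg V) : Out V := ids.val.map fun v => (v, m)

/-- Send a list of messages. -/
def sendList (l : List (V × Msg V)) : Out V := l

/-- Reject and flush the given ids. -/
def sendRejFly (u : V) (ids : Finset V) (a : Node V × Out V) : Node V × Out V :=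
  (flush u ids a.1, a.2 + sendAll ids .rejFlyover)

/-- The shortcut in `l` whose distance `2 ^ i` is closest to `d`. -/
def closest (l : List V) (d : ℤ) : Option V :=
  ((List.range l.length).argmin fun i => ((2 : ℤ) ^ i - d).natAbs).bind fun i => l[i]?

/-- The next stop on the way to virtual id `val`. -/
def nextStop (s : Node V) (val : ℤ) : Option V :=
  if val < 1 ∨ val = s.vID ∨ s.S = ∅ ∨ s.vID < 1 then none
  else if s.vID < val then closest (s.sc .right) (val - s.vID)
  else closest (s.sc .left) (s.vID - val)

/-- The node is to propagate its flyover id. -/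
def propFlyID (var : Variant) (u : V) (s : Node V) : Prop :=
  (s.vID = 1 ∧ (var.rootDual = true → s.S ≠ ∅)) ∨ (1 < s.vID ∧ s.flyID ≠ u)

instance (var : Variant) (u : V) (s : Node V) : Decidable (propFlyID var u s) := by
  unfold propFlyID; infer_instance

/-! ### Init -/

/-- The function BasicChecks. -/
def basicChecks (u : V) (s : Node V) (ch : List (Msg V)) : Node V :=
  if (∃ m ∈ ch, m matches .rejFlyover)
      ∨ (s.S = ∅ ∧ (s.cIds ≠ ∅ ∨ s.flyID ≠ u))
      ∨ (s.sc .left = [] ∧ s.sc .right ≠ [] ∧ (s.vID ≠ 1 ∨ s.flyID ≠ u))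
      ∨ (s.sc .left ≠ [] ∧ s.vID ≤ 1)
      ∨ (s.vID = 1 ∧ s.cDist ≠ 0) ∨ (1 < s.vID ∧ s.cDist ≤ 0)
      ∨ (s.S ≠ ∅ ∧ 1 < s.vID ∧ nextStop s s.cPar = none)
      ∨ 2 < s.cIds.card
      ∨ (s.cIds.card = 2 ∧ ((∀ v ∈ s.cIds, v < u) ∨ (∀ v ∈ s.cIds, u < v)))
  then { s with exit := true } else s

/-- The function RejectFlyover. -/
def rejectFlyover (u : V) (s : Node V) : Node V × Out V :=
  if s.exit then
    let a := sendRejFly u ((s.S ∪ {s.flyID} ∪ s.cIds).erase u) (s, 0)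
    ({ a.1 with
        sc := fun _ => [], vID := 0, flyID := u, exit := false, cPar := 0, cDist := -1,
        cIds := ∅ }, a.2)
  else (s, 0)

/-! ### Tests -/

/-- The function TestFlyoverConstruction. -/
def testFlyoverConstruction (u : V) (s : Node V) : Out V :=
  sendList ((s.sc .right).head?.toList.map fun v => (v, .testLine .right u))
  + sendList ((s.sc .left).head?.toList.map fun v => (v, .testLine .left u))
  + sendList (((s.sc .left).zip (s.sc .right)).zipIdx.map fun x =>
      (x.1.2, .flyConst .right x.1.1 x.2 u))
  + sendList (((s.sc .left).zip (s.sc .right)).zipIdx.map fun x =>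
      (x.1.1, .flyConst .left x.1.2 x.2 u))

/-- The function TestConnCertificate. -/
def testConnCertificate (u : V) (s : Node V) : Out V :=
  if 1 < s.vID ∧ s.flyID ≠ u then
    sendList ((nextStop s s.cPar).toList.map fun v => (v, .testCert u s.cPar s.cDist))
  else 0

/-- The function TestFlyoverMetadata. -/
def testFlyoverMetadata (var : Variant) (u : V) (s : Node V) (ch : List (Msg V)) : Out V :=
  sendList ((s.sc .right).zipIdx.map fun x => (x.1, .testvID (s.vID + 2 ^ x.2)))
  + sendList ((s.sc .left).zipIdx.map fun x => (x.1, .testvID (s.vID - 2 ^ x.2)))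
  + (if s.S = ∅ ∧ s.vID = 0 then sendAll (memory u s ch) (.testFlyID none) else 0)
  + (if propFlyID var u s then
      sendAll ((memory u s ch).erase s.flyID) (.testFlyID (some s.flyID)) else 0)

/-! ### Responses -/

/-- Response to TestLine. -/
def onTestLine (u : V) (a : Node V × Out V) : Msg V → Node V × Out V
  | .testLine d sen =>
    let s := if (a.1.sc d.opp).head? ≠ some sen then { a.1 with exit := true } else a.1
    if s.S = ∅ ∨ s.exit then sendRejFly u {sen} (s, a.2) else (s, a.2)
  | _ => a

/-- Response to FlyConst. -/
def onFlyConst (u : V) (a : Node V × Out V) : Msg V → Node V × Out V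
  | .flyConst d w i sen =>
    let l := a.1.sc d.opp
    let s := if l = [] ∨ (i < l.length ∧ l[i]? ≠ some sen)
        ∨ (i + 1 < l.length ∧ l[i + 1]? ≠ some w) then { a.1 with exit := true } else a.1
    let s := if s.exit = false ∧ l.length < i + 1 then flush u {sen, w} s else s
    let s := if s.exit = false ∧ l.length = i + 1 ∧ l[i]? = some sen then
        { s with sc := Function.update s.sc d.opp (l ++ [w]) } else s
    if s.S = ∅ ∨ s.exit then sendRejFly u {sen, w} (s, a.2) else (s, a.2)
  | _ => a

/-- Response to TestCert. -/
def onTestCert (var : Variant) (u : V) (a : Node V × Out V) : Msg V → Node V × Out V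
  | .testCert w val dist =>
    let s := if (a.1.vID = val ∧ dist - 1 ≠ a.1.cDist)
        ∨ (a.1.vID ≠ val ∧ nextStop a.1 val = none) then { a.1 with exit := true } else a.1
    if s.S = ∅ ∨ s.exit then sendRejFly u {w} (s, a.2)
    else if s.vID = val then
      ({ s with cIds := insert w s.cIds }, a.2 + {(w, .introCert u)})
    else if propFlyID var u s then
      (s, a.2 + sendList ((nextStop s val).toList.map fun v => (v, .testCert w val dist)))
    else (flush u {w} s, a.2)
  | _ => a

/-- Response to IntroCert. -/
def onIntroCert (a : Node V × Out V) : Msg V → Node V × Out V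
  | .introCert w => ({ a.1 with cIds := insert w a.1.cIds }, a.2)
  | _ => a

/-- Response to TestvID. -/
def onTestvID (a : Node V × Out V) : Msg V → Node V × Out V
  | .testvID x => (if a.1.S = ∅ ∨ a.1.vID ≠ x then { a.1 with exit := true } else a.1, a.2)
  | _ => a

/-- Response to TestFlyID. -/
def onTestFlyID (u : V) (a : Node V × Out V) : Msg V → Node V × Out V
  | .testFlyID f =>
    let s := if a.1.sc .left ≠ [] ∧ a.1.exit = false ∧ a.1.flyID = u then
        { a.1 with flyID := f.getD u } else a.1
    let s := if (s.S ≠ ∅ ∧ some s.flyID ≠ f) ∨ (s.S = ∅ ∧ f ≠ none) then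
        { s with exit := true } else s
    if s.exit then sendRejFly u f.toFinset (s, a.2) else (s, a.2)
  | _ => a

/-- All responses, in order; each one goes through the channel. -/
def respond (var : Variant) (u : V) (ch : List (Msg V)) (a : Node V × Out V) : Node V × Out V :=
  let a := ch.foldl (onTestLine u) a
  let a := ch.foldl (onFlyConst u) a
  let a := ch.foldl (onTestCert var u) a
  let a := ch.foldl onIntroCert a
  let a := ch.foldl onTestvID a
  ch.foldl (onTestFlyID u) a

/-! ### Interaction with the supervisor and distributed Tree-to-Path -/

/-- The function BasicChecks2. -/
def basicChecks2 (var : Variant) (s : Node V) : Node V :=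
  let t := if 5 < s.t then 5 else if s.t < 0 then 0 else s.t
  let t := if 0 < t then t - 1 else t
  { s with t := t, vID := if t ≤ var.joinLimit ∧ (s.S = ∅ ∨ s.exit) then 0 else s.vID }

/-- The function SnapshotReq. (What the node reports to the supervisor is not recorded, since the
supervisor is arbitrary.) -/
def snapshotReq (u : V) (sup : Supervision V) (ch : List (Msg V)) (a : Node V × Out V) :
    Node V × Out V :=
  let s := a.1
  if s.S = ∅ ∧ s.exit = false ∧ s.t = 0 ∧ sup.request then
    let snap := (s.base ∪ chBaseIds ch).erase u
    ({ s with t := 5 }, a.2 + sendAll snap (.intro u) + snap.val.map (fun v => (u, .intro v)))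
  else a

/-- Well-formed advice, relative to the ids `snap`. -/
def Advice.WellFormed (adv : Advice V) (snap : Finset V) : Prop :=
  (match adv.par with
    | none => adv.dist = 0 ∧ adv.vID = 1 ∧ adv.cDist = 0
    | some p => p ∈ snap ∧ 0 < adv.dist ∧ 1 < adv.vID ∧ 0 < adv.cDist) ∧ 0 ≤ adv.cPar

instance (adv : Advice V) (snap : Finset V) : Decidable (adv.WellFormed snap) := by
  unfold Advice.WellFormed; cases adv.par <;> infer_instance

/-- The function GetAdvice. -/
def getAdvice (u : V) (sup : Supervision V) (ch : List (Msg V)) (a : Node V × Out V) :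
    Node V × Out V :=
  let snap := (ch.flatMap fun m => match m with | .intro v => [v] | _ => []).toFinset
  let b := match sup.advice with
    | some adv =>
      if a.1.S = ∅ ∧ a.1.exit = false ∧ a.1.t = 4 ∧ adv.WellFormed snap then
        ({ a.1 with vID := adv.vID, cPar := adv.cPar, cDist := adv.cDist, dist := adv.dist },
          a.2 + sendList (adv.par.toList.map fun p => (p, .testAdvice adv.dist u)))
      else a
    | none => a
  (flush u snap b.1, b.2)

/-- The messages sent by the function SetupLocalTransform. -/
def setupLocalTransform (u : V) (children : Finset V) : Out V :=
  let c := children.sort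
  sendAll children (.verified .parent u)
  + sendList ((c.zip c.tail).map fun x => (x.1, .verified .sibUp x.2))
  + sendList ((c.zip c.tail).map fun x => (x.2, .verified .sibDown x.1))
  + children.val.map (fun w => (u, .verified .child w))

/-- The function CertifyTree. -/
def certifyTree (u : V) (ch : List (Msg V)) (a : Node V × Out V) : Node V × Out V :=
  let l := ch.flatMap fun m => match m with | .testAdvice dist v => [(dist, v)] | _ => []
  let children := (l.map Prod.snd).toFinset
  let out := if a.1.S = ∅ ∧ a.1.exit = false ∧ 1 < a.1.t ∧ (∀ x ∈ l, a.1.dist = x.1 - 1)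
      ∧ children ≠ ∅ then setupLocalTransform u children else 0
  (flush u children a.1, a.2 + out)

/-- The messages sent by the function ExecuteTransform. -/
def executeTransform (u : V) (s : Node V) (parent : V) (rsib lsib : Option V)
    (children : Finset V) : Out V :=
  let c := children.sort
  if s.dist ≠ 0 ∧ s.dist % 2 = 1 then
    let x := rsib.getD parent
    let y := c.getLast?.getD u
    {(x, .path .right y), (y, .path .left x)}
  else if s.dist ≠ 0 ∧ s.dist % 2 = 0 then
    let x := lsib.getD parent
    let y := c.head?.getD u
    {(x, .path .left y), (y, .path .right x)}
  else 0

/-- The local variables of LocalTransform. -/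
structure LT (V : Type*) where
  ignore : Bool
  parent : Option V
  rsib : Option V
  lsib : Option V
  children : Finset V

/-- LocalTransform: processing one message. -/
def LT.step (x : LT V) : Msg V → LT V
  | .verified k v =>
    let ig := x.ignore || match k with
      | .parent => x.parent.isSome
      | .sibDown => x.lsib.isSome
      | .sibUp => x.rsib.isSome
      | .child => false
    if ig then { x with ignore := true, children := insert v x.children }
    else match k with
      | .parent => { x with parent := some v }
      | .sibDown => { x with lsib := some v }
      | .sibUp => { x with rsib := some v }
      | .child => { x with children := insert v x.children }
  | _ => x

/-- The function LocalTransform. -/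
def localTransform (u : V) (ch : List (Msg V)) (a : Node V × Out V) : Node V × Out V :=
  let s := a.1
  let x := ch.foldl LT.step
    ⟨decide (¬ (s.S = ∅ ∧ s.exit = false ∧ 1 < s.t)), none, none, none, ∅⟩
  let out := match x.parent with
    | some p => if x.ignore = false ∧ 1 ≤ s.dist then
        executeTransform u s p x.rsib x.lsib x.children else 0
    | none => 0
  (flush u (x.parent.toFinset ∪ x.rsib.toFinset ∪ x.lsib.toFinset ∪ x.children) s, a.2 + out)

/-- The local variables of JoinPath; `fly .left` and `fly .right` are flyL and flyR, and `rest`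
collects the ids of ignored messages. -/
structure JP (V : Type*) where
  ignore : Bool
  fly : Side → Option V
  rest : Finset V

/-- JoinPath: processing one message. -/
def JP.step (s : Node V) (x : JP V) : Msg V → JP V
  | .path d v =>
    if x.ignore ∨ (x.fly d).isSome ∨ (d = .left ∧ s.vID = 1) then
      { x with ignore := true, rest := insert v x.rest }
    else { x with fly := Function.update x.fly d (some v) }
  | _ => x

/-- The function JoinPath. -/
def joinPath (var : Variant) (u : V) (ch : List (Msg V)) (s : Node V) : Node V :=
  let x := ch.foldl (JP.step s)
    ⟨decide (¬ (s.S = ∅ ∧ s.exit = false ∧ var.joinLimit < s.t)), fun _ => none, ∅⟩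
  let s' := if x.ignore then s else { s with sc := fun d => (x.fly d).toList }
  flush u ((x.fly .left).toFinset ∪ (x.fly .right).toFinset ∪ x.rest) s'

/-! ### The base algorithm -/

/-- `BaseRun u M out M'`: by finitely many universal primitives, with Delegate-after-Reversal in
place of delegation, node `u` transforms the set `M` of ids of other nodes held by its base
algorithm into `M'` and sends `out`. (Fusion of duplicates is implicit, since `M` is a set.) -/
inductive BaseRun (u : V) : Finset V → Out V → Finset V → Prop
  | refl (M : Finset V) : BaseRun u M 0 M
  /-- Introduction: send to `v` some ids, possibly including the own one, and keep everything. -/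
  | introduce {M M' : Finset V} {out : Out V} (v : V) (ids : List V) (hv : v ∈ M)
      (hids : ∀ w ∈ ids, w = u ∨ w ∈ M) (h : BaseRun u M out M') :
      BaseRun u M ((v, .base ids) ::ₘ out) M'
  /-- Delegate-after-Reversal of the edges to `w :: ws` to the node `v`, which is kept. (A delegated
  id need not be dropped, since it may have been stored twice.) -/
  | delegate {M M' M₁ : Finset V} {out : Out V} (v w : V) (ws : List V) (hv : v ∈ M)
      (hw : ∀ x ∈ w :: ws, x ∈ M ∧ x ≠ v) (hsub : M₁ ⊆ M)
      (hkeep : ∀ x ∈ M, x ∉ w :: ws → x ∈ M₁) (h : BaseRun u M₁ out M') :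
      BaseRun u M ((w, .rev v ws) ::ₘ
        (sendList (ws.map fun x => (x, .rev v [])) + out)) M'
  /-- Reversal: replace the edge to `v` by an edge from `v`. -/
  | reverse {M M' : Finset V} {out : Out V} (v : V) (hv : v ∈ M)
      (h : BaseRun u (M.erase v) out M') : BaseRun u M ((v, .base [u]) ::ₘ out) M'

/-- The ids held by the base algorithm of `u` when it starts: its address variables, the ids in
ordinary messages of the base algorithm, and the advised neighbors. -/
def basePool (u : V) (s : Node V) (ch : List (Msg V)) : Finset V :=
  (s.base ∪ s.cIds
    ∪ (ch.flatMap fun m => match m with | .base ids => ids | _ => []).toFinset).erase u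

/-- The second half of Delegate-after-Reversal: the answers to messages `rev`. -/
def revReplies (u : V) (ch : List (Msg V)) : Out V :=
  sendList (ch.flatMap fun m => match m with | .rev v ws => [(v, .base (u :: ws))] | _ => [])

/-! ### Rounds -/

/-- The part of a round that precedes the base algorithm. -/
def localRound (var : Variant) (u : V) (sup : Supervision V) (s : Node V) (ch : List (Msg V)) :
    Node V × Out V :=
  let a := rejectFlyover u (basicChecks u s ch)
  let a := (a.1, a.2 + testFlyoverConstruction u a.1 + testConnCertificate u a.1
    + testFlyoverMetadata var u a.1 ch)
  let a := respond var u ch a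
  let a := snapshotReq u sup ch (basicChecks2 var a.1, a.2)
  let a := getAdvice u sup ch a
  let a := certifyTree u ch a
  let a := localTransform u ch a
  (joinPath var u ch a.1, a.2)

/-- One synchronous round: `C'` may follow `C`. The base algorithm is an arbitrary one that works by
the universal primitives, so its moves are not determined; the messages that are sent in this round
form the channels of the next one, in an arbitrary order. -/
def Step [Fintype V] (var : Variant) (sup : V → Supervision V) (C C' : Config V) : Prop :=
  ∃ out : V → Out V,
    (∀ u, ∃ base',
      BaseRun u (basePool u (localRound var u (sup u) (C.node u) (C.ch u)).1 (C.ch u)) (out u) base'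
      ∧ C'.node u = { (localRound var u (sup u) (C.node u) (C.ch u)).1 with base := base' }) ∧
    ∀ v, (C'.ch v : Multiset (Msg V)) =
      ((∑ u, ((localRound var u (sup u) (C.node u) (C.ch u)).2 + revReplies u (C.ch u)
        + out u)).filter (fun x => x.1 = v)).map Prod.snd

/-- The communication graph, without directions. -/
def commGraph (C : Config V) : SimpleGraph V :=
  SimpleGraph.fromRel fun u v => v ∈ (C.node u).addr ∪ chIds (C.ch u)

/-- `C` is an execution: `C r` is the configuration at the beginning of round `r ≥ 1`, the initial
communication graph is weakly connected, and everything else about `C 1` is arbitrary. -/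
structure IsExecution [Fintype V] (var : Variant) (sup : ℕ → V → Supervision V)
    (C : ℕ → Config V) : Prop where
  connected : (commGraph (C 1)).Connected
  step : ∀ r, 1 ≤ r → Step var (sup r) (C r) (C (r + 1))

/-- `B` is a backbone. -/
def IsBackbone (C : Config V) (B : Finset V) : Prop :=
  2 ≤ B.card ∧ ∃ l : List V, l.Nodup ∧ l.toFinset = B ∧
    (∀ a ∈ l.head?, ∀ x ∈ ((C.node a).sc .left).head?, x ∉ B) ∧
    (∀ a ∈ l.getLast?, ∀ x ∈ ((C.node a).sc .right).head?, x ∉ B) ∧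
    l.IsChain fun a b =>
      ((C.node a).sc .right).head? = some b ∧ ((C.node b).sc .left).head? = some a

/-- `B` is a maximal backbone. -/
def IsMaximalBackbone (C : Config V) (B : Finset V) : Prop :=
  IsBackbone C B ∧ ∀ u ∉ B, ¬ IsBackbone C (insert u B)

/-- The variable exit of `u` has the value `1` at some moment of round `r`: when RejectFlyover tests
it, or at the end of the round. -/
def ExitSet (C : ℕ → Config V) (r : ℕ) (u : V) : Prop :=
  (basicChecks u ((C r).node u) ((C r).ch u)).exit = true ∨ ((C (r + 1)).node u).exit = true

end Protocol

end Flyover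

set_option linter.unusedSectionVars false
set_option linter.unnecessarySeqFocus false

namespace Flyover

variable {V : Type*} [LinearOrder V]

/-! Suppose that no node of the maximal backbone `B` exits in the rounds from `r` to `r + 61 log n`.
It is shown that then `B` contains all nodes. Put `L = log n + 1`.

Living nodes are consistent. An exiting node rejects its shortcuts and its flyover id, which
therefore exit within two rounds (`exitSet_of_exitSet`). Conversely, a node with a living shortcut
lives almost as long (`AliveOn.of_mem_S`), even if it is not in `B`. The neighbor relation of a
living node is symmetric in the same round (`head_symm`). This is where `r > 5` enters: messages of
the joining phase are traced back through the preceding rounds to show that two neighbors cannot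
have joined in successive rounds.

A living node has a root. The FlyConst messages double the length of the shortcuts every two rounds,
and the tests of virtual ids show that a shortcut of length `2 ^ i` changes the virtual id by `2 ^
i` (`exists_shortcut`). Decomposing a distance in binary gives a living node at every smaller
positive virtual id, reached by at most `L` jumps, and flyover ids travel back along these jumps
(`exists_left`). By pigeonhole virtual ids are at most `n`, so every long-living node is reached
from a node with virtual id `1`, which has no left neighbor and whose id becomes the flyover id
(`exists_root`).

Thus `B` is a complete line: a further neighbor of an end would extend `B`, unless it closed a
cycle, and a cycle has no root (`exists_line`). After `4L` rounds all of `B` carries the id of its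
left end as flyover id (`exists_settled`).

A settled flyover is isolated. No outside node with shortcuts can keep a flyover id from `B`, since
its own root would then lie in `B` (`not_flyID_mem`); so an id of an outside node known in `B` leads
to a rejection (`known_subset`). An outside node `z` that knows a node of `B` must neither exit, nor
be free without virtual id, nor announce a flyover id, for each of these would make a node of `B`
exit (`of_known`). Under these restrictions `z` cannot get rid of its ids from `B`: certificates are
not forwarded, and a universal primitive would reveal `z` or another outsider to `B`
(`exists_known_succ`). But a node with shortcuts eventually announces its root (`not_known_of_S`),
and one without them loses its virtual id when its timer expires, unless it gets shortcuts first
(`not_known`).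

Finally, no id is lost in a round (`conservation`), so the communication graph stays connected
(`connected_of_le`). If `B` were proper, some edge would have to cross its boundary, contrary to
isolation. -/

theorem Node.mem_S {s : Node V} {x : V} : x ∈ s.S ↔ ∃ d, x ∈ s.sc d := by
  simp only [Node.S, List.mem_toFinset, List.mem_append]
  constructor
  · rintro (h | h)
    exacts [⟨_, h⟩, ⟨_, h⟩]
  · rintro ⟨d, h⟩
    cases d
    exacts [.inl h, .inr h]

theorem Node.S_eq_empty {s : Node V} : s.S = ∅ ↔ ∀ d, s.sc d = [] := by
  rw [Finset.eq_empty_iff_forall_notMem]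
  simp only [Node.mem_S, not_exists, List.eq_nil_iff_forall_not_mem]
  exact forall_comm

theorem Node.S_ne_empty {s : Node V} : s.S ≠ ∅ ↔ ∃ d, s.sc d ≠ [] := by
  rw [Ne, Node.S_eq_empty, not_forall]

theorem Node.S_congr {s s' : Node V} (h : s'.sc = s.sc) : s'.S = s.S := by
  simp [Node.S, h]

/-! ### Monotonicity of the response phase -/

/-- How the state and the sent messages of `u` may develop while `u` responds to messages. -/
structure Ext (u : V) (a b : Node V × Out V) : Prop where
  sc : ∀ d, a.1.sc d <+: b.1.sc d
  nil : ∀ d, a.1.sc d = [] → b.1.sc d = []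
  vID : b.1.vID = a.1.vID
  t : b.1.t = a.1.t
  dist : b.1.dist = a.1.dist
  exit : a.1.exit = true → b.1.exit = true
  base : a.1.base ⊆ b.1.base
  cIds : a.1.cIds ⊆ b.1.cIds
  flyID : b.1.flyID = a.1.flyID ∨ (a.1.flyID = u ∧ a.1.sc .left ≠ [])
  out : ∀ x ∈ a.2, x ∈ b.2

theorem Ext.refl (u : V) (a : Node V × Out V) : Ext u a a :=
  ⟨fun _ => List.prefix_rfl, fun _ h => h, rfl, rfl, rfl, id, subset_rfl, subset_rfl, .inl rfl,
    fun _ h => h⟩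

theorem Ext.trans {u : V} {a b c : Node V × Out V} (h : Ext u a b) (k : Ext u b c) : Ext u a c where
  sc d := (h.sc d).trans (k.sc d)
  nil d hd := k.nil d (h.nil d hd)
  vID := k.vID.trans h.vID
  t := k.t.trans h.t
  dist := k.dist.trans h.dist
  exit e := k.exit (h.exit e)
  base := h.base.trans k.base
  cIds := h.cIds.trans k.cIds
  flyID := by
    rcases h.flyID with e | e
    · rcases k.flyID with e' | ⟨e', e''⟩
      · exact .inl (e'.trans e)
      · exact .inr ⟨e ▸ e', fun hn => e'' (h.nil _ hn)⟩
    · exact .inr e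
  out x hx := k.out x (h.out x hx)

theorem Ext.S_subset {u : V} {a b : Node V × Out V} (h : Ext u a b) : a.1.S ⊆ b.1.S := by
  intro x hx
  obtain ⟨d, hd⟩ := Node.mem_S.1 hx
  exact Node.mem_S.2 ⟨d, (h.sc d).subset hd⟩

theorem Ext.S_eq_empty {u : V} {a b : Node V × Out V} (h : Ext u a b) :
    b.1.S = ∅ ↔ a.1.S = ∅ := by
  constructor
  · intro hb
    exact Finset.subset_empty.1 (hb ▸ h.S_subset)
  · intro ha
    exact Node.S_eq_empty.2 fun d => h.nil d (Node.S_eq_empty.1 ha d)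

/-- The only stored id that can be overwritten by a response is the flyover id, and only if it is
the node's own id; ids of other nodes stay. -/
theorem Ext.addr {u v : V} {a b : Node V × Out V} (h : Ext u a b) (hv : v ≠ u)
    (ha : v ∈ a.1.addr) : v ∈ b.1.addr := by
  simp only [Node.addr, Finset.mem_union, Finset.mem_singleton] at ha ⊢
  rcases ha with ((ha | ha) | ha) | ha
  · exact .inl (.inl (.inl (h.S_subset ha)))
  · rcases h.flyID with e | e
    · exact .inl (.inl (.inr (ha.trans e.symm)))
    · exact absurd (ha.trans e.1) hv
  · exact .inl (.inr (h.cIds ha))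
  · exact .inr (h.base ha)

theorem ext_setExit (u : V) (a : Node V × Out V) (p : Prop) [Decidable p] :
    Ext u a (if p then { a.1 with exit := true } else a.1, a.2) := by
  split_ifs
  · exact ⟨fun _ => List.prefix_rfl, fun _ h => h, rfl, rfl, rfl, fun _ => rfl, subset_rfl,
      subset_rfl, .inl rfl, fun _ h => h⟩
  · exact Ext.refl u a

theorem ext_flush (u : V) (a : Node V × Out V) (ids : Finset V) : Ext u a (flush u ids a.1, a.2) :=
  ⟨fun _ => List.prefix_rfl, fun _ h => h, rfl, rfl, rfl, id, Finset.subset_union_left,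
    subset_rfl, .inl rfl, fun _ h => h⟩

theorem ext_send (u : V) (a : Node V × Out V) (o : Out V) : Ext u a (a.1, a.2 + o) :=
  ⟨fun _ => List.prefix_rfl, fun _ h => h, rfl, rfl, rfl, id, subset_rfl,
    subset_rfl, .inl rfl, fun _ h => Multiset.mem_add.2 (.inl h)⟩

theorem ext_sendRejFly (u : V) (a : Node V × Out V) (ids : Finset V) :
    Ext u a (sendRejFly u ids a) :=
  (ext_flush u a ids).trans (ext_send u _ _)

theorem ext_onTestLine (u : V) (a : Node V × Out V) (m : Msg V) : Ext u a (onTestLine u a m) := by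
  cases m with
  | testLine d sen =>
    refine (ext_setExit u a ((a.1.sc d.opp).head? ≠ some sen)).trans ?_
    simp only [onTestLine]
    generalize (if (a.1.sc d.opp).head? ≠ some sen then { a.1 with exit := true } else a.1) = s
    split_ifs
    · exact ext_sendRejFly _ _ _
    · exact Ext.refl _ _
  | _ => exact Ext.refl _ _

/-- The successive updates are abstracted one at a time. The only change of a shortcut list is an
append, and it needs an entry at index `i`, so an empty list stays empty. -/
theorem ext_onFlyConst (u : V) (a : Node V × Out V) (m : Msg V) : Ext u a (onFlyConst u a m) := by
  cases m with
  | flyConst d w i sen =>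
    simp only [onFlyConst]
    set p := (a.1.sc d.opp = [] ∨ (i < (a.1.sc d.opp).length ∧ (a.1.sc d.opp)[i]? ≠ some sen)
        ∨ (i + 1 < (a.1.sc d.opp).length ∧ (a.1.sc d.opp)[i + 1]? ≠ some w)) with hp
    have h1 := ext_setExit u a p
    have hs1 : (if p then { a.1 with exit := true } else a.1).sc = a.1.sc := by split_ifs <;> rfl
    have he1 : (if p then { a.1 with exit := true } else a.1).exit = false → ¬ p := by
      split_ifs with h <;> simp [h]
    generalize (if p then { a.1 with exit := true } else a.1) = s1 at *
    refine h1.trans ?_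
    have h2 : Ext u (s1, a.2) (if s1.exit = false ∧ (a.1.sc d.opp).length < i + 1
        then flush u {sen, w} s1 else s1, a.2) := by
      split_ifs
      · exact ext_flush _ (s1, a.2) _
      · exact Ext.refl _ _
    have hs2 : (if s1.exit = false ∧ (a.1.sc d.opp).length < i + 1
        then flush u {sen, w} s1 else s1).sc = a.1.sc := by split_ifs <;> simp [hs1, flush]
    have he2 : (if s1.exit = false ∧ (a.1.sc d.opp).length < i + 1
        then flush u {sen, w} s1 else s1).exit = false → ¬ p := by
      split_ifs <;> simpa [flush] using he1
    generalize (if s1.exit = false ∧ (a.1.sc d.opp).length < i + 1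
        then flush u {sen, w} s1 else s1) = s2 at *
    refine h2.trans ?_
    have h3 : Ext u (s2, a.2) (if s2.exit = false ∧ (a.1.sc d.opp).length = i + 1
          ∧ (a.1.sc d.opp)[i]? = some sen then
        { s2 with sc := Function.update s2.sc d.opp (a.1.sc d.opp ++ [w]) } else s2, a.2) := by
      split_ifs with h
      · refine ⟨fun e => ?_, fun e hn => ?_, rfl, rfl, rfl, id, subset_rfl, subset_rfl, .inl rfl,
          fun _ h => h⟩
        · rcases eq_or_ne e d.opp with rfl | he
          · simp [hs2]
          · simp [he]
        · rcases eq_or_ne e d.opp with rfl | he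
          · simp only [hs2] at hn
            simp [hn] at h
          · simpa [he] using hn
      · exact Ext.refl _ _
    generalize (if s2.exit = false ∧ (a.1.sc d.opp).length = i + 1
          ∧ (a.1.sc d.opp)[i]? = some sen then
        { s2 with sc := Function.update s2.sc d.opp (a.1.sc d.opp ++ [w]) } else s2) = s3 at *
    refine h3.trans ?_
    split_ifs
    · exact ext_sendRejFly _ _ _
    · exact Ext.refl _ _
  | _ => exact Ext.refl _ _

theorem ext_onTestCert (var : Variant) (u : V) (a : Node V × Out V) (m : Msg V) :
    Ext u a (onTestCert var u a m) := by
  cases m with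
  | testCert w val dist =>
    refine (ext_setExit u a ((a.1.vID = val ∧ dist - 1 ≠ a.1.cDist)
        ∨ (a.1.vID ≠ val ∧ nextStop a.1 val = none))).trans ?_
    simp only [onTestCert]
    generalize (if (a.1.vID = val ∧ dist - 1 ≠ a.1.cDist)
        ∨ (a.1.vID ≠ val ∧ nextStop a.1 val = none) then { a.1 with exit := true } else a.1) = s
    split_ifs
    · exact ext_sendRejFly _ _ _
    · exact ⟨fun _ => List.prefix_rfl, fun _ h => h, rfl, rfl, rfl, id, subset_rfl,
        Finset.subset_insert _ _, .inl rfl, fun _ h => Multiset.mem_add.2 (.inl h)⟩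
    · exact ext_send _ (s, a.2) _
    · exact ext_flush _ (s, a.2) _
  | _ => exact Ext.refl _ _

theorem ext_onIntroCert (u : V) (a : Node V × Out V) (m : Msg V) : Ext u a (onIntroCert a m) := by
  cases m with
  | introCert w => exact ⟨fun _ => List.prefix_rfl, fun _ h => h, rfl, rfl, rfl, id, subset_rfl,
        Finset.subset_insert _ _, .inl rfl, fun _ h => h⟩
  | _ => exact Ext.refl _ _

theorem ext_onTestvID (u : V) (a : Node V × Out V) (m : Msg V) : Ext u a (onTestvID a m) := by
  cases m with
  | testvID x => exact ext_setExit u a _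
  | _ => exact Ext.refl _ _

theorem ext_onTestFlyID (u : V) (a : Node V × Out V) (m : Msg V) :
    Ext u a (onTestFlyID u a m) := by
  cases m with
  | testFlyID f =>
    simp only [onTestFlyID]
    have h1 : Ext u a (if a.1.sc .left ≠ [] ∧ a.1.exit = false ∧ a.1.flyID = u then
        { a.1 with flyID := f.getD u } else a.1, a.2) := by
      split_ifs with h
      · exact ⟨fun _ => List.prefix_rfl, fun _ h => h, rfl, rfl, rfl, id, subset_rfl,
          subset_rfl, .inr ⟨h.2.2, h.1⟩, fun _ h => h⟩
      · exact Ext.refl _ _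
    refine h1.trans ?_
    generalize (if a.1.sc .left ≠ [] ∧ a.1.exit = false ∧ a.1.flyID = u then
        { a.1 with flyID := f.getD u } else a.1) = s
    refine (ext_setExit u (s, a.2) ((s.S ≠ ∅ ∧ some s.flyID ≠ f) ∨ (s.S = ∅ ∧ f ≠ none))).trans ?_
    generalize (if (s.S ≠ ∅ ∧ some s.flyID ≠ f) ∨ (s.S = ∅ ∧ f ≠ none) then
        { s with exit := true } else s) = s'
    split_ifs
    · exact ext_sendRejFly _ _ _
    · exact Ext.refl _ _
  | _ => exact Ext.refl _ _

theorem ext_foldl {u : V} {f : Node V × Out V → Msg V → Node V × Out V}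
    (hf : ∀ a m, Ext u a (f a m)) (ch : List (Msg V)) (a : Node V × Out V) :
    Ext u a (ch.foldl f a) := by
  induction ch generalizing a with
  | nil => exact Ext.refl _ _
  | cons m ch ih => exact (hf a m).trans (ih _)

/-- Every message of the channel is processed in some intermediate state. -/
theorem ext_foldl_mem {u : V} {f : Node V × Out V → Msg V → Node V × Out V}
    (hf : ∀ a m, Ext u a (f a m)) {ch : List (Msg V)} {m : Msg V} (hm : m ∈ ch)
    (a : Node V × Out V) : ∃ b, Ext u a b ∧ Ext u (f b m) (ch.foldl f a) := by
  obtain ⟨l₁, l₂, rfl⟩ := List.append_of_mem hm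
  refine ⟨l₁.foldl f a, ext_foldl hf _ _, ?_⟩
  rw [List.foldl_append, List.foldl_cons]
  exact ext_foldl hf _ _

/-! ### Isolating the treatment of one message -/

section Respond

variable (var : Variant) (u : V) {ch : List (Msg V)} (a : Node V × Out V)

theorem ext_respond (ch : List (Msg V)) : Ext u a (respond var u ch a) :=
  (ext_foldl (ext_onTestLine u) ch a).trans <|
  (ext_foldl (ext_onFlyConst u) ch _).trans <|
  (ext_foldl (ext_onTestCert var u) ch _).trans <|
  (ext_foldl (ext_onIntroCert u) ch _).trans <|
  (ext_foldl (ext_onTestvID u) ch _).trans <| ext_foldl (ext_onTestFlyID u) ch _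

/-- This form, repeated for the other message types, lets one reason about a single handler call:
fields that responses never change can be read off at `b`, and whatever the handler sends or flags
is still there at the end. -/
theorem respond_testLine {m : Msg V} (hm : m ∈ ch) :
    ∃ b, Ext u a b ∧ Ext u (onTestLine u b m) (respond var u ch a) := by
  obtain ⟨b, hb, hb'⟩ := ext_foldl_mem (ext_onTestLine u) hm a
  exact ⟨b, hb, hb'.trans <|
    (ext_foldl (ext_onFlyConst u) ch _).trans <|
    (ext_foldl (ext_onTestCert var u) ch _).trans <|
    (ext_foldl (ext_onIntroCert u) ch _).trans <|
    (ext_foldl (ext_onTestvID u) ch _).trans <| ext_foldl (ext_onTestFlyID u) ch _⟩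

theorem respond_flyConst {m : Msg V} (hm : m ∈ ch) :
    ∃ b, Ext u a b ∧ Ext u (onFlyConst u b m) (respond var u ch a) := by
  obtain ⟨b, hb, hb'⟩ := ext_foldl_mem (ext_onFlyConst u) hm (ch.foldl (onTestLine u) a)
  exact ⟨b, (ext_foldl (ext_onTestLine u) ch a).trans hb, hb'.trans <|
    (ext_foldl (ext_onTestCert var u) ch _).trans <|
    (ext_foldl (ext_onIntroCert u) ch _).trans <|
    (ext_foldl (ext_onTestvID u) ch _).trans <| ext_foldl (ext_onTestFlyID u) ch _⟩

theorem foldl_flyID_eq {f : Node V × Out V → Msg V → Node V × Out V}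
    (hf : ∀ a m, (f a m).1.flyID = a.1.flyID) (ch : List (Msg V)) (a : Node V × Out V) :
    (ch.foldl f a).1.flyID = a.1.flyID := by
  induction ch generalizing a with
  | nil => rfl
  | cons m ch ih => rw [List.foldl_cons, ih, hf]

theorem onTestLine_flyID (a : Node V × Out V) (m : Msg V) :
    (onTestLine u a m).1.flyID = a.1.flyID := by
  cases m <;> simp only [onTestLine, sendRejFly, flush] <;> split_ifs <;> rfl

theorem onFlyConst_flyID (a : Node V × Out V) (m : Msg V) :
    (onFlyConst u a m).1.flyID = a.1.flyID := by
  cases m with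
  | flyConst d w i sen =>
    simp only [onFlyConst, sendRejFly, flush]
    split_ifs <;> rfl
  | _ => rfl

theorem onTestCert_flyID (a : Node V × Out V) (m : Msg V) :
    (onTestCert var u a m).1.flyID = a.1.flyID := by
  cases m <;> simp only [onTestCert, sendRejFly, flush] <;> split_ifs <;> rfl

/-- Flyover ids are only changed by TestFlyID, which is treated after TestCert. The extra equation
makes the decision whether to forward a certificate depend on the state after the checks alone. -/
theorem respond_testCert {m : Msg V} (hm : m ∈ ch) :
    ∃ b, Ext u a b ∧ b.1.flyID = a.1.flyID ∧
      Ext u (onTestCert var u b m) (respond var u ch a) := by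
  obtain ⟨l₁, l₂, rfl⟩ := List.append_of_mem hm
  refine ⟨l₁.foldl (onTestCert var u) ((l₁ ++ m :: l₂).foldl (onFlyConst u)
    ((l₁ ++ m :: l₂).foldl (onTestLine u) a)), ?_, ?_, ?_⟩
  · exact (ext_foldl (ext_onTestLine u) _ a).trans <|
      (ext_foldl (ext_onFlyConst u) _ _).trans <| ext_foldl (ext_onTestCert var u) _ _
  · rw [foldl_flyID_eq (onTestCert_flyID var u), foldl_flyID_eq (onFlyConst_flyID u),
      foldl_flyID_eq (onTestLine_flyID u)]
  · refine Ext.trans ?_ <|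
      (ext_foldl (ext_onIntroCert u) _ _).trans <|
      (ext_foldl (ext_onTestvID u) _ _).trans <| ext_foldl (ext_onTestFlyID u) _ _
    rw [List.foldl_append (f := onTestCert var u), List.foldl_cons]
    exact ext_foldl (ext_onTestCert var u) _ _

theorem respond_introCert {m : Msg V} (hm : m ∈ ch) :
    ∃ b, Ext u a b ∧ Ext u (onIntroCert b m) (respond var u ch a) := by
  obtain ⟨b, hb, hb'⟩ := ext_foldl_mem (ext_onIntroCert u) hm
    (ch.foldl (onTestCert var u) (ch.foldl (onFlyConst u) (ch.foldl (onTestLine u) a)))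
  exact ⟨b, (ext_foldl (ext_onTestLine u) ch a).trans <|
    (ext_foldl (ext_onFlyConst u) ch _).trans <|
    (ext_foldl (ext_onTestCert var u) ch _).trans hb, hb'.trans <|
    (ext_foldl (ext_onTestvID u) ch _).trans <| ext_foldl (ext_onTestFlyID u) ch _⟩

theorem respond_testvID {m : Msg V} (hm : m ∈ ch) :
    ∃ b, Ext u a b ∧ Ext u (onTestvID b m) (respond var u ch a) := by
  obtain ⟨b, hb, hb'⟩ := ext_foldl_mem (ext_onTestvID u) hm (ch.foldl onIntroCert
    (ch.foldl (onTestCert var u) (ch.foldl (onFlyConst u) (ch.foldl (onTestLine u) a))))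
  exact ⟨b, (ext_foldl (ext_onTestLine u) ch a).trans <|
    (ext_foldl (ext_onFlyConst u) ch _).trans <|
    (ext_foldl (ext_onTestCert var u) ch _).trans <|
    (ext_foldl (ext_onIntroCert u) ch _).trans hb, hb'.trans <|
    ext_foldl (ext_onTestFlyID u) ch _⟩

theorem respond_testFlyID {m : Msg V} (hm : m ∈ ch) :
    ∃ b, Ext u a b ∧ Ext u (onTestFlyID u b m) (respond var u ch a) := by
  obtain ⟨b, hb, hb'⟩ := ext_foldl_mem (ext_onTestFlyID u) hm (ch.foldl onTestvID
    (ch.foldl onIntroCert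
    (ch.foldl (onTestCert var u) (ch.foldl (onFlyConst u) (ch.foldl (onTestLine u) a)))))
  exact ⟨b, (ext_foldl (ext_onTestLine u) ch a).trans <|
    (ext_foldl (ext_onFlyConst u) ch _).trans <|
    (ext_foldl (ext_onTestCert var u) ch _).trans <|
    (ext_foldl (ext_onIntroCert u) ch _).trans <|
    (ext_foldl (ext_onTestvID u) ch _).trans hb, hb'⟩

end Respond

/-! ### The stages of a round at one node -/

section Stages

variable (var : Variant) (u : V) (sup : Supervision V) (s : Node V) (ch : List (Msg V))

/-- The state of `u` after the checks. -/
def checked : Node V := (rejectFlyover u (basicChecks u s ch)).1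

/-- The state and the sent messages of `u` after the tests. -/
def tested : Node V × Out V :=
  (checked u s ch, (rejectFlyover u (basicChecks u s ch)).2
    + testFlyoverConstruction u (checked u s ch) + testConnCertificate u (checked u s ch)
    + testFlyoverMetadata var u (checked u s ch) ch)

/-- The state and the sent messages of `u` after the responses. -/
def responded : Node V × Out V := respond var u ch (tested var u s ch)

/-- The state and the sent messages of `u` after the processing of advice. -/
def advised : Node V × Out V :=
  getAdvice u sup ch (snapshotReq u sup ch
    (basicChecks2 var (responded var u s ch).1, (responded var u s ch).2))

/-- The state and the sent messages of `u` before it joins a path. -/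
def transformed : Node V × Out V :=
  localTransform u ch (certifyTree u ch (advised var u sup s ch))

theorem localRound_eq : localRound var u sup s ch =
    (joinPath var u ch (transformed var u sup s ch).1, (transformed var u sup s ch).2) := rfl

end Stages

section Local

variable {var : Variant} {u : V} {sup : Supervision V} {s : Node V} {ch : List (Msg V)}

theorem checked_of_not_exit (h : (basicChecks u s ch).exit = false) : checked u s ch = s := by
  unfold checked rejectFlyover
  rw [if_neg (by simp [h])]
  unfold basicChecks at h ⊢
  split_ifs at h ⊢
  rfl

theorem not_checks (h : (basicChecks u s ch).exit = false) :
    s.exit = false ∧ Msg.rejFlyover ∉ ch ∧ ¬ (s.S = ∅ ∧ (s.cIds ≠ ∅ ∨ s.flyID ≠ u))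
      ∧ ¬ (s.sc .left = [] ∧ s.sc .right ≠ [] ∧ (s.vID ≠ 1 ∨ s.flyID ≠ u))
      ∧ ¬ (s.sc .left ≠ [] ∧ s.vID ≤ 1) := by
  unfold basicChecks at h
  split_ifs at h with h'
  simp only [not_or] at h'
  refine ⟨h, fun hm => h'.1 ⟨_, hm, rfl⟩, h'.2.1, h'.2.2.1, h'.2.2.2.1⟩

theorem basicChecks_exit_of_rejFlyover (h : Msg.rejFlyover ∈ ch) :
    (basicChecks u s ch).exit = true := by
  by_contra h'
  exact (not_checks (by simpa using h')).2.1 h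

theorem basicChecks_exit_of_exit (h : s.exit = true) : (basicChecks u s ch).exit = true := by
  by_contra h'
  simp [(not_checks (by simpa using h')).1] at h

theorem basicChecks_addr : (basicChecks u s ch).S = s.S ∧ (basicChecks u s ch).flyID = s.flyID
    ∧ (basicChecks u s ch).cIds = s.cIds ∧ (basicChecks u s ch).base = s.base := by
  unfold basicChecks
  split_ifs <;> exact ⟨rfl, rfl, rfl, rfl⟩

theorem checked_of_exit (h : (basicChecks u s ch).exit = true) :
    (∀ d, (checked u s ch).sc d = []) ∧ (checked u s ch).vID = 0 ∧ (checked u s ch).flyID = u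
      ∧ (checked u s ch).exit = false
      ∧ (checked u s ch).base = s.base ∪ (s.S ∪ {s.flyID} ∪ s.cIds).erase u := by
  obtain ⟨h1, h2, h3, h4⟩ := basicChecks_addr (u := u) (s := s) (ch := ch)
  unfold checked rejectFlyover
  rw [if_pos h]
  refine ⟨fun _ => rfl, rfl, rfl, rfl, ?_⟩
  simp [sendRejFly, flush, h1, h2, h3, h4]

theorem checked_timer : (checked u s ch).t = s.t ∧ (checked u s ch).dist = s.dist := by
  unfold checked rejectFlyover basicChecks
  split_ifs <;> exact ⟨rfl, rfl⟩

theorem mem_tested_of_exit (h : (basicChecks u s ch).exit = true) {x : V}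
    (hx : x ∈ s.S ∪ {s.flyID} ∪ s.cIds) (hne : x ≠ u) :
    (x, Msg.rejFlyover) ∈ (tested var u s ch).2 := by
  obtain ⟨h1, h2, h3, h4⟩ := basicChecks_addr (u := u) (s := s) (ch := ch)
  simp only [tested, Multiset.mem_add]
  refine .inl (.inl (.inl ?_))
  unfold rejectFlyover
  rw [if_pos h]
  simp only [sendRejFly, sendAll, h1, h2, h3, zero_add, Multiset.mem_map]
  exact ⟨x, by rw [Finset.mem_val]; exact Finset.mem_erase.2 ⟨hne, hx⟩, rfl⟩

/-- Rejecting includes flushing, so what the reset erases reappears in `base`. -/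
theorem checked_addr {v : V} (hv : v ≠ u) (h : v ∈ s.addr) : v ∈ (checked u s ch).addr := by
  cases he : (basicChecks u s ch).exit
  · rwa [checked_of_not_exit he]
  · simp only [Node.addr, (checked_of_exit he).2.2.2.2] at h ⊢
    simp only [Finset.mem_union, Finset.mem_erase] at h ⊢
    tauto

theorem ext_responded : Ext u (tested var u s ch) (responded var u s ch) := ext_respond _ _ _ _

theorem advised_fields :
    (advised var u sup s ch).1.sc = (responded var u s ch).1.sc
    ∧ (advised var u sup s ch).1.exit = (responded var u s ch).1.exit
    ∧ (advised var u sup s ch).1.flyID = (responded var u s ch).1.flyID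
    ∧ (advised var u sup s ch).1.cIds = (responded var u s ch).1.cIds
    ∧ (responded var u s ch).1.base ⊆ (advised var u sup s ch).1.base
    ∧ ∀ x ∈ (responded var u s ch).2, x ∈ (advised var u sup s ch).2 := by
  have h1 : (snapshotReq u sup ch
      (basicChecks2 var (responded var u s ch).1, (responded var u s ch).2)).1.sc
        = (responded var u s ch).1.sc
    ∧ (snapshotReq u sup ch
      (basicChecks2 var (responded var u s ch).1, (responded var u s ch).2)).1.exit
        = (responded var u s ch).1.exit
    ∧ (snapshotReq u sup ch
      (basicChecks2 var (responded var u s ch).1, (responded var u s ch).2)).1.flyID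
        = (responded var u s ch).1.flyID
    ∧ (snapshotReq u sup ch
      (basicChecks2 var (responded var u s ch).1, (responded var u s ch).2)).1.cIds
        = (responded var u s ch).1.cIds
    ∧ (responded var u s ch).1.base = (snapshotReq u sup ch
      (basicChecks2 var (responded var u s ch).1, (responded var u s ch).2)).1.base
    ∧ ∀ x ∈ (responded var u s ch).2, x ∈ (snapshotReq u sup ch
      (basicChecks2 var (responded var u s ch).1, (responded var u s ch).2)).2 := by
    unfold snapshotReq
    dsimp only
    split_ifs
    · refine ⟨rfl, rfl, rfl, rfl, rfl, fun x hx => ?_⟩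
      simp only [Multiset.mem_add]
      exact .inl (.inl hx)
    · exact ⟨rfl, rfl, rfl, rfl, rfl, fun x hx => hx⟩
  unfold advised
  generalize (snapshotReq u sup ch
      (basicChecks2 var (responded var u s ch).1, (responded var u s ch).2)) = a at h1 ⊢
  obtain ⟨h1, h2, h3, h4, h5, h6⟩ := h1
  rw [← h1, ← h2, ← h3, ← h4, h5]
  unfold getAdvice
  dsimp only
  cases sup.advice with
  | none => exact ⟨rfl, rfl, rfl, rfl, Finset.subset_union_left, h6⟩
  | some adv =>
    dsimp only
    split_ifs
    · exact ⟨rfl, rfl, rfl, rfl, Finset.subset_union_left,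
        fun x hx => Multiset.mem_add.2 (.inl (h6 x hx))⟩
    · exact ⟨rfl, rfl, rfl, rfl, Finset.subset_union_left, h6⟩

/-- The effect of one round on the timer. -/
def Ticks (t t' : ℤ) : Prop := t' = max 0 (min 5 t - 1) ∨ (t' = 5 ∧ t ≤ 1)

/-- Only an adopted advice overwrites `dist`; adoption requires the timer value 4 and does not alter
it. -/
theorem advised_t : Ticks s.t (advised var u sup s ch).1.t
    ∧ ((advised var u sup s ch).1.dist = s.dist ∨ (advised var u sup s ch).1.t = 4) := by
  have h0 : (responded var u s ch).1.t = s.t := by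
    rw [ext_responded.t]; exact checked_timer.1
  have h0' : (responded var u s ch).1.dist = s.dist := by
    rw [ext_responded.dist]; exact checked_timer.2
  have ht : (basicChecks2 var (responded var u s ch).1).t = max 0 (min 5 s.t - 1) := by
    simp only [basicChecks2, h0]
    split_ifs <;> omega
  have h1 : Ticks s.t (snapshotReq u sup ch
      (basicChecks2 var (responded var u s ch).1, (responded var u s ch).2)).1.t
      ∧ (snapshotReq u sup ch
      (basicChecks2 var (responded var u s ch).1, (responded var u s ch).2)).1.dist = s.dist := by
    unfold snapshotReq
    dsimp only
    split_ifs with h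
    · refine ⟨.inr ⟨rfl, ?_⟩, h0'⟩
      have := h.2.2.1
      rw [ht] at this
      omega
    · exact ⟨.inl ht, h0'⟩
  unfold advised
  generalize (snapshotReq u sup ch
      (basicChecks2 var (responded var u s ch).1, (responded var u s ch).2)) = a at h1 ⊢
  unfold getAdvice
  dsimp only
  cases sup.advice with
  | none => exact ⟨h1.1, .inl h1.2⟩
  | some adv =>
    dsimp only
    split_ifs with h
    · exact ⟨h1.1, .inr h.2.2.1⟩
    · exact ⟨h1.1, .inl h1.2⟩

/-- The timeout, the snapshot and the advice all concern nodes that are free or exiting. -/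
theorem advised_vID (h : (responded var u s ch).1.S ≠ ∅) (he : (responded var u s ch).1.exit = false) :
    (advised var u sup s ch).1.vID = (responded var u s ch).1.vID := by
  unfold advised getAdvice
  dsimp only
  have h2 : (basicChecks2 var (responded var u s ch).1).vID = (responded var u s ch).1.vID := by
    simp [basicChecks2, h, he]
  have h1 : snapshotReq u sup ch (basicChecks2 var (responded var u s ch).1, (responded var u s ch).2)
      = (basicChecks2 var (responded var u s ch).1, (responded var u s ch).2) := by
    unfold snapshotReq
    rw [if_neg]
    rintro ⟨h', -⟩
    exact h h'
  rw [h1]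
  cases sup.advice with
  | none => exact h2
  | some adv =>
    dsimp only
    rw [if_neg]
    · exact h2
    · rintro ⟨h', -⟩
      exact h h'

/-- When the timer has run out, a node outside any flyover has no virtual id. -/
theorem advised_vID_zero (hj : var.joinLimit = 0 ∨ var.joinLimit = 1)
    (h : (responded var u s ch).1.S = ∅)
    (ht : max 0 (min 5 s.t - 1) ≤ var.joinLimit) : (advised var u sup s ch).1.vID = 0 := by
  have h0 : (responded var u s ch).1.t = s.t := by
    rw [ext_responded.t]; exact checked_timer.1
  have ht' : (basicChecks2 var (responded var u s ch).1).t = max 0 (min 5 s.t - 1) := by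
    simp only [basicChecks2, h0]
    split_ifs <;> omega
  have hv : (basicChecks2 var (responded var u s ch).1).vID = 0 := by
    have : (basicChecks2 var (responded var u s ch).1).vID
      = if (basicChecks2 var (responded var u s ch).1).t ≤ var.joinLimit ∧
        ((responded var u s ch).1.S = ∅ ∨ (responded var u s ch).1.exit) then 0
        else (responded var u s ch).1.vID := rfl
    rw [this, if_pos ⟨ht' ▸ ht, .inl h⟩]
  -- With a decremented timer of at most 1, the timer either stays there or is restarted at 5. It is
  -- not 4, so no advice can restore the virtual id in the same round.
  have h1 : (snapshotReq u sup ch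
      (basicChecks2 var (responded var u s ch).1, (responded var u s ch).2)).1.vID = 0
      ∧ (snapshotReq u sup ch
      (basicChecks2 var (responded var u s ch).1, (responded var u s ch).2)).1.t ≠ 4 := by
    unfold snapshotReq
    dsimp only
    split_ifs with h
    · exact ⟨hv, by norm_num⟩
    · refine ⟨hv, ?_⟩
      dsimp only
      rw [ht']
      omega
  unfold advised
  generalize (snapshotReq u sup ch
      (basicChecks2 var (responded var u s ch).1, (responded var u s ch).2)) = a at h1 ⊢
  unfold getAdvice
  dsimp only
  cases sup.advice with
  | none => exact h1.1
  | some adv =>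
    dsimp only
    split_ifs with h
    · exact absurd h.2.2.1 h1.2
    · exact h1.1

theorem transformed_fields :
    (transformed var u sup s ch).1.sc = (advised var u sup s ch).1.sc
    ∧ (transformed var u sup s ch).1.exit = (advised var u sup s ch).1.exit
    ∧ (transformed var u sup s ch).1.flyID = (advised var u sup s ch).1.flyID
    ∧ (transformed var u sup s ch).1.cIds = (advised var u sup s ch).1.cIds
    ∧ (transformed var u sup s ch).1.t = (advised var u sup s ch).1.t
    ∧ (transformed var u sup s ch).1.dist = (advised var u sup s ch).1.dist
    ∧ (transformed var u sup s ch).1.vID = (advised var u sup s ch).1.vID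
    ∧ (advised var u sup s ch).1.base ⊆ (transformed var u sup s ch).1.base
    ∧ ∀ x ∈ (advised var u sup s ch).2, x ∈ (transformed var u sup s ch).2 := by
  refine ⟨rfl, rfl, rfl, rfl, rfl, rfl, rfl, ?_, fun x hx => ?_⟩
  · exact Finset.subset_union_left.trans Finset.subset_union_left
  · exact Multiset.mem_add.2 (.inl (Multiset.mem_add.2 (.inl hx)))

theorem joinPath_fields (s : Node V) :
    (joinPath var u ch s).exit = s.exit
    ∧ (joinPath var u ch s).flyID = s.flyID
    ∧ (joinPath var u ch s).cIds = s.cIds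
    ∧ (joinPath var u ch s).t = s.t
    ∧ (joinPath var u ch s).dist = s.dist
    ∧ (joinPath var u ch s).vID = s.vID
    ∧ s.base ⊆ (joinPath var u ch s).base := by
  unfold joinPath
  dsimp only [flush]
  split_ifs <;> exact ⟨rfl, rfl, rfl, rfl, rfl, rfl, Finset.subset_union_left⟩

theorem foldl_jp_step (s : Node V) (ch : List (Msg V)) (x : JP V) :
    (x.ignore = true → (ch.foldl (JP.step s) x).ignore = true) ∧
    ∀ d v, (ch.foldl (JP.step s) x).fly d = some v → x.fly d = some v ∨ Msg.path d v ∈ ch := by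
  induction ch generalizing x with
  | nil => exact ⟨id, fun d v h => .inl h⟩
  | cons m ch ih =>
    rw [List.foldl_cons]
    obtain ⟨h1, h2⟩ := ih (JP.step s x m)
    cases m with
    | path d v =>
      unfold JP.step at h1 h2 ⊢
      dsimp only at h1 h2 ⊢
      split_ifs at h1 h2 ⊢ with h
      · refine ⟨fun _ => h1 rfl, fun d' v' h' => ?_⟩
        rcases h2 d' v' h' with h' | h'
        · exact .inl h'
        · exact .inr (List.mem_cons_of_mem _ h')
      · refine ⟨fun h' => h1 h', fun d' v' h' => ?_⟩
        rcases h2 d' v' h' with h' | h'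
        · by_cases hd : d' = d
          · subst hd
            simp only [Function.update_self, Option.some.injEq] at h'
            subst h'
            exact .inr (List.mem_cons_self ..)
          · simp only [Function.update_of_ne hd] at h'
            exact .inl h'
        · exact .inr (List.mem_cons_of_mem _ h')
    | _ =>
      refine ⟨fun h' => h1 h', fun d' v' h' => ?_⟩
      rcases h2 d' v' h' with h' | h'
      · exact .inl h'
      · exact .inr (List.mem_cons_of_mem _ h')

/-- The flag `ignore` is never cleared. If it is false at the end, it was false at the start, which
is the joining condition, and each new shortcut was put into an initially empty slot by a message.
-/
theorem joinPath_sc (s : Node V) :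
    (joinPath var u ch s).sc = s.sc ∨
    (s.S = ∅ ∧ s.exit = false ∧ var.joinLimit < s.t ∧
      ∀ d, ∀ v ∈ (joinPath var u ch s).sc d, Msg.path d v ∈ ch) := by
  set x0 : JP V := ⟨decide (¬ (s.S = ∅ ∧ s.exit = false ∧ var.joinLimit < s.t)), fun _ => none, ∅⟩
    with hx0
  obtain ⟨h1, h2⟩ := foldl_jp_step s ch x0
  have hsc : (joinPath var u ch s).sc = if (ch.foldl (JP.step s) x0).ignore then s.sc
      else fun d => ((ch.foldl (JP.step s) x0).fly d).toList := by
    unfold joinPath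
    dsimp only [flush]
    rw [← hx0]
    split_ifs <;> rfl
  rw [hsc]
  split_ifs with h
  · exact .inl rfl
  · right
    have : ¬ x0.ignore = true := fun h' => h (h1 h')
    simp only [hx0, decide_eq_true_eq, not_not] at this
    refine ⟨this.1, this.2.1, this.2.2, fun d v hv => ?_⟩
    have := h2 d v (by simpa using hv)
    simpa [hx0] using this

/-- A summary of the part of a round that follows the responses. -/
theorem localRound_fields :
    (localRound var u sup s ch).1.exit = (responded var u s ch).1.exit
    ∧ (localRound var u sup s ch).1.flyID = (responded var u s ch).1.flyID
    ∧ (localRound var u sup s ch).1.cIds = (responded var u s ch).1.cIds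
    ∧ (responded var u s ch).1.base ⊆ (localRound var u sup s ch).1.base
    ∧ ∀ x ∈ (responded var u s ch).2, x ∈ (localRound var u sup s ch).2 := by
  obtain ⟨a1, a2, a3, a4, a5, a6⟩ := advised_fields (var := var) (u := u) (sup := sup) (s := s)
    (ch := ch)
  obtain ⟨b1, b2, b3, b4, b5, b6, b7, b8, b9⟩ := transformed_fields (var := var) (u := u)
    (sup := sup) (s := s) (ch := ch)
  obtain ⟨c1, c2, c3, c4, c5, c6, c7⟩ := joinPath_fields (var := var) (u := u) (ch := ch)
    (transformed var u sup s ch).1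
  rw [localRound_eq]
  exact ⟨c1.trans (b2.trans a2), c2.trans (b3.trans a3), c3.trans (b4.trans a4),
    a5.trans (b8.trans c7), fun x hx => b9 x (a6 x hx)⟩

theorem localRound_t : Ticks s.t (localRound var u sup s ch).1.t
    ∧ ((localRound var u sup s ch).1.dist = s.dist ∨ (localRound var u sup s ch).1.t = 4) := by
  obtain ⟨b1, b2, b3, b4, b5, b6, b7, b8, b9⟩ := transformed_fields (var := var) (u := u)
    (sup := sup) (s := s) (ch := ch)
  obtain ⟨c1, c2, c3, c4, c5, c6, c7⟩ := joinPath_fields (var := var) (u := u) (ch := ch)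
    (transformed var u sup s ch).1
  rw [localRound_eq]
  rw [c4, b5, c5, b6]
  exact advised_t

theorem localRound_vID_eq : (localRound var u sup s ch).1.vID = (advised var u sup s ch).1.vID :=
  (joinPath_fields (var := var) (u := u) (ch := ch) (transformed var u sup s ch).1).2.2.2.2.2.1

theorem localRound_t_eq : (localRound var u sup s ch).1.t = (advised var u sup s ch).1.t :=
  (joinPath_fields (var := var) (u := u) (ch := ch) (transformed var u sup s ch).1).2.2.2.1

theorem localRound_dist_eq :
    (localRound var u sup s ch).1.dist = (advised var u sup s ch).1.dist :=
  (joinPath_fields (var := var) (u := u) (ch := ch) (transformed var u sup s ch).1).2.2.2.2.1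

/-- Either the shortcuts are those after the responses, or `u` has just joined a path. -/
theorem localRound_sc :
    (localRound var u sup s ch).1.sc = (responded var u s ch).1.sc ∨
    ((responded var u s ch).1.S = ∅ ∧ (responded var u s ch).1.exit = false
      ∧ var.joinLimit < (localRound var u sup s ch).1.t ∧
      ∀ d, ∀ v ∈ (localRound var u sup s ch).1.sc d, Msg.path d v ∈ ch) := by
  obtain ⟨a1, a2, -⟩ := advised_fields (var := var) (u := u) (sup := sup) (s := s)
    (ch := ch)
  obtain ⟨b1, b2, -⟩ := transformed_fields (var := var) (u := u)
    (sup := sup) (s := s) (ch := ch)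
  have hs : (transformed var u sup s ch).1.S = (responded var u s ch).1.S :=
    Node.S_congr (b1.trans a1)
  rcases joinPath_sc (var := var) (u := u) (ch := ch) (transformed var u sup s ch).1 with h | h
  · exact .inl (h.trans (b1.trans a1))
  · refine .inr ⟨hs ▸ h.1, (b2.trans a2) ▸ h.2.1, ?_, h.2.2.2⟩
    rw [localRound_eq, (joinPath_fields _).2.2.2.1]
    exact h.2.2.1

end Local

/-! ### Origin of the messages that are not tests -/

/-- The messages sent by the checks, tests, responses and snapshots. -/
def Msg.IsTest : Msg V → Prop
  | .testAdvice _ _ | .verified _ _ | .path _ _ | .base _ | .rev _ _ => False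
  | _ => True

theorem mem_sendList {l : List (V × Msg V)} {x : V × Msg V} : x ∈ sendList l ↔ x ∈ l := Iff.rfl

theorem mem_sendAll {ids : Finset V} {m : Msg V} {x : V × Msg V} :
    x ∈ sendAll ids m ↔ x.1 ∈ ids ∧ x.2 = m := by
  obtain ⟨x, m'⟩ := x
  simp only [sendAll, Multiset.mem_map, Finset.mem_val, Prod.mk.injEq]
  constructor
  · rintro ⟨y, hy, rfl, rfl⟩
    exact ⟨hy, rfl⟩
  · rintro ⟨h, rfl⟩
    exact ⟨x, h, rfl, rfl⟩

/-- All sent messages are tests. -/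
def OnlyTests (o : Out V) : Prop := ∀ x ∈ o, x.2.IsTest

theorem OnlyTests.add {o o' : Out V} (h : OnlyTests o) (h' : OnlyTests o') :
    OnlyTests (o + o') := by
  intro x hx
  rcases Multiset.mem_add.1 hx with hx | hx
  exacts [h x hx, h' x hx]

theorem onlyTests_zero : OnlyTests (0 : Out V) := fun x hx => absurd hx (Multiset.notMem_zero x)

theorem onlyTests_sendAll (ids : Finset V) {m : Msg V} (hm : m.IsTest) :
    OnlyTests (sendAll ids m) := by
  intro x hx
  rw [(mem_sendAll.1 hx).2]
  exact hm

theorem onlyTests_map {α : Type*} (l : List α) (f : α → V × Msg V) (h : ∀ x, (f x).2.IsTest) :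
    OnlyTests (sendList (l.map f)) := by
  intro x hx
  obtain ⟨y, -, rfl⟩ := List.mem_map.1 (mem_sendList.1 hx)
  exact h y

theorem onlyTests_foldl {f : Node V × Out V → Msg V → Node V × Out V}
    (hf : ∀ a m, OnlyTests a.2 → OnlyTests (f a m).2) (ch : List (Msg V)) (a : Node V × Out V)
    (ha : OnlyTests a.2) : OnlyTests (ch.foldl f a).2 := by
  induction ch generalizing a with
  | nil => exact ha
  | cons m ch ih => exact ih _ (hf a m ha)

section Out

variable {var : Variant} {u : V} {sup : Supervision V} {s : Node V} {ch : List (Msg V)}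

theorem onlyTests_tested : OnlyTests (tested var u s ch).2 := by
  unfold tested testFlyoverConstruction testConnCertificate testFlyoverMetadata rejectFlyover
  dsimp only
  refine OnlyTests.add (OnlyTests.add (OnlyTests.add ?_ ?_) ?_) ?_
  · split_ifs
    · exact onlyTests_zero.add (onlyTests_sendAll _ trivial)
    · exact onlyTests_zero
  · exact ((((onlyTests_map _ _ (by intro; trivial)).add (onlyTests_map _ _ (by intro; trivial))).add
      (onlyTests_map _ _ (by intro; trivial))).add (onlyTests_map _ _ (by intro; trivial)))
  · split_ifs
    · exact onlyTests_map _ _ (by intro; trivial)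
    · exact onlyTests_zero
  · refine (((onlyTests_map _ _ (by intro; trivial)).add (onlyTests_map _ _ (by intro; trivial))).add
      ?_).add ?_
    · split_ifs
      · exact onlyTests_sendAll _ trivial
      · exact onlyTests_zero
    · split_ifs
      · exact onlyTests_sendAll _ trivial
      · exact onlyTests_zero

theorem onlyTests_responded : OnlyTests (responded var u s ch).2 := by
  unfold responded respond
  dsimp only
  refine onlyTests_foldl ?_ _ _ <| onlyTests_foldl ?_ _ _ <| onlyTests_foldl ?_ _ _ <|
    onlyTests_foldl ?_ _ _ <| onlyTests_foldl ?_ _ _ <| onlyTests_foldl ?_ _ _ onlyTests_tested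
  · intro a m ha
    cases m with
    | testFlyID f =>
      simp only [onTestFlyID]
      split_ifs <;> first | exact ha | exact ha.add (onlyTests_sendAll _ trivial)
    | _ => exact ha
  · intro a m ha
    cases m <;> exact ha
  · intro a m ha
    cases m <;> exact ha
  · intro a m ha
    cases m with
    | testCert w v d =>
      simp only [onTestCert]
      split_ifs <;> first
        | exact ha
        | exact ha.add (onlyTests_sendAll _ trivial)
        | exact ha.add (onlyTests_map _ _ (by intro; trivial))
        | exact ha.add (fun x hx => by rw [Multiset.mem_singleton.1 hx]; trivial)
    | _ => exact ha
  · intro a m ha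
    cases m with
    | flyConst d w i sen =>
      simp only [onFlyConst]
      split_ifs <;> first | exact ha | exact ha.add (onlyTests_sendAll _ trivial)
    | _ => exact ha
  · intro a m ha
    cases m with
    | testLine d sen =>
      simp only [onTestLine]
      split_ifs <;> first | exact ha | exact ha.add (onlyTests_sendAll _ trivial)
    | _ => exact ha

theorem onlyTests_snapshotReq {a : Node V × Out V} (ha : OnlyTests a.2) :
    OnlyTests (snapshotReq u sup ch a).2 := by
  unfold snapshotReq
  dsimp only
  split_ifs
  · refine (ha.add (onlyTests_sendAll _ (by trivial))).add ?_
    intro x hx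
    obtain ⟨y, -, rfl⟩ := Multiset.mem_map.1 hx
    trivial
  · exact ha

/-- A message in the output after the processing of advice is a test or the announcement of an
adopted advice. -/
theorem mem_advised {x : V × Msg V} (hx : x ∈ (advised var u sup s ch).2) :
    x.2.IsTest ∨ ((advised var u sup s ch).1.t = 4 ∧
      x.2 = .testAdvice (advised var u sup s ch).1.dist u) := by
  unfold advised at hx ⊢
  have h0 : OnlyTests (snapshotReq u sup ch
      (basicChecks2 var (responded var u s ch).1, (responded var u s ch).2)).2 :=
    onlyTests_snapshotReq onlyTests_responded
  generalize (snapshotReq u sup ch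
      (basicChecks2 var (responded var u s ch).1, (responded var u s ch).2)) = a at h0 hx ⊢
  unfold getAdvice at hx ⊢
  dsimp only at hx ⊢
  cases h : sup.advice with
  | none =>
    rw [h] at hx
    exact .inl (h0 x hx)
  | some adv =>
    rw [h] at hx
    dsimp only at hx ⊢
    split_ifs at hx ⊢ with h'
    · rcases Multiset.mem_add.1 hx with hx | hx
      · exact .inl (h0 x hx)
      · obtain ⟨p, -, rfl⟩ := List.mem_map.1 (mem_sendList.1 hx)
        exact .inr ⟨h'.2.2.1, rfl⟩
    · exact .inl (h0 x hx)

theorem mem_of_zip_tail {α : Type*} {c : List α} {x : α × α} (h : x ∈ c.zip c.tail) :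
    x.1 ∈ c ∧ x.2 ∈ c := by
  have := List.of_mem_zip (a := x.1) (b := x.2) h
  exact ⟨this.1, List.mem_of_mem_tail this.2⟩

/-- The senders of `Verified` messages. -/
theorem mem_setupLocalTransform {c : Finset V} {x : V × Msg V}
    (hx : x ∈ setupLocalTransform u c) : ∃ k v, x.2 = .verified k v ∧
      (k = .parent → v = u) ∧ (k ≠ .child → x.1 ∈ c) ∧ (k = .child → x.1 = u) ∧
      (k ≠ .parent → v ∈ c) := by
  unfold setupLocalTransform at hx
  simp only [Multiset.mem_add, or_assoc] at hx
  rcases hx with hx | hx | hx | hx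
  · obtain ⟨h1, h2⟩ := mem_sendAll.1 hx
    exact ⟨_, _, h2, fun _ => rfl, fun _ => h1, by simp, by simp⟩
  · obtain ⟨y, hy, rfl⟩ := List.mem_map.1 (mem_sendList.1 hx)
    have := mem_of_zip_tail hy
    simp only [Finset.mem_sort] at this
    exact ⟨_, _, rfl, by simp, fun _ => this.1, by simp, fun _ => this.2⟩
  · obtain ⟨y, hy, rfl⟩ := List.mem_map.1 (mem_sendList.1 hx)
    have := mem_of_zip_tail hy
    simp only [Finset.mem_sort] at this
    exact ⟨_, _, rfl, by simp, fun _ => this.2, by simp, fun _ => this.1⟩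
  · obtain ⟨y, hy, rfl⟩ := Multiset.mem_map.1 hx
    rw [Finset.mem_val] at hy
    exact ⟨_, _, rfl, by simp, by simp, by simp, fun _ => hy⟩

/-- A final value `false` of the flag means that no message was ignored, so every field was filled
by a message of its own kind. -/
theorem foldl_lt_step (ch : List (Msg V)) (x : LT V)
    (h : (ch.foldl LT.step x).ignore = false) :
    x.ignore = false ∧
    (∀ p, (ch.foldl LT.step x).parent = some p → x.parent = some p ∨ Msg.verified .parent p ∈ ch) ∧
    (∀ p, (ch.foldl LT.step x).rsib = some p → x.rsib = some p ∨ Msg.verified .sibUp p ∈ ch) ∧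
    (∀ p, (ch.foldl LT.step x).lsib = some p → x.lsib = some p ∨ Msg.verified .sibDown p ∈ ch) ∧
    (∀ p ∈ (ch.foldl LT.step x).children, p ∈ x.children ∨ Msg.verified .child p ∈ ch) := by
  induction ch generalizing x with
  | nil => exact ⟨h, fun _ h => .inl h, fun _ h => .inl h, fun _ h => .inl h, fun _ h => .inl h⟩
  | cons m ch ih =>
    rw [List.foldl_cons] at h ⊢
    obtain ⟨h0, h1, h2, h3, h4⟩ := ih _ h
    generalize ch.foldl LT.step (LT.step x m) = y at *
    have key : x.ignore = false ∧
        (∀ p, (LT.step x m).parent = some p → x.parent = some p ∨ Msg.verified .parent p = m) ∧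
        (∀ p, (LT.step x m).rsib = some p → x.rsib = some p ∨ Msg.verified .sibUp p = m) ∧
        (∀ p, (LT.step x m).lsib = some p → x.lsib = some p ∨ Msg.verified .sibDown p = m) ∧
        (∀ p ∈ (LT.step x m).children, p ∈ x.children ∨ Msg.verified .child p = m) := by
      cases m with
      | verified k v =>
        unfold LT.step at h0 ⊢
        dsimp only at h0 ⊢
        split_ifs at h0 ⊢ with hi
        have hx : x.ignore = false := by
          cases hx : x.ignore
          · rfl
          · simp [hx] at hi
        refine ⟨hx, ?_⟩
        cases k
        · exact ⟨fun p hp => .inr (by cases hp; rfl), fun _ h => .inl h, fun _ h => .inl h,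
            fun _ h => .inl h⟩
        · exact ⟨fun _ h => .inl h, fun p hp => .inr (by cases hp; rfl), fun _ h => .inl h,
            fun _ h => .inl h⟩
        · exact ⟨fun _ h => .inl h, fun _ h => .inl h, fun p hp => .inr (by cases hp; rfl),
            fun _ h => .inl h⟩
        · exact ⟨fun _ h => .inl h, fun _ h => .inl h, fun _ h => .inl h,
            fun p hp => (Finset.mem_insert.1 hp).elim (fun e => .inr (by rw [e])) .inl⟩
      | _ => exact ⟨h0, fun _ h => .inl h, fun _ h => .inl h, fun _ h => .inl h, fun _ h => .inl h⟩
    obtain ⟨k0, k1, k2, k3, k4⟩ := key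
    refine ⟨k0, fun p hp => ?_, fun p hp => ?_, fun p hp => ?_, fun p hp => ?_⟩
    · rcases h1 p hp with hp | hp
      · exact (k1 p hp).imp_right fun e => by rw [e]; exact List.mem_cons_self ..
      · exact .inr (List.mem_cons_of_mem _ hp)
    · rcases h2 p hp with hp | hp
      · exact (k2 p hp).imp_right fun e => by rw [e]; exact List.mem_cons_self ..
      · exact .inr (List.mem_cons_of_mem _ hp)
    · rcases h3 p hp with hp | hp
      · exact (k3 p hp).imp_right fun e => by rw [e]; exact List.mem_cons_self ..
      · exact .inr (List.mem_cons_of_mem _ hp)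
    · rcases h4 p hp with hp | hp
      · exact (k4 p hp).imp_right fun e => by rw [e]; exact List.mem_cons_self ..
      · exact .inr (List.mem_cons_of_mem _ hp)

/-- `PathPair u ch x v`: the nodes `x` and `v` are joined when `u` executes the transformation. -/
def PathPair (u : V) (ch : List (Msg V)) (x v : V) : Prop :=
  ∃ X Y, (Msg.verified .parent X ∈ ch ∨ Msg.verified .sibUp X ∈ ch ∨ Msg.verified .sibDown X ∈ ch)
    ∧ (Y = u ∨ Msg.verified .child Y ∈ ch) ∧ ((x = X ∧ v = Y) ∨ (x = Y ∧ v = X))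

theorem mem_executeTransform {p : V} {rsib lsib : Option V} {c : Finset V}
    (hp : Msg.verified .parent p ∈ ch) (hr : ∀ v, rsib = some v → Msg.verified .sibUp v ∈ ch)
    (hl : ∀ v, lsib = some v → Msg.verified .sibDown v ∈ ch)
    (hc : ∀ v ∈ c, Msg.verified .child v ∈ ch) {x : V × Msg V}
    (hx : x ∈ executeTransform u s p rsib lsib c) :
    ∃ e v, x.2 = .path e v ∧ PathPair u ch x.1 v := by
  have hY : ∀ o : Option V, (∀ y, o = some y → y ∈ c.sort) →
      o.getD u = u ∨ Msg.verified .child (o.getD u) ∈ ch := by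
    rintro (_ | y) h
    · exact .inl rfl
    · exact .inr (hc y (by simpa using h y rfl))
  unfold executeTransform at hx
  dsimp only at hx
  split_ifs at hx
  · have hX : Msg.verified .parent (rsib.getD p) ∈ ch ∨ Msg.verified .sibUp (rsib.getD p) ∈ ch ∨
        Msg.verified .sibDown (rsib.getD p) ∈ ch := by
      cases rsib with
      | none => exact .inl hp
      | some v => exact .inr (.inl (hr v rfl))
    have hY := hY c.sort.getLast? fun y hy => List.mem_of_getLast? hy
    simp only [Multiset.insert_eq_cons, Multiset.mem_cons, Multiset.mem_singleton] at hx
    rcases hx with rfl | rfl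
    · exact ⟨_, _, rfl, _, _, hX, hY, .inl ⟨rfl, rfl⟩⟩
    · exact ⟨_, _, rfl, _, _, hX, hY, .inr ⟨rfl, rfl⟩⟩
  · have hX : Msg.verified .parent (lsib.getD p) ∈ ch ∨ Msg.verified .sibUp (lsib.getD p) ∈ ch ∨
        Msg.verified .sibDown (lsib.getD p) ∈ ch := by
      cases lsib with
      | none => exact .inl hp
      | some v => exact .inr (.inr (hl v rfl))
    have hY := hY c.sort.head? fun y hy => List.mem_of_mem_head? hy
    simp only [Multiset.insert_eq_cons, Multiset.mem_cons, Multiset.mem_singleton] at hx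
    rcases hx with rfl | rfl
    · exact ⟨_, _, rfl, _, _, hX, hY, .inl ⟨rfl, rfl⟩⟩
    · exact ⟨_, _, rfl, _, _, hX, hY, .inr ⟨rfl, rfl⟩⟩
  · exact absurd hx (Multiset.notMem_zero x)

/-- Verified messages are sent only if all announced distances exceed the own one by 1; this yields
the order on distances that later excludes joining in successive rounds. -/
theorem mem_certifyTree {a : Node V × Out V} {x : V × Msg V} (hx : x ∈ (certifyTree u ch a).2) :
    x ∈ a.2 ∨ (1 < a.1.t ∧ ∃ k v, x.2 = .verified k v ∧
      (k = .parent → v = u) ∧ (k ≠ .child → Msg.testAdvice (a.1.dist + 1) x.1 ∈ ch) ∧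
      (k = .child → x.1 = u) ∧ (k ≠ .parent → Msg.testAdvice (a.1.dist + 1) v ∈ ch)) := by
  unfold certifyTree at hx
  dsimp only at hx
  rcases Multiset.mem_add.1 hx with hx | hx
  · exact .inl hx
  right
  split_ifs at hx with h
  · refine ⟨h.2.2.1, ?_⟩
    obtain ⟨k, v, h1, h2, h3, h4, h5⟩ := mem_setupLocalTransform hx
    have key : ∀ w ∈ ((ch.flatMap fun m => match m with
        | .testAdvice dist v => [(dist, v)] | _ => []).map Prod.snd).toFinset,
        Msg.testAdvice (a.1.dist + 1) w ∈ ch := by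
      intro w hw
      rw [List.mem_toFinset, List.mem_map] at hw
      obtain ⟨⟨e, w'⟩, hw, rfl⟩ := hw
      have he := h.2.2.2.1 _ hw
      rw [List.mem_flatMap] at hw
      obtain ⟨m, hm, hw⟩ := hw
      cases m <;> simp at hw
      obtain ⟨rfl, rfl⟩ := hw
      have : a.1.dist + 1 = e := by simp only at he; omega
      rw [this]
      exact hm
    exact ⟨k, v, h1, h2, fun hk => key _ (h3 hk), h4, fun hk => key _ (h5 hk)⟩
  · exact absurd hx (Multiset.notMem_zero x)

theorem mem_localTransform {a : Node V × Out V} {x : V × Msg V}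
    (hx : x ∈ (localTransform u ch a).2) :
    x ∈ a.2 ∨ (1 < a.1.t ∧ (∃ p, Msg.verified .parent p ∈ ch) ∧
      ∃ e v, x.2 = .path e v ∧ PathPair u ch x.1 v) := by
  unfold localTransform at hx
  dsimp only at hx
  rcases Multiset.mem_add.1 hx with hx | hx
  · exact .inl hx
  right
  have key := foldl_lt_step ch
    (⟨decide (¬ (a.1.S = ∅ ∧ a.1.exit = false ∧ 1 < a.1.t)), none, none, none, ∅⟩ : LT V)
  generalize ch.foldl LT.step
    (⟨decide (¬ (a.1.S = ∅ ∧ a.1.exit = false ∧ 1 < a.1.t)), none, none, none, ∅⟩ : LT V) = y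
    at hx key
  cases hp : y.parent with
  | none =>
    rw [hp] at hx
    exact absurd hx (Multiset.notMem_zero x)
  | some p =>
    rw [hp] at hx
    dsimp only at hx
    split_ifs at hx with h
    · obtain ⟨h0, h1, h2, h3, h4⟩ := key h.1
      simp only [decide_eq_false_iff_not, not_not] at h0
      have hp' : Msg.verified .parent p ∈ ch := by simpa using h1 p hp
      refine ⟨h0.2.2, ⟨p, hp'⟩, mem_executeTransform hp' (fun v hv => by simpa using h2 v hv)
        (fun v hv => by simpa using h3 v hv) (fun v hv => by simpa using h4 v hv) hx⟩
    · exact absurd hx (Multiset.notMem_zero x)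

/-- The non-test messages of a node in a round. -/
theorem mem_localRound {x : V × Msg V} (hx : x ∈ (localRound var u sup s ch).2) :
    x.2.IsTest ∨ ((localRound var u sup s ch).1.t = 4 ∧
      x.2 = .testAdvice (localRound var u sup s ch).1.dist u) ∨
    (1 < (localRound var u sup s ch).1.t ∧ ∃ k v, x.2 = .verified k v ∧
      (k = .parent → v = u) ∧
      (k ≠ .child → Msg.testAdvice ((localRound var u sup s ch).1.dist + 1) x.1 ∈ ch) ∧
      (k = .child → x.1 = u) ∧
      (k ≠ .parent → Msg.testAdvice ((localRound var u sup s ch).1.dist + 1) v ∈ ch)) ∨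
    (1 < (localRound var u sup s ch).1.t ∧ (∃ p, Msg.verified .parent p ∈ ch) ∧
      ∃ e v, x.2 = .path e v ∧ PathPair u ch x.1 v) := by
  rw [localRound_t_eq, localRound_dist_eq]
  rw [localRound_eq] at hx
  rcases mem_localTransform hx with hx | hx
  · rcases mem_certifyTree hx with hx | hx
    · rcases mem_advised hx with hx | hx
      · exact .inl hx
      · exact .inr (.inl hx)
    · exact .inr (.inr (.inl hx))
  · exact .inr (.inr (.inr hx))

end Out

/-- What the base algorithm sends. -/
theorem BaseRun.mem_out {u : V} {M M' : Finset V} {out : Out V} (h : BaseRun u M out M')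
    {x : V × Msg V} (hx : x ∈ out) : (∃ ids, x.2 = .base ids) ∨ ∃ v ws, x.2 = .rev v ws ∧
      ∀ w ∈ ws, (w, Msg.rev v []) ∈ out := by
  induction h with
  | refl => exact absurd hx (Multiset.notMem_zero x)
  | introduce v ids _ _ _ ih =>
    rcases Multiset.mem_cons.1 hx with rfl | hx
    · exact .inl ⟨_, rfl⟩
    · rcases ih hx with h | ⟨v, ws, h, h'⟩
      · exact .inl h
      · exact .inr ⟨v, ws, h, fun w hw => Multiset.mem_cons_of_mem (h' w hw)⟩
  | reverse v _ _ ih =>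
    rcases Multiset.mem_cons.1 hx with rfl | hx
    · exact .inl ⟨_, rfl⟩
    · rcases ih hx with h | ⟨v, ws, h, h'⟩
      · exact .inl h
      · exact .inr ⟨v, ws, h, fun w hw => Multiset.mem_cons_of_mem (h' w hw)⟩
  | delegate v w ws _ _ _ _ _ ih =>
    rcases Multiset.mem_cons.1 hx with rfl | hx
    · refine .inr ⟨v, ws, rfl, fun y hy => Multiset.mem_cons_of_mem (Multiset.mem_add.2 (.inl ?_))⟩
      exact mem_sendList.2 (List.mem_map.2 ⟨y, hy, rfl⟩)
    · rcases Multiset.mem_add.1 hx with hx | hx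
      · obtain ⟨y, hy, rfl⟩ := List.mem_map.1 (mem_sendList.1 hx)
        exact .inr ⟨v, [], rfl, by simp⟩
      · rcases ih hx with h | ⟨v, ws, h, h'⟩
        · exact .inl h
        · exact .inr ⟨v, ws, h, fun w hw => Multiset.mem_cons_of_mem
            (Multiset.mem_add.2 (.inr (h' w hw)))⟩

theorem mem_revReplies {u : V} {ch : List (Msg V)} {x : V × Msg V} :
    x ∈ revReplies u ch ↔ ∃ v ws, Msg.rev v ws ∈ ch ∧ x = (v, .base (u :: ws)) := by
  unfold revReplies
  rw [mem_sendList, List.mem_flatMap]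
  constructor
  · rintro ⟨m, hm, hx⟩
    cases m <;> simp at hx
    exact ⟨_, _, hm, hx⟩
  · rintro ⟨v, ws, hm, rfl⟩
    exact ⟨_, hm, by simp⟩

/-! ### Executions: channels, persistence and the effect of the tests -/

section Execution

variable [Fintype V] {var : Variant} {sup : ℕ → V → Supervision V} {C : ℕ → Config V}
  {r : ℕ} {u : V}

/-- The outcome of round `r` at `u` before the base algorithm. -/
abbrev roundOf (var : Variant) (sup : ℕ → V → Supervision V) (C : ℕ → Config V) (r : ℕ) (u : V) :
    Node V × Out V :=
  localRound var u (sup r u) ((C r).node u) ((C r).ch u)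

/-- The state and messages of `u` after the responses in round `r`. -/
abbrev respOf (var : Variant) (C : ℕ → Config V) (r : ℕ) (u : V) : Node V × Out V :=
  responded var u ((C r).node u) ((C r).ch u)

theorem mem_ch_iff {C' : Config V} {o : V → Out V}
    (h : ∀ v, (C'.ch v : Multiset (Msg V)) = ((∑ u, o u).filter (fun x => x.1 = v)).map Prod.snd)
    {m : Msg V} {x : V} : m ∈ C'.ch x ↔ ∃ u, (x, m) ∈ o u := by
  rw [← Multiset.mem_coe, h x]
  simp only [Multiset.mem_map, Multiset.mem_filter, Multiset.mem_sum, Finset.mem_univ, true_and]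
  constructor
  · rintro ⟨⟨y, m'⟩, ⟨⟨u, hu⟩, rfl⟩, rfl⟩
    exact ⟨u, hu⟩
  · rintro ⟨u, hu⟩
    exact ⟨_, ⟨⟨u, hu⟩, rfl⟩, rfl⟩

theorem IsExecution.base_step (hE : IsExecution var sup C) (hr : 1 ≤ r) (u : V) :
    ∃ out base', BaseRun u (basePool u (roundOf var sup C r u).1 ((C r).ch u)) out base'
      ∧ (C (r + 1)).node u = { (roundOf var sup C r u).1 with base := base' }
      ∧ ∀ y ∈ out, y.2 ∈ (C (r + 1)).ch y.1 := by
  obtain ⟨out, h1, h2⟩ := hE.step r hr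
  obtain ⟨b, hb, hb'⟩ := h1 u
  refine ⟨out u, b, hb, hb', fun y hy => ?_⟩
  rw [mem_ch_iff h2]
  exact ⟨u, Multiset.mem_add.2 (.inr hy)⟩

theorem IsExecution.mem_ch_of_round (hE : IsExecution var sup C) (hr : 1 ≤ r) {x : V} {m : Msg V}
    (h : (x, m) ∈ (roundOf var sup C r u).2) : m ∈ (C (r + 1)).ch x := by
  obtain ⟨out, h1, h2⟩ := hE.step r hr
  rw [mem_ch_iff h2]
  exact ⟨u, Multiset.mem_add.2 (.inl (Multiset.mem_add.2 (.inl h)))⟩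

theorem IsExecution.mem_ch_of_rev (hE : IsExecution var sup C) (hr : 1 ≤ r) {x : V} {ws : List V}
    (h : Msg.rev x ws ∈ (C r).ch u) : Msg.base (u :: ws) ∈ (C (r + 1)).ch x := by
  obtain ⟨out, h1, h2⟩ := hE.step r hr
  rw [mem_ch_iff h2]
  exact ⟨u, Multiset.mem_add.2 (.inl (Multiset.mem_add.2
    (.inr (mem_revReplies.2 ⟨x, ws, h, rfl⟩))))⟩

/-- The clause on `ws` records that a delegation informs all delegated nodes in the same round; it
is what keeps delegated ids from escaping unnoticed in `exists_known_succ`. -/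
theorem IsExecution.mem_ch (hE : IsExecution var sup C) (hr : 1 ≤ r) {x : V} {m : Msg V}
    (h : m ∈ (C (r + 1)).ch x) :
    (∃ u, (x, m) ∈ (roundOf var sup C r u).2) ∨ (∃ ids, m = .base ids) ∨
      ∃ v ws, m = .rev v ws ∧ ∀ w ∈ ws, Msg.rev v [] ∈ (C (r + 1)).ch w := by
  obtain ⟨out, h1, h2⟩ := hE.step r hr
  rw [mem_ch_iff h2] at h
  obtain ⟨u, hu⟩ := h
  rcases Multiset.mem_add.1 hu with hu | hu
  · rcases Multiset.mem_add.1 hu with hu | hu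
    · exact .inl ⟨u, hu⟩
    · obtain ⟨v, ws, -, h⟩ := mem_revReplies.1 hu
      exact .inr (.inl ⟨_, (Prod.mk.inj h).2⟩)
  · obtain ⟨b, hb, -⟩ := h1 u
    rcases hb.mem_out hu with h | ⟨v, ws, h, h'⟩
    · exact .inr (.inl h)
    · refine .inr (.inr ⟨v, ws, h, fun w hw => ?_⟩)
      rw [mem_ch_iff h2]
      exact ⟨u, Multiset.mem_add.2 (.inr (h' w hw))⟩

theorem IsExecution.node_succ (hE : IsExecution var sup C) (hr : 1 ≤ r) (u : V) :
    ((C (r + 1)).node u).sc = (roundOf var sup C r u).1.sc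
    ∧ ((C (r + 1)).node u).vID = (roundOf var sup C r u).1.vID
    ∧ ((C (r + 1)).node u).flyID = (roundOf var sup C r u).1.flyID
    ∧ ((C (r + 1)).node u).exit = (roundOf var sup C r u).1.exit
    ∧ ((C (r + 1)).node u).cIds = (roundOf var sup C r u).1.cIds
    ∧ ((C (r + 1)).node u).t = (roundOf var sup C r u).1.t
    ∧ ((C (r + 1)).node u).dist = (roundOf var sup C r u).1.dist := by
  obtain ⟨out, b, -, h, -⟩ := hE.base_step hr u
  rw [h]
  exact ⟨rfl, rfl, rfl, rfl, rfl, rfl, rfl⟩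

theorem IsExecution.exit_succ (hE : IsExecution var sup C) (hr : 1 ≤ r) (u : V) :
    ((C (r + 1)).node u).exit = (respOf var C r u).1.exit :=
  (hE.node_succ hr u).2.2.2.1.trans localRound_fields.1

theorem IsExecution.flyID_succ (hE : IsExecution var sup C) (hr : 1 ≤ r) (u : V) :
    ((C (r + 1)).node u).flyID = (respOf var C r u).1.flyID :=
  (hE.node_succ hr u).2.2.1.trans localRound_fields.2.1

theorem IsExecution.sc_succ (hE : IsExecution var sup C) (hr : 1 ≤ r) (u : V) :
    ((C (r + 1)).node u).sc = (respOf var C r u).1.sc ∨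
    ((respOf var C r u).1.S = ∅ ∧ (respOf var C r u).1.exit = false
      ∧ var.joinLimit < ((C (r + 1)).node u).t ∧
      ∀ d, ∀ v ∈ ((C (r + 1)).node u).sc d, Msg.path d v ∈ (C r).ch u) := by
  obtain ⟨h1, -, -, -, -, h2, -⟩ := hE.node_succ hr u
  rw [h1, h2]
  exact localRound_sc

theorem IsExecution.ticks (hE : IsExecution var sup C) (hr : 1 ≤ r) (u : V) :
    Ticks ((C r).node u).t ((C (r + 1)).node u).t := by
  rw [(hE.node_succ hr u).2.2.2.2.2.1]
  exact localRound_t.1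

theorem IsExecution.dist_succ (hE : IsExecution var sup C) (hr : 1 ≤ r) (u : V) :
    ((C (r + 1)).node u).dist = ((C r).node u).dist ∨ ((C (r + 1)).node u).t = 4 := by
  obtain ⟨-, -, -, -, -, h2, h3⟩ := hE.node_succ hr u
  rw [h2, h3]
  exact localRound_t.2

theorem IsExecution.mem_ch_of_resp (hE : IsExecution var sup C) (hr : 1 ≤ r) {x : V} {m : Msg V}
    (h : (x, m) ∈ (respOf var C r u).2) : m ∈ (C (r + 1)).ch x :=
  hE.mem_ch_of_round hr (localRound_fields.2.2.2.2 _ h)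

theorem IsExecution.mem_ch_of_tested (hE : IsExecution var sup C) (hr : 1 ≤ r) {x : V} {m : Msg V}
    (h : (x, m) ∈ (tested var u ((C r).node u) ((C r).ch u)).2) : m ∈ (C (r + 1)).ch x :=
  hE.mem_ch_of_resp hr (ext_responded.out _ h)

/-- The checks of round `r` do not let `u` exit. -/
def Passes (C : ℕ → Config V) (r : ℕ) (u : V) : Prop :=
  (basicChecks u ((C r).node u) ((C r).ch u)).exit = false

theorem passes_of_not_exitSet (h : ¬ ExitSet C r u) : Passes C r u := by
  unfold ExitSet at h
  push Not at h
  simpa [Passes] using h.1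

theorem exit_succ_of_not_exitSet (h : ¬ ExitSet C r u) : ((C (r + 1)).node u).exit = false := by
  unfold ExitSet at h
  push Not at h
  simpa using h.2

theorem Passes.checked (h : Passes C r u) : checked u ((C r).node u) ((C r).ch u) = (C r).node u :=
  checked_of_not_exit h

theorem Passes.ext (h : Passes C r u) :
    Ext u ((C r).node u, (tested var u ((C r).node u) ((C r).ch u)).2) (respOf var C r u) := by
  have := ext_responded (var := var) (u := u) (s := (C r).node u) (ch := (C r).ch u)
  have e : tested var u ((C r).node u) ((C r).ch u)
      = ((C r).node u, (tested var u ((C r).node u) ((C r).ch u)).2) := by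
    rw [Prod.ext_iff]
    exact ⟨h.checked, rfl⟩
  rwa [e] at this

theorem IsExecution.sc_succ_of_S (hE : IsExecution var sup C) (hr : 1 ≤ r) (h : Passes C r u)
    (hS : ((C r).node u).S ≠ ∅) : ((C (r + 1)).node u).sc = (respOf var C r u).1.sc := by
  rcases hE.sc_succ hr u with h' | h'
  · exact h'
  · exact absurd ((h.ext (var := var)).S_eq_empty.1 h'.1) hS

/-- Shortcuts persist, as long as the checks are passed. -/
theorem IsExecution.sc_isPrefix (hE : IsExecution var sup C) (hr : 1 ≤ r) (h : Passes C r u)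
    (d : Side) : ((C r).node u).sc d <+: ((C (r + 1)).node u).sc d := by
  by_cases hS : ((C r).node u).S = ∅
  · rw [Node.S_eq_empty.1 hS d]
    exact List.nil_prefix
  · rw [hE.sc_succ_of_S hr h hS]
    exact h.ext.sc d

theorem IsExecution.sc_nil (hE : IsExecution var sup C) (hr : 1 ≤ r) (h : Passes C r u)
    (hS : ((C r).node u).S ≠ ∅) {d : Side} (hd : ((C r).node u).sc d = []) :
    ((C (r + 1)).node u).sc d = [] := by
  rw [hE.sc_succ_of_S hr h hS]
  exact h.ext.nil d hd

theorem IsExecution.S_succ (hE : IsExecution var sup C) (hr : 1 ≤ r) (h : Passes C r u)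
    (hS : ((C r).node u).S ≠ ∅) : ((C (r + 1)).node u).S ≠ ∅ := by
  obtain ⟨d, hd⟩ := Node.S_ne_empty.1 hS
  refine Node.S_ne_empty.2 ⟨d, fun h' => hd ?_⟩
  have := hE.sc_isPrefix hr h d
  rw [h'] at this
  exact List.prefix_nil.1 this

theorem IsExecution.flyID_persist (hE : IsExecution var sup C) (hr : 1 ≤ r) (h : Passes C r u)
    (hf : ((C r).node u).flyID ≠ u) :
    ((C (r + 1)).node u).flyID = ((C r).node u).flyID := by
  rw [hE.flyID_succ hr]
  rcases (h.ext (var := var)).flyID with h' | h'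
  · exact h'
  · exact absurd h'.1 hf

theorem IsExecution.vID_succ (hE : IsExecution var sup C) (hr : 1 ≤ r) (h : ¬ ExitSet C r u)
    (hS : ((C r).node u).S ≠ ∅) : ((C (r + 1)).node u).vID = ((C r).node u).vID := by
  have hx := ((passes_of_not_exitSet h).ext (var := var))
  rw [(hE.node_succ hr u).2.1, localRound_vID_eq, advised_vID]
  · exact hx.vID
  · exact fun h' => hS (hx.S_eq_empty.1 h')
  · rw [← hE.exit_succ hr]
    exact exit_succ_of_not_exitSet h

/-- An exiting node rejects its shortcuts and its flyover id. -/
theorem IsExecution.exitSet_of_exitSet (hE : IsExecution var sup C) (hr : 1 ≤ r)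
    (h : ExitSet C r u) {x : V} (hx : x ∈ ((C r).node u).S ∨ x = ((C r).node u).flyID) :
    ExitSet C r x ∨ ExitSet C (r + 1) x ∨ ExitSet C (r + 2) x := by
  by_cases hne : x = u
  · exact .inl (hne ▸ h)
  by_cases hp : Passes C r u
  · have he : ((C (r + 1)).node u).exit = true := by
      rcases h with h | h
      · simp [Passes, h] at hp
      · exact h
    have hx' : x ∈ ((C (r + 1)).node u).S ∪ {((C (r + 1)).node u).flyID} ∪
        ((C (r + 1)).node u).cIds := by
      simp only [Finset.mem_union, Finset.mem_singleton]
      refine .inl ?_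
      rcases hx with hx | hx
      · left
        obtain ⟨d, hd⟩ := Node.mem_S.1 hx
        exact Node.mem_S.2 ⟨d, (hE.sc_isPrefix hr hp d).subset hd⟩
      · right
        rw [hE.flyID_persist hr hp (hx ▸ hne)]
        exact hx
    have := mem_tested_of_exit (var := var) (ch := (C (r + 1)).ch u)
      (basicChecks_exit_of_exit he) hx' hne
    exact .inr (.inr (.inl (basicChecks_exit_of_rejFlyover
      (hE.mem_ch_of_tested (by omega) this))))
  · have := mem_tested_of_exit (var := var) (ch := (C r).ch u) (s := (C r).node u) (u := u)
      (by simpa [Passes] using hp) (x := x) (by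
        simp only [Finset.mem_union, Finset.mem_singleton]
        exact .inl hx) hne
    exact .inr (.inl (.inl (basicChecks_exit_of_rejFlyover (hE.mem_ch_of_tested hr this))))

/-! ### Living nodes -/

/-- `u` does not exit in the rounds from `a` to `b`. -/
def AliveOn (C : ℕ → Config V) (a b : ℕ) (u : V) : Prop := ∀ t, a ≤ t → t ≤ b → ¬ ExitSet C t u

theorem AliveOn.mono {a b a' b' : ℕ} (h : AliveOn C a b u) (ha : a ≤ a') (hb : b' ≤ b) :
    AliveOn C a' b' u := fun t h1 h2 => h t (ha.trans h1) (h2.trans hb)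

theorem AliveOn.passes {a b t : ℕ} (h : AliveOn C a b u) (h1 : a ≤ t) (h2 : t ≤ b) :
    Passes C t u := passes_of_not_exitSet (h t h1 h2)

theorem AliveOn.sc_isPrefix (hE : IsExecution var sup C) {a b t t' : ℕ} (h : AliveOn C a b u)
    (ha : 1 ≤ a) (h1 : a ≤ t) (h2 : t ≤ t') (h3 : t' ≤ b + 1) (d : Side) :
    ((C t).node u).sc d <+: ((C t').node u).sc d := by
  induction t', h2 using Nat.le_induction with
  | base => exact List.prefix_rfl
  | succ n hn ih =>
    exact (ih (by omega)).trans
      (hE.sc_isPrefix (by omega) (h.passes (by omega) (by omega)) d)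

theorem AliveOn.S_ne (hE : IsExecution var sup C) {a b t t' : ℕ} (h : AliveOn C a b u)
    (ha : 1 ≤ a) (h1 : a ≤ t) (h2 : t ≤ t') (h3 : t' ≤ b + 1) (hS : ((C t).node u).S ≠ ∅) :
    ((C t').node u).S ≠ ∅ := by
  induction t', h2 using Nat.le_induction with
  | base => exact hS
  | succ n hn ih =>
    exact hE.S_succ (by omega) (h.passes (by omega) (by omega)) (ih (by omega))

theorem AliveOn.sc_nil (hE : IsExecution var sup C) {a b t t' : ℕ} (h : AliveOn C a b u)
    (ha : 1 ≤ a) (h1 : a ≤ t) (h2 : t ≤ t') (h3 : t' ≤ b + 1) (hS : ((C t).node u).S ≠ ∅)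
    {d : Side} (hd : ((C t).node u).sc d = []) : ((C t').node u).sc d = [] := by
  induction t', h2 using Nat.le_induction with
  | base => exact hd
  | succ n hn ih =>
    exact hE.sc_nil (by omega) (h.passes (by omega) (by omega))
      (h.S_ne hE ha h1 hn (by omega) hS) (ih (by omega))

theorem AliveOn.vID_eq (hE : IsExecution var sup C) {a b t t' : ℕ} (h : AliveOn C a b u)
    (ha : 1 ≤ a) (h1 : a ≤ t) (h2 : t ≤ t') (h3 : t' ≤ b + 1) (hS : ((C t).node u).S ≠ ∅) :
    ((C t').node u).vID = ((C t).node u).vID := by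
  induction t', h2 using Nat.le_induction with
  | base => rfl
  | succ n hn ih =>
    rw [hE.vID_succ (by omega) (h n (by omega) (by omega))
      (h.S_ne hE ha h1 hn (by omega) hS), ih (by omega)]

theorem getElem?_of_isPrefix {α : Type*} {l l' : List α} (h : l <+: l') {i : ℕ} {x : α}
    (hx : l[i]? = some x) : l'[i]? = some x := by
  obtain ⟨k, rfl⟩ := h
  rw [List.getElem?_append_left (List.getElem?_eq_some_iff.1 hx).1, hx]

theorem mem_S_of_getElem? {s : Node V} {d : Side} {i : ℕ} {x : V} (h : (s.sc d)[i]? = some x) :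
    x ∈ s.S := Node.mem_S.2 ⟨d, List.mem_of_getElem? h⟩

theorem S_ne_of_getElem? {s : Node V} {d : Side} {i : ℕ} {x : V} (h : (s.sc d)[i]? = some x) :
    s.S ≠ ∅ := Finset.ne_empty_of_mem (mem_S_of_getElem? h)

/-- A node that has a living node among its shortcuts lives, too. -/
theorem AliveOn.of_mem_S (hE : IsExecution var sup C) {a b : ℕ} (ha : 1 ≤ a) {x y : V}
    (h : AliveOn C a b x) (hy : x ∈ ((C a).node y).S) : AliveOn C a (b - 2) y := by
  -- Induction on the round: until its first exit, `y` keeps `x` as a shortcut, and that exit would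
  -- make `x` exit at most two rounds later, still within its lifetime.
  have key : ∀ n, (∀ t, a ≤ t → t ≤ b - 2 → t < n → ¬ ExitSet C t y) := by
    intro n
    induction n with
    | zero => intro t _ _ h; omega
    | succ n ih =>
      intro t h1 h2 h3
      rcases Nat.lt_succ_iff_lt_or_eq.1 h3 with h4 | rfl
      · exact ih t h1 h2 h4
      intro hex
      have hxt : x ∈ ((C t).node y).S := by
        rcases Nat.lt_or_ge a t with hat | hat
        · have hl : AliveOn C a (t - 1) y := fun t' h5 h6 => ih t' h5 (by omega) (by omega)
          obtain ⟨d, hd⟩ := Node.mem_S.1 hy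
          exact Node.mem_S.2 ⟨d, (hl.sc_isPrefix hE ha le_rfl h1 (by omega) d).subset hd⟩
        · obtain rfl : t = a := by omega
          exact hy
      rcases hE.exitSet_of_exitSet (by omega) hex (.inl hxt) with h' | h' | h'
      · exact h t (by omega) (by omega) h'
      · exact h (t + 1) (by omega) (by omega) h'
      · exact h (t + 2) (by omega) (by omega) h'
  intro t h1 h2
  exact key (t + 1) t h1 h2 (by omega)

theorem IsExecution.testLine_mem (hE : IsExecution var sup C) (hr : 1 ≤ r) {z w : V}
    (hz : Passes C r z) {d : Side} (hw : (((C r).node z).sc d).head? = some w) :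
    Msg.testLine d z ∈ (C (r + 1)).ch w := by
  refine hE.mem_ch_of_tested hr (u := z) ?_
  have hc := hz.checked
  simp only [tested, Multiset.mem_add, testFlyoverConstruction, mem_sendList, List.mem_map, hc]
  refine .inl (.inl (.inr (.inl (.inl ?_))))
  cases d
  · exact .inr ⟨w, by simp [hw], rfl⟩
  · exact .inl ⟨w, by simp [hw], rfl⟩

theorem head?_of_isPrefix {α : Type*} {l l' : List α} (h : l <+: l') (hn : l = [] → l' = []) :
    l.head? = l'.head? := by
  cases l with
  | nil => rw [hn rfl]
  | cons y l =>
    obtain ⟨k, rfl⟩ := h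
    rfl

/-- The head of a shortcut list after the responses was there before. -/
theorem head?_of_ext {b : Node V × Out V} {w z : V} {d : Side}
    (hb : Ext w (tested var w ((C r).node w) ((C r).ch w)) b)
    (hz : (b.1.sc d).head? = some z) :
    Passes C r w ∧ (((C r).node w).sc d).head? = some z := by
  have h1 := head?_of_isPrefix (hb.sc d) (hb.nil d)
  rw [hz] at h1
  have hp : Passes C r w := by
    by_contra hp
    have := (checked_of_exit (by simpa [Passes] using hp)).1 d
    simp only [tested, this] at h1
    simp at h1
  have e : (tested var w ((C r).node w) ((C r).ch w)).1 = (C r).node w := hp.checked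
  exact ⟨hp, e ▸ h1⟩

/-- The tests of a line: a living node is a neighbor of its neighbors one round later. -/
theorem IsExecution.head_of_testLine (hE : IsExecution var sup C) (hr : 1 ≤ r) {z w : V}
    (hz : AliveOn C r (r + 2) z) {d : Side} (hw : (((C r).node z).sc d).head? = some w) :
    Passes C (r + 1) w ∧ (((C (r + 1)).node w).sc d.opp).head? = some z := by
  have hm := hE.testLine_mem hr (hz.passes le_rfl (by omega)) hw
  obtain ⟨b, hb, hb'⟩ := respond_testLine var w
    (tested var w ((C (r + 1)).node w) ((C (r + 1)).ch w)) hm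
  -- A rejection sent in round `r + 1` would be read by `z` in round `r + 2`, where `z` still lives.
  have hrej : (z, Msg.rejFlyover) ∉ (onTestLine w b (.testLine d z)).2 := by
    intro h
    exact hz (r + 2) (by omega) (by omega) (.inl (basicChecks_exit_of_rejFlyover
      (hE.mem_ch_of_resp (r := r + 1) (u := w) (by omega) (hb'.out _ h))))
  refine head?_of_ext hb ?_
  by_contra hne
  apply hrej
  simp only [onTestLine, if_pos hne]
  rw [if_pos (by simp)]
  exact Multiset.mem_add.2 (.inr (mem_sendAll.2 ⟨by simp, rfl⟩))

/-- The sign of the change of virtual ids in a direction. -/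
def Side.sign : Side → ℤ
  | .left => -1
  | .right => 1

/-- The tests of virtual ids. -/
theorem IsExecution.vID_of_testvID (hE : IsExecution var sup C) (hr : 1 ≤ r) {z w : V}
    (hz : Passes C r z) (hw : ¬ ExitSet C (r + 1) w) {d : Side} {i : ℕ}
    (hi : (((C r).node z).sc d)[i]? = some w) :
    ((C (r + 1)).node w).vID = ((C r).node z).vID + d.sign * 2 ^ i := by
  have hm : Msg.testvID (((C r).node z).vID + d.sign * 2 ^ i) ∈ (C (r + 1)).ch w := by
    refine hE.mem_ch_of_tested hr (u := z) ?_
    have hc := hz.checked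
    simp only [tested, Multiset.mem_add, testFlyoverMetadata, mem_sendList, List.mem_map, hc]
    refine .inr (.inl (.inl ?_))
    cases d
    · exact .inr ⟨(w, i), List.mem_zipIdx_iff_getElem?.2 hi, by simp [Side.sign, sub_eq_add_neg]⟩
    · exact .inl ⟨(w, i), List.mem_zipIdx_iff_getElem?.2 hi, by simp [Side.sign]⟩
  generalize ((C r).node z).vID + d.sign * 2 ^ i = x at hm ⊢
  obtain ⟨b, hb, hb'⟩ := respond_testvID var w
    (tested var w ((C (r + 1)).node w) ((C (r + 1)).ch w)) hm
  have hex := exit_succ_of_not_exitSet hw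
  rw [hE.exit_succ (by omega)] at hex
  have h1 : (tested var w ((C (r + 1)).node w) ((C (r + 1)).ch w)).1 = (C (r + 1)).node w :=
    (passes_of_not_exitSet hw).checked
  by_contra hne
  have : (onTestvID b (.testvID x)).1.exit = true := by
    simp only [onTestvID]
    rw [if_pos]
    right
    rw [hb.vID, h1]
    exact hne
  exact absurd ((hb'.exit this).symm.trans hex) (by simp)

/-- The construction of shortcuts. -/
theorem IsExecution.sc_of_flyConst (hE : IsExecution var sup C) (hr : 1 ≤ r) {y v w : V}
    (hy : Passes C r y) (hw : ¬ ExitSet C (r + 1) w) {d : Side} {i : ℕ}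
    (h1 : (((C r).node y).sc d)[i]? = some w) (h2 : (((C r).node y).sc d.opp)[i]? = some v)
    (h3 : (((C (r + 1)).node w).sc d.opp)[i]? = some y) :
    (((C (r + 2)).node w).sc d.opp)[i + 1]? = some v := by
  have hm : Msg.flyConst d v i y ∈ (C (r + 1)).ch w := by
    refine hE.mem_ch_of_tested hr (u := y) ?_
    have hc := hy.checked
    simp only [tested, Multiset.mem_add, testFlyoverConstruction, mem_sendList, List.mem_map, hc]
    refine .inl (.inl (.inr ?_))
    cases d
    · refine .inr ⟨((w, v), i), List.mem_zipIdx_iff_getElem?.2 ?_, rfl⟩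
      exact List.getElem?_zip_eq_some.2 ⟨h1, h2⟩
    · refine .inl (.inr ⟨((v, w), i), List.mem_zipIdx_iff_getElem?.2 ?_, rfl⟩)
      exact List.getElem?_zip_eq_some.2 ⟨h2, h1⟩
  obtain ⟨b, hb, hb'⟩ := respond_flyConst var w
    (tested var w ((C (r + 1)).node w) ((C (r + 1)).ch w)) hm
  have hp := passes_of_not_exitSet hw
  have hex := exit_succ_of_not_exitSet hw
  rw [hE.exit_succ (by omega)] at hex
  have e : (tested var w ((C (r + 1)).node w) ((C (r + 1)).ch w)).1 = (C (r + 1)).node w :=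
    hp.checked
  have hbi : (b.1.sc d.opp)[i]? = some y :=
    getElem?_of_isPrefix (hb.sc d.opp) (by rw [e]; exact h3)
  have hbe : (onFlyConst w b (.flyConst d v i y)).1.exit = false := by
    by_contra h
    exact absurd ((hb'.exit (by simpa using h)).symm.trans hex) (by simp)
  have hfin : ((onFlyConst w b (.flyConst d v i y)).1.sc d.opp)[i + 1]? = some v := by
    have hlen := (List.getElem?_eq_some_iff.1 hbi).1
    simp only [onFlyConst] at hbe ⊢
    by_cases hp : (b.1.sc d.opp = [] ∨ (i < (b.1.sc d.opp).length ∧ (b.1.sc d.opp)[i]? ≠ some y)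
        ∨ (i + 1 < (b.1.sc d.opp).length ∧ (b.1.sc d.opp)[i + 1]? ≠ some v))
    · simp only [if_pos hp] at hbe
      simp [sendRejFly, flush] at hbe
    · have hbx : b.1.exit = false := by
        by_contra hx
        have hx' := (ext_onFlyConst w b (.flyConst d v i y)).exit (by simpa using hx)
        simp only [onFlyConst] at hx'
        rw [hx'] at hbe
        exact absurd hbe (by simp)
      have hlt : ¬ (b.1.sc d.opp).length < i + 1 := by omega
      simp only [if_neg hp]
      simp only [hbx, hlt, and_false, if_false, true_and, hbi, and_true]
      push Not at hp
      -- Either the next level is empty and `v` is appended, or it is occupied and the check that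
      -- did not fire shows that the entry is `v`.
      by_cases hl : (b.1.sc d.opp).length = i + 1
      · have h4 : ∀ s' : Node V, s'.sc = Function.update b.1.sc d.opp (b.1.sc d.opp ++ [v]) →
            (s'.sc d.opp)[i + 1]? = some v := by
          intro s' hs'
          rw [hs', Function.update_self, List.getElem?_append_right (by omega)]
          simp [hl]
        split_ifs <;> exact h4 _ rfl
      · have h4 := hp.2.2 (by omega)
        split_ifs <;> exact h4
  have hS : ((C (r + 1)).node w).S ≠ ∅ := S_ne_of_getElem? h3
  rw [hE.sc_succ_of_S (by omega) hp hS]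
  exact getElem?_of_isPrefix (hb'.sc d.opp) hfin

/-- A node that propagates its flyover id tests the nodes in its memory. -/
theorem IsExecution.testFlyID_mem (hE : IsExecution var sup C) (hr : 1 ≤ r) {y z : V}
    (hy : Passes C r y) (hp : propFlyID var y ((C r).node y))
    (hz : z ∈ memory y ((C r).node y) ((C r).ch y)) (hne : z ≠ ((C r).node y).flyID) :
    Msg.testFlyID (some ((C r).node y).flyID) ∈ (C (r + 1)).ch z := by
  refine hE.mem_ch_of_tested hr (u := y) ?_
  have hc := hy.checked
  simp only [tested, Multiset.mem_add, testFlyoverMetadata, hc, if_pos hp]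
  exact .inr (.inr (mem_sendAll.2 ⟨Finset.mem_erase.2 ⟨hne, hz⟩, rfl⟩))

/-- A living node agrees with all flyover ids it is tested for. -/
theorem IsExecution.flyID_of_testFlyID (hE : IsExecution var sup C) (hr : 1 ≤ r) {z f : V}
    (hm : Msg.testFlyID (some f) ∈ (C r).ch z) (hz : ¬ ExitSet C r z)
    (hS : ((C r).node z).S ≠ ∅) (hne : f ≠ z) : ((C (r + 1)).node z).flyID = f := by
  obtain ⟨b, hb, hb'⟩ := respond_testFlyID var z
    (tested var z ((C r).node z) ((C r).ch z)) hm
  have hp := passes_of_not_exitSet hz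
  have hex := exit_succ_of_not_exitSet hz
  rw [hE.exit_succ (by omega)] at hex
  have e : (tested var z ((C r).node z) ((C r).ch z)).1 = (C r).node z := hp.checked
  have hbe : (onTestFlyID z b (.testFlyID (some f))).1.exit = false := by
    by_contra h
    exact absurd ((hb'.exit (by simpa using h)).symm.trans hex) (by simp)
  have hSb : b.1.S ≠ ∅ := fun h => hS (e ▸ hb.S_eq_empty.1 h)
  have hf : (onTestFlyID z b (.testFlyID (some f))).1.flyID = f := by
    simp only [onTestFlyID] at hbe ⊢
    set s' := (if b.1.sc .left ≠ [] ∧ b.1.exit = false ∧ b.1.flyID = z then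
        { b.1 with flyID := (some f).getD z } else b.1) with hs'
    have hS' : s'.S ≠ ∅ := by
      rw [Node.S_congr (s := b.1) (by rw [hs']; split_ifs <;> rfl)]
      exact hSb
    by_contra hne
    have hc : (s'.S ≠ ∅ ∧ some s'.flyID ≠ some f) ∨ (s'.S = ∅ ∧ some f ≠ none) := by
      left
      refine ⟨hS', fun h => hne ?_⟩
      have h' := Option.some.inj h
      split_ifs <;> exact h'
    simp only [if_pos hc] at hbe
    simp [sendRejFly, flush] at hbe
  rw [hE.flyID_succ hr]
  -- A later response could replace the flyover id only if it were `z` itself; hence the hypothesis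
  -- `f ≠ z`.
  rcases hb'.flyID with h | h
  · exact h.trans hf
  · exact absurd (hf.symm.trans h.1) hne

/-- A node that disagrees with a flyover id rejects it. -/
theorem IsExecution.flyID_of_testFlyID_of_alive (hE : IsExecution var sup C) (hr : 1 ≤ r) {z f : V}
    (hm : Msg.testFlyID (some f) ∈ (C r).ch z) (hf : ¬ ExitSet C (r + 1) f) (hne : f ≠ z) :
    ((C (r + 1)).node z).S ≠ ∅ ∧ ((C (r + 1)).node z).flyID = f := by
  obtain ⟨b, hb, hb'⟩ := respond_testFlyID var z
    (tested var z ((C r).node z) ((C r).ch z)) hm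
  have hrej : (f, Msg.rejFlyover) ∉ (onTestFlyID z b (.testFlyID (some f))).2 := by
    intro h
    exact hf (.inl (basicChecks_exit_of_rejFlyover (hE.mem_ch_of_resp hr (u := z) (hb'.out _ h))))
  have key : (onTestFlyID z b (.testFlyID (some f))).1.S ≠ ∅ ∧
      (onTestFlyID z b (.testFlyID (some f))).1.flyID = f := by
    simp only [onTestFlyID] at hrej ⊢
    generalize (if b.1.sc .left ≠ [] ∧ b.1.exit = false ∧ b.1.flyID = z then
        { b.1 with flyID := (some f).getD z } else b.1) = s' at hrej ⊢
    by_cases hc : (s'.S ≠ ∅ ∧ some s'.flyID ≠ some f) ∨ (s'.S = ∅ ∧ some f ≠ none)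
    · exfalso
      apply hrej
      simp only [if_pos hc, if_true]
      exact Multiset.mem_add.2 (.inr (mem_sendAll.2 ⟨by simp, rfl⟩))
    · simp only [if_neg hc]
      have h2 : s'.S ≠ ∅ ∧ s'.flyID = f := by
        push Not at hc
        have h1 : s'.S ≠ ∅ := fun h => absurd (hc.2 h) (by simp)
        exact ⟨h1, Option.some.inj (hc.1 (Finset.nonempty_iff_ne_empty.2 h1))⟩
      split_ifs <;> exact h2
  have hSr : (respOf var C r z).1.S ≠ ∅ := fun h => key.1 (hb'.S_eq_empty.1 h)
  refine ⟨?_, ?_⟩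
  · rcases hE.sc_succ hr z with h | h
    · rw [Node.S_congr h]
      exact hSr
    · exact absurd h.1 hSr
  · rw [hE.flyID_succ hr]
    rcases hb'.flyID with h | h
    · exact h.trans key.2
    · exact absurd (key.2.symm.trans h.1) hne

/-- A node of a flyover exits when it is told that there is none. -/
theorem IsExecution.exitSet_of_testFlyID_none (hE : IsExecution var sup C) (hr : 1 ≤ r) {z : V}
    (hm : Msg.testFlyID none ∈ (C r).ch z) (hS : ((C r).node z).S ≠ ∅) : ExitSet C r z := by
  by_contra hz
  obtain ⟨b, hb, hb'⟩ := respond_testFlyID var z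
    (tested var z ((C r).node z) ((C r).ch z)) hm
  have hp := passes_of_not_exitSet hz
  have hex := exit_succ_of_not_exitSet hz
  rw [hE.exit_succ (by omega)] at hex
  have e : (tested var z ((C r).node z) ((C r).ch z)).1 = (C r).node z := hp.checked
  have hSb : b.1.S ≠ ∅ := fun h => hS (e ▸ hb.S_eq_empty.1 h)
  have hbe : (onTestFlyID z b (.testFlyID none)).1.exit = true := by
    simp only [onTestFlyID]
    set s' := (if b.1.sc .left ≠ [] ∧ b.1.exit = false ∧ b.1.flyID = z then
        { b.1 with flyID := (none : Option V).getD z } else b.1) with hs'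
    have hS' : s'.S ≠ ∅ := by
      rw [Node.S_congr (s := b.1) (by rw [hs']; split_ifs <;> rfl)]
      exact hSb
    have hc : (s'.S ≠ ∅ ∧ some s'.flyID ≠ none) ∨ (s'.S = ∅ ∧ (none : Option V) ≠ none) :=
      .inl ⟨hS', by simp⟩
    simp only [if_pos hc, if_true, sendRejFly, flush]
  exact absurd ((hb'.exit hbe).symm.trans hex) (by simp)

/-- A node that is in no flyover after the checks says so to the nodes in its memory. -/
theorem IsExecution.testFlyID_none_mem (hE : IsExecution var sup C) (hr : 1 ≤ r) {y z : V}
    (h : ¬ Passes C r y ∨ (((C r).node y).S = ∅ ∧ ((C r).node y).vID = 0))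
    (hz : z ∈ memory y ((C r).node y) ((C r).ch y)) :
    Msg.testFlyID none ∈ (C (r + 1)).ch z := by
  have h1 : (checked y ((C r).node y) ((C r).ch y)).S = ∅ ∧
      (checked y ((C r).node y) ((C r).ch y)).vID = 0 := by
    by_cases hp : Passes C r y
    · rw [hp.checked]
      exact h.resolve_left (not_not_intro hp)
    · have := checked_of_exit (u := y) (s := (C r).node y) (ch := (C r).ch y)
        (by simpa [Passes] using hp)
      exact ⟨Node.S_eq_empty.2 this.1, this.2.1⟩
  -- The tests address the memory after the checks, which still contains all rejected ids.
  have h2 : z ∈ memory y (checked y ((C r).node y) ((C r).ch y)) ((C r).ch y) := by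
    simp only [memory, Finset.mem_erase, Finset.mem_union] at hz ⊢
    exact ⟨hz.1, hz.2.imp_left (checked_addr hz.1)⟩
  refine hE.mem_ch_of_tested hr (u := y) ?_
  simp only [tested, Multiset.mem_add, testFlyoverMetadata, if_pos h1]
  exact .inr (.inl (.inr (mem_sendAll.2 ⟨h2, rfl⟩)))

end Execution

/-! ### Neighbors join simultaneously -/

section Join

variable [Fintype V] {var : Variant} {sup : ℕ → V → Supervision V} {C : ℕ → Config V}
  {r : ℕ} {u : V}

/-- Only a node that has just adopted an advice sends `TestAdvice`. -/
theorem IsExecution.testAdvice_origin (hE : IsExecution var sup C) (hr : 2 ≤ r) {q v : V} {d : ℤ}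
    (h : Msg.testAdvice d v ∈ (C r).ch q) :
    ((C r).node v).t = 4 ∧ ((C r).node v).dist = d := by
  obtain ⟨j, rfl⟩ : ∃ j, r = j + 1 := ⟨r - 1, by omega⟩
  rcases hE.mem_ch (by omega) h with ⟨p, hp⟩ | ⟨_, hp⟩ | ⟨_, _, hp, -⟩
  · rcases mem_localRound hp with h' | ⟨h1, h2⟩ | ⟨-, _, _, h', -⟩ | ⟨-, -, _, _, h', -⟩
    · exact absurd h' (by simp [Msg.IsTest])
    · simp only [Msg.testAdvice.injEq] at h2
      obtain ⟨rfl, rfl⟩ := h2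
      obtain ⟨-, -, -, -, -, e1, e2⟩ := hE.node_succ (r := j) (by omega) v
      exact ⟨e1.trans h1, e2⟩
    · exact absurd h' (by simp)
    · exact absurd h' (by simp)
  · exact absurd hp (by simp)
  · exact absurd hp (by simp)

/-- The origin of `Verified` messages. -/
theorem IsExecution.verified_origin (hE : IsExecution var sup C) (hr : 2 ≤ r) {y v : V} {k : Kin}
    (h : Msg.verified k v ∈ (C (r + 1)).ch y) :
    match k with
    | .parent => ((C r).node y).t = 4 ∧ 1 < ((C (r + 1)).node v).t ∧
        ((C r).node y).dist = ((C (r + 1)).node v).dist + 1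
    | .child => ((C r).node v).t = 4 ∧ ((C r).node v).dist = ((C (r + 1)).node y).dist + 1
    | _ => ((C r).node y).t = 4 ∧ ((C r).node v).t = 4 := by
  rcases hE.mem_ch (by omega) h with ⟨q, hq⟩ | ⟨_, hp⟩ | ⟨_, _, hp, -⟩
  · rcases mem_localRound hq with h' | ⟨h1, h2⟩ | ⟨h0, k', v', h', h1, h2, h3, h4⟩ |
      ⟨-, -, _, _, h', -⟩
    · exact absurd h' (by simp [Msg.IsTest])
    · exact absurd h2 (by simp)
    · simp only [Msg.verified.injEq] at h'
      obtain ⟨rfl, rfl⟩ := h'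
      obtain ⟨-, -, -, -, -, e1, e2⟩ := hE.node_succ (r := r) (by omega) q
      rw [← e1] at h0
      rw [← e2] at h2 h4
      have h2 := fun hk => hE.testAdvice_origin hr (h2 hk)
      have h4 := fun hk => hE.testAdvice_origin hr (h4 hk)
      dsimp only at h3 h2
      cases k with
      | parent =>
        obtain rfl := h1 rfl
        exact ⟨(h2 (by simp)).1, h0, (h2 (by simp)).2⟩
      | child =>
        obtain rfl := h3 rfl
        exact h4 (by simp)
      | sibUp => exact ⟨(h2 (by simp)).1, (h4 (by simp)).1⟩
      | sibDown => exact ⟨(h2 (by simp)).1, (h4 (by simp)).1⟩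
    · exact absurd h' (by simp)
  · exact absurd hp (by simp)
  · exact absurd hp (by simp)

/-- From 4 the timer can only count down, and `dist` changes only in rounds that leave the timer at
4. So the distances used in one tree transformation can be compared across rounds. -/
theorem IsExecution.dist_eq_of_t (hE : IsExecution var sup C) (hr : 1 ≤ r)
    (h : ((C r).node u).t = 4) :
    ((C (r + 1)).node u).t = 3 ∧ ((C (r + 2)).node u).t = 2 ∧ ((C (r + 3)).node u).t = 1 ∧
    ((C (r + 1)).node u).dist = ((C r).node u).dist ∧
    ((C (r + 2)).node u).dist = ((C r).node u).dist := by
  have h1 := hE.ticks hr u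
  have h2 := hE.ticks (r := r + 1) (by omega) u
  have h3 := hE.ticks (r := r + 2) (by omega) u
  have h4 := hE.dist_succ hr u
  have h5 := hE.dist_succ (r := r + 1) (by omega) u
  simp only [Ticks, add_assoc, Nat.reduceAdd] at *
  omega

/-- The origin of `Path` messages: one of the two partners has adopted an advice three rounds
earlier, and the other one did so, too, or is its predecessor in the tree. -/
theorem IsExecution.path_origin (hE : IsExecution var sup C) (hr : 2 ≤ r) {x v : V} {e : Side}
    (h : Msg.path e v ∈ (C (r + 2)).ch x) : ∃ X Y : V, ∃ D : ℤ,
      ((x = X ∧ v = Y) ∨ (x = Y ∧ v = X)) ∧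
      (((C r).node X).t = 4 ∨ ((C (r + 1)).node X).dist + 1 = D) ∧
      ((C r).node Y).t = 4 ∧ D ≤ ((C r).node Y).dist := by
  rcases hE.mem_ch (r := r + 1) (by omega) h with ⟨p, hp⟩ | ⟨_, hp⟩ | ⟨_, _, hp, -⟩
  · rcases mem_localRound hp with h' | ⟨h1, h2⟩ | ⟨h0, k', v', h', -⟩ |
      ⟨-, ⟨q, hq⟩, e', v', h', X, Y, hX, hY, hxy⟩
    · exact absurd h' (by simp [Msg.IsTest])
    · exact absurd h2 (by simp)
    · exact absurd h' (by simp)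
    · simp only [Msg.path.injEq] at h'
      obtain ⟨rfl, rfl⟩ := h'
      have hp4 := (hE.verified_origin hr hq).1
      -- The node `p` executes the transformation, `X` is its parent or a sibling, and `Y` is `p` or
      -- one of its children. Measured by the distance of `p`, a parent is one below, and `Y` is not
      -- below.
      refine ⟨X, Y, ((C r).node p).dist, hxy, ?_, ?_⟩
      · rcases hX with hX | hX | hX
        · exact .inr (hE.verified_origin hr hX).2.2.symm
        · exact .inl (hE.verified_origin hr hX).2
        · exact .inl (hE.verified_origin hr hX).2
      · rcases hY with rfl | hY
        · exact ⟨hp4, le_rfl⟩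
        · have h1 := hE.verified_origin hr hY
          have h2 := hE.dist_eq_of_t (by omega) hp4
          refine ⟨h1.1, ?_⟩
          omega
  · exact absurd hp (by simp)
  · exact absurd hp (by simp)

/-- Two nodes cannot be joined in two successive rounds. -/
theorem IsExecution.not_path_path (hE : IsExecution var sup C) (hr : 2 ≤ r) {z w : V} {e e' : Side}
    (h1 : Msg.path e w ∈ (C (r + 2)).ch z) (h2 : Msg.path e' z ∈ (C (r + 3)).ch w) :
    ((C (r + 4)).node w).t = 0 ∨ ((C (r + 4)).node w).t = 5 := by
  obtain ⟨X, Y, D, hxy, hX, hY, hD⟩ := hE.path_origin hr h1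
  obtain ⟨X', Y', D', hxy', hX', hY', hD'⟩ := hE.path_origin (r := r + 1) (by omega) h2
  -- The timer of `w` is 1 in round `r + 3`, so it then expires or restarts.
  have hw : ((C r).node w).t = 4 → ((C (r + 4)).node w).t = 0 ∨ ((C (r + 4)).node w).t = 5 := by
    intro h
    have h3 := (hE.dist_eq_of_t (by omega) h).2.2.1
    have h4 := hE.ticks (r := r + 3) (by omega) w
    simp only [Ticks, add_assoc, Nat.reduceAdd] at h4
    omega
  rcases hxy with ⟨rfl, rfl⟩ | ⟨rfl, rfl⟩
  · exact hw hY
  have hz := hE.dist_eq_of_t (by omega) hY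
  rcases hxy' with ⟨rfl, rfl⟩ | ⟨rfl, rfl⟩
  · omega
  rcases hX with hX | hX
  · exact hw hX
  rcases hX' with hX' | hX'
  · omega
  -- In the remaining case each of `z` and `w` would be strictly closer to the root than the other,
  -- the distance of `z` being constant in the meantime.
  · simp only [add_assoc, Nat.reduceAdd] at *
    omega

/-- The neighbor relation of living nodes is symmetric, because neighbors join simultaneously. -/
theorem IsExecution.head_symm (hE : IsExecution var sup C)
    (hj : var.joinLimit = 0 ∨ var.joinLimit = 1) (hr : 5 ≤ r) {z w : V}
    (hz : AliveOn C r (r + 2) z) {d : Side} (hw : (((C r).node z).sc d).head? = some w) :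
    (((C r).node w).sc d.opp).head? = some z := by
  obtain ⟨hp, hh⟩ := hE.head_of_testLine (by omega) hz hw
  rcases hE.sc_succ (r := r) (by omega) w with hs | ⟨hS, hex, hjt, hpath⟩
  · rw [hs] at hh
    exact (head?_of_ext (var := var) ext_responded hh).2
  -- It remains that `w` acquired its neighbor by joining a path in round `r`, one round too late.
  exfalso
  have hzw : Msg.path d.opp z ∈ (C r).ch w := hpath _ _ (List.mem_of_mem_head? hh)
  have hv : ((C (r + 1)).node w).vID ≠ 0 := by
    obtain ⟨-, -, -, h1, h2⟩ := not_checks hp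
    intro h0
    by_cases hl : ((C (r + 1)).node w).sc .left = []
    · refine h1 ⟨hl, ?_, .inl (by omega)⟩
      intro hr'
      cases d
      · simp [Side.opp, hr'] at hh
      · simp [Side.opp, hl] at hh
    · exact h2 ⟨hl, by omega⟩
  -- A free node with an expired timer loses its virtual id, but `w` passes the next checks with
  -- shortcuts and so has one. A restart is possible only from an expired timer.
  have ht5 : ((C (r + 1)).node w).t ≠ 0 ∧ ((C (r + 1)).node w).t ≠ 5 := by
    have h1 : ¬ max 0 (min 5 ((C r).node w).t - 1) ≤ var.joinLimit := by
      intro h1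
      apply hv
      rw [(hE.node_succ (by omega) w).2.1, localRound_vID_eq]
      exact advised_vID_zero hj hS h1
    have h2 := hE.ticks (r := r) (by omega) w
    unfold Ticks at h2
    omega
  obtain ⟨k, rfl⟩ : ∃ k, r = k + 3 := ⟨r - 3, by omega⟩
  -- If `z` had `w` as neighbor a round earlier, its TestLine reached `w` in the joining round and
  -- would have set `exit`, which forbids joining. Otherwise `z` joined just one round before `w`,
  -- against `not_path_path`.
  rcases hE.sc_succ (r := k + 2) (by omega) z with hs | ⟨-, -, -, hpath'⟩
  · rw [show k + 3 = k + 2 + 1 from rfl, hs] at hw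
    obtain ⟨hp', hw'⟩ := head?_of_ext (var := var) ext_responded hw
    have hm := hE.testLine_mem (by omega) hp' hw'
    obtain ⟨b, hb, hb'⟩ := respond_testLine var w
      (tested var w ((C (k + 3)).node w) ((C (k + 3)).ch w)) hm
    have hSb : b.1.S = ∅ := by
      rw [hb.S_eq_empty, ← ext_responded.S_eq_empty]
      exact hS
    have : (onTestLine w b (.testLine d z)).1.exit = true := by
      simp only [onTestLine, Node.S_eq_empty.1 hSb d.opp]
      simp [sendRejFly, flush]
    exact absurd ((hb'.exit this).symm.trans hex) (by simp)
  · have hwz : Msg.path d w ∈ (C (k + 2)).ch z := hpath' _ _ (List.mem_of_mem_head? hw)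
    have := hE.not_path_path (r := k) (by omega) hwz hzw
    simp only [add_assoc, Nat.reduceAdd] at ht5
    omega

end Join

/-! ### Pointer doubling and the root of a living node -/

/-- `B` contains the neighbors of its elements in direction `d`. -/
def ClosedUnder (C : Config V) (d : Side) (B : Finset V) : Prop :=
  ∀ b ∈ B, ∀ x, ((C.node b).sc d).head? = some x → x ∈ B

section Root

variable [Fintype V] {var : Variant} {sup : ℕ → V → Supervision V} {C : ℕ → Config V}
  {a b : ℕ} {z : V}

/-- The two checks on left shortcuts tie the absence of a left neighbor to virtual id 1, and force
such a node to carry its own flyover id: it is a root. -/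
theorem Passes.one_le_vID {r : ℕ} (h : Passes C r z) (hS : ((C r).node z).S ≠ ∅) :
    1 ≤ ((C r).node z).vID ∧ (1 < ((C r).node z).vID ↔ ((C r).node z).sc .left ≠ []) ∧
    (((C r).node z).sc .left = [] → ((C r).node z).flyID = z) := by
  obtain ⟨-, -, -, h1, h2⟩ := not_checks h
  by_cases hl : ((C r).node z).sc .left = []
  · have hr : ((C r).node z).sc .right ≠ [] := by
      intro hr
      apply hS
      rw [Node.S_eq_empty]
      rintro (_ | _)
      exacts [hl, hr]
    have h3 : ((C r).node z).vID = 1 ∧ ((C r).node z).flyID = z := by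
      by_contra h3
      exact h1 ⟨hl, hr, by tauto⟩
    exact ⟨h3.1.ge, by simp [h3.1, hl], fun _ => h3.2⟩
  · have h3 : 1 < ((C r).node z).vID := by
      by_contra h3
      exact h2 ⟨hl, by omega⟩
    exact ⟨h3.le, by simp [h3, hl], fun h => absurd h hl⟩

/-- To the left of a living node there is, at every distance that is a power of two and allowed by
its virtual id, another living node, and in time a shortcut to it and back. -/
theorem IsExecution.exists_shortcut (hE : IsExecution var sup C)
    (hj : var.joinLimit = 0 ∨ var.joinLimit = 1) (ha : 5 ≤ a) (i : ℕ) :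
    ∀ (z : V) (b : ℕ), AliveOn C a b z → ((C a).node z).S ≠ ∅ → 2 ^ i < ((C a).node z).vID →
      a + 2 * i + 4 ≤ b → ∃ y, AliveOn C a (b - 2) y ∧ ((C a).node y).S ≠ ∅ ∧
        ((C a).node y).vID = ((C a).node z).vID - 2 ^ i ∧
        (∀ t, a + 2 * i ≤ t → t + 1 ≤ b → (((C t).node z).sc .left)[i]? = some y ∧
          (((C t).node y).sc .right)[i]? = some z) ∧
        (∀ B, ClosedUnder (C a) .right B → y ∈ B → z ∈ B) ∧
        (∀ B, ClosedUnder (C a) .left B → z ∈ B → y ∈ B) := by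
  induction i with
  | zero =>
    intro z b hz hS hv hb
    obtain ⟨-, h1, -⟩ := (hz.passes le_rfl (by omega)).one_le_vID hS
    have hl := h1.1 (by simpa using hv)
    obtain ⟨y, hy⟩ : ∃ y, (((C a).node z).sc .left).head? = some y := by
      cases h : ((C a).node z).sc .left with
      | nil => exact absurd h hl
      | cons y l => exact ⟨y, rfl⟩
    have hy' : (((C a).node y).sc .right).head? = some z :=
      hE.head_symm hj ha (hz.mono le_rfl (by omega)) hy
    have hy0 : (((C a).node z).sc .left)[0]? = some y := by rw [← hy, List.head?_eq_getElem?]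
    have hz0 : (((C a).node y).sc .right)[0]? = some z := by rw [← hy', List.head?_eq_getElem?]
    have hya : AliveOn C a (b - 2) y := hz.of_mem_S hE (by omega) (mem_S_of_getElem? hz0)
    have hSy := S_ne_of_getElem? hz0
    refine ⟨y, hya, hSy, ?_, fun t h1 h2 => ⟨?_, ?_⟩, fun B hB h => hB y h z hy',
      fun B hB h => hB z h y hy⟩
    · have h3 := hE.vID_of_testvID (by omega) (hz.passes le_rfl (by omega))
        (hya (a + 1) (by omega) (by omega)) hy0
      rw [hya.vID_eq hE (by omega) le_rfl (by omega) (by omega) hSy] at h3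
      rw [h3]
      simp [Side.sign, sub_eq_add_neg]
    · exact getElem?_of_isPrefix (hz.sc_isPrefix hE (by omega) le_rfl (by omega) (by omega) _) hy0
    · exact getElem?_of_isPrefix (hya.sc_isPrefix hE (by omega) le_rfl (by omega) (by omega) _) hz0
  | succ i ih =>
    intro z b hz hS hv hb
    have hpow : (0 : ℤ) < 2 ^ i := by positivity
    rw [pow_succ] at hv ⊢
    obtain ⟨y, hy, hSy, hvy, hly, hRy, hLy⟩ := ih z b hz hS (by omega) (by omega)
    obtain ⟨x, hx, hSx, hvx, hlx, hRx, hLx⟩ := ih y (b - 2) hy hSy (by omega) (by omega)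
    have hyp := hy.passes (t := a + 2 * i) (by omega) (by omega)
    obtain ⟨hly1, hly2⟩ := hly (a + 2 * i) le_rfl (by omega)
    obtain ⟨hlx1, hlx2⟩ := hlx (a + 2 * i) le_rfl (by omega)
    -- The middle node `y` introduces its two level-`i` neighbors to each other in round `a + 2 *
    -- i`; two rounds later both have the longer shortcut.
    have h1 : (((C (a + 2 * i + 2)).node z).sc .left)[i + 1]? = some x :=
      hE.sc_of_flyConst (d := .right) (by omega) hyp (hz _ (by omega) (by omega)) hly2 hlx1
        (hly (a + 2 * i + 1) (by omega) (by omega)).1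
    have h2 : (((C (a + 2 * i + 2)).node x).sc .right)[i + 1]? = some z :=
      hE.sc_of_flyConst (d := .left) (by omega) hyp (hx _ (by omega) (by omega)) hlx1 hly2
        (hlx (a + 2 * i + 1) (by omega) (by omega)).2
    -- Induction alone gives a lifetime up to `b - 4`. Once `x` has a shortcut to `z` itself, its
    -- lifetime is bounded by that of `z`, so the loss stays 2 instead of growing with `i`.
    have hx' : AliveOn C (a + 2 * i + 2) (b - 2) x :=
      (hz.mono (by omega) le_rfl).of_mem_S hE (by omega) (mem_S_of_getElem? h2)
    have hxa : AliveOn C a (b - 2) x := by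
      intro t h3 h4
      rcases le_total (a + 2 * i + 2) t with h5 | h5
      · exact hx' t h5 h4
      · exact hx t h3 (by omega)
    refine ⟨x, hxa, hSx, by omega, fun t h3 h4 => ⟨?_, ?_⟩, fun B hB h => hRy B hB (hRx B hB h),
      fun B hB h => hLx B hB (hLy B hB h)⟩
    · exact getElem?_of_isPrefix (hz.sc_isPrefix hE (by omega) (by omega) (by omega) (by omega) _) h1
    · exact getElem?_of_isPrefix (hxa.sc_isPrefix hE (by omega) (by omega) (by omega) (by omega) _) h2

/-- To the left of a living node there is, at every distance `k` that is allowed by its virtual id,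
another living node, and the flyover id of the latter arrives at the former. -/
theorem IsExecution.exists_left (hE : IsExecution var sup C)
    (hj : var.joinLimit = 0 ∨ var.joinLimit = 1) (ha : 5 ≤ a) (i : ℕ) :
    ∀ (z : V) (b k : ℕ), AliveOn C a b z → ((C a).node z).S ≠ ∅ → k < 2 ^ i →
      k < ((C a).node z).vID → a + 2 * i + 4 ≤ b →
      ∃ y, AliveOn C a (b - 2 * i) y ∧ ((C a).node y).S ≠ ∅ ∧
        ((C a).node y).vID = ((C a).node z).vID - k ∧
        (∀ B, ClosedUnder (C a) .right B → y ∈ B → z ∈ B) ∧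
        (∀ B, ClosedUnder (C a) .left B → z ∈ B → y ∈ B) ∧
        ∀ f lo hi, ((C a).node f).vID = 1 → a + 2 * i ≤ lo → hi + 2 * i ≤ b →
          (∀ t, lo ≤ t → t ≤ hi → ((C t).node y).flyID = f) →
          ∀ t, lo + 2 * i ≤ t → t ≤ hi → ((C t).node z).flyID = f := by
  induction i with
  | zero =>
    intro z b k hz hS hk hv hb
    obtain rfl : k = 0 := by simpa using hk
    exact ⟨z, hz, hS, by simp, fun _ _ h => h, fun _ _ h => h,
      fun f lo hi _ _ _ h t h1 h2 => h t h1 h2⟩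
  | succ i ih =>
    intro z b k hz hS hk hv hb
    rcases Nat.lt_or_ge k (2 ^ i) with hk' | hk'
    · obtain ⟨y, hy, hSy, hvy, hR, hL, hf⟩ := ih z b k hz hS hk' hv (by omega)
      exact ⟨y, hy.mono le_rfl (by omega), hSy, hvy, hR, hL, fun f lo hi h1 h2 h3 h4 t h5 h6 =>
        hf f lo hi h1 (by omega) (by omega) h4 t (by omega) h6⟩
    -- The leading binary digit of the distance is one jump of length `2 ^ i` to `y`; the remainder
    -- `m` is left to the induction hypothesis at `y`.
    · obtain ⟨m, rfl⟩ := Nat.exists_eq_add_of_le hk'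
      have hm : m < 2 ^ i := by rw [pow_succ] at hk; omega
      have hpow : (0 : ℤ) < 2 ^ i := by positivity
      push_cast at hv ⊢
      obtain ⟨y, hy, hSy, hvy, hly, hRy, hLy⟩ :=
        hE.exists_shortcut hj ha i z b hz hS (by omega) (by omega)
      obtain ⟨x, hx, hSx, hvx, hRx, hLx, hfx⟩ := ih y (b - 2) m hy hSy hm (by omega) (by omega)
      refine ⟨x, hx.mono le_rfl (by omega), hSx, by omega, fun B hB h => hRy B hB (hRx B hB h),
        fun B hB h => hLx B hB (hLy B hB h), fun f lo hi h1 h2 h3 h4 t h5 h6 => ?_⟩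
      -- The test is sent by `y` in round `t - 2` and read by `z` in round `t - 1`, hence visible in
      -- round `t`.
      have hfy := hfx f lo hi h1 (by omega) (by omega) h4 (t - 2) (by omega) (by omega)
      have hzf : z ≠ f := by rintro rfl; omega
      have hzy : z ≠ y := by rintro rfl; omega
      have hvy' := hy.vID_eq hE (t' := t - 2) (by omega) le_rfl (by omega) (by omega) hSy
      have hSy' := hy.S_ne hE (t' := t - 2) (by omega) le_rfl (by omega) (by omega) hSy
      -- If `y` does not have virtual id 1, it differs from `f`, so its flyover id is not its own id
      -- and it announces `f`.
      have hp : propFlyID var y ((C (t - 2)).node y) := by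
        by_cases h7 : ((C a).node y).vID = 1
        · exact .inl ⟨hvy'.trans h7, fun _ => hSy'⟩
        · refine .inr ⟨by omega, ?_⟩
          rw [hfy]
          rintro rfl
          exact h7 h1
      have hmem : z ∈ memory y ((C (t - 2)).node y) ((C (t - 2)).ch y) := by
        have := mem_S_of_getElem? (hly (t - 2) (by omega) (by omega)).2
        simp only [memory, Node.addr, Finset.mem_erase, Finset.mem_union]
        exact ⟨hzy, .inl (.inl (.inl (.inl this)))⟩
      have hmsg := hE.testFlyID_mem (by omega) (hy.passes (by omega) (by omega)) hp hmem
        (hfy ▸ hzf)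
      rw [hfy] at hmsg
      have := hE.flyID_of_testFlyID (by omega) hmsg (hz _ (by omega) (by omega))
        (hz.S_ne hE (by omega) le_rfl (by omega) (by omega) hS) hzf.symm
      rwa [show t - 2 + 1 + 1 = t by omega] at this

/-- A node that lives long enough belongs to the flyover of a root, whose id is its flyover id. -/
theorem IsExecution.exists_root (hE : IsExecution var sup C)
    (hj : var.joinLimit = 0 ∨ var.joinLimit = 1) (ha : 5 ≤ a) (hz : AliveOn C a b z)
    (hS : ((C a).node z).S ≠ ∅) (hb : a + 2 * (Nat.log 2 (Fintype.card V) + 1) + 4 ≤ b) :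
    ∃ ρ, ((C a).node ρ).vID = 1 ∧ ((C a).node ρ).sc .left = [] ∧
      (∀ B, ClosedUnder (C a) .right B → ρ ∈ B → z ∈ B) ∧
      (∀ B, ClosedUnder (C a) .left B → z ∈ B → ρ ∈ B) ∧
      ∀ t, a + 4 * (Nat.log 2 (Fintype.card V) + 1) ≤ t →
        t + 2 * (Nat.log 2 (Fintype.card V) + 1) ≤ b → ((C t).node z).flyID = ρ := by
  set n := Fintype.card V
  set L := Nat.log 2 n + 1
  have hn : n < 2 ^ L := Nat.lt_pow_succ_log_self (by norm_num) n
  obtain ⟨hv1, -⟩ := (hz.passes le_rfl (by omega)).one_le_vID hS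
  -- Otherwise the distances `0, …, n` would yield `n + 1` nodes with distinct virtual ids.
  have hvn : ((C a).node z).vID ≤ n := by
    by_contra hvn
    have key : ∀ k : Fin (n + 1), ∃ y, ((C a).node y).vID = ((C a).node z).vID - (k : ℕ) := by
      intro k
      have hk := k.2
      obtain ⟨y, -, -, hy, -⟩ := hE.exists_left hj ha L z b k hz hS (by omega) (by omega) hb
      exact ⟨y, hy⟩
    choose y hy using key
    have hinj : Function.Injective y := by
      intro k l hkl
      have h1 := hy k
      have h2 := hy l
      rw [hkl] at h1
      exact Fin.ext (by omega)
    have := Fintype.card_le_of_injective y hinj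
    simp only [Fintype.card_fin] at this
    omega
  obtain ⟨k, hk⟩ : ∃ k : ℕ, (k : ℤ) = ((C a).node z).vID - 1 :=
    ⟨(((C a).node z).vID - 1).toNat, by omega⟩
  obtain ⟨ρ, hρ, hSρ, hvρ, hR, hL, hf⟩ :=
    hE.exists_left hj ha L z b k hz hS (by omega) (by omega) hb
  have hvρ : ((C a).node ρ).vID = 1 := by omega
  have hlρ : ((C a).node ρ).sc .left = [] := by
    by_contra h
    have := ((hρ.passes le_rfl (by omega)).one_le_vID hSρ).2.1.2 h
    omega
  refine ⟨ρ, hvρ, hlρ, hR, hL, fun t h1 h2 => ?_⟩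
  -- Allow `2L` rounds for building the shortcuts and another `2L` for the flyover id to travel. A
  -- node without left shortcuts that passes its checks carries its own id.
  refine hf ρ (a + 2 * L) t hvρ le_rfl h2 (fun t' h3 h4 => ?_) t (by omega) le_rfl
  have hS' := hρ.S_ne hE (t' := t') (by omega) le_rfl (by omega) (by omega) hSρ
  exact ((hρ.passes (t := t') (by omega) (by omega)).one_le_vID hS').2.2
    (hρ.sc_nil hE (by omega) le_rfl (by omega) (by omega) hSρ hlρ)

end Root

/-! ### No id is lost in a round -/

section Conservation

variable {var : Variant} {u v : V} {sup : Supervision V} {s : Node V} {ch : List (Msg V)}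

theorem mem_addr_flush {ids : Finset V} (hv : v ≠ u) (h : v ∈ ids) :
    v ∈ (flush u ids s).addr := by
  simp only [Node.addr, flush, Finset.mem_union, Finset.mem_erase]
  exact .inr (.inr ⟨hv, h⟩)

theorem mem_addr_of_reject {ids : Finset V} (hv : v ≠ u) (h : v ∈ ids) {o : Out V}
    (hs : s.exit = false → v ∈ s.addr) :
    v ∈ (if s.S = ∅ ∨ s.exit then sendRejFly u ids (s, o) else (s, o)).1.addr := by
  split_ifs with hc
  · exact mem_addr_flush hv h
  · push Not at hc
    exact hs (by simpa using hc.2)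

theorem mem_addr_of_mem_S (h : v ∈ s.S) : v ∈ s.addr := by
  simp [Node.addr, h]

theorem mem_addr_onTestLine {a : Node V × Out V} {d : Side} (hv : v ≠ u) :
    v ∈ (onTestLine u a (.testLine d v)).1.addr := by
  simp only [onTestLine]
  refine mem_addr_of_reject hv (by simp) fun h => ?_
  split_ifs at h ⊢ with hc
  push Not at hc
  exact mem_addr_of_mem_S (Node.mem_S.2 ⟨_, List.mem_of_mem_head? hc⟩)

/-- Without an exit there are three cases: a list that is too short flushes both ids, one of length
`i + 1` already contains the sender and gets `w`, and a longer one contains both. -/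
theorem mem_addr_onFlyConst {a : Node V × Out V} {d : Side} {w sen : V} {i : ℕ} (hv : v ≠ u)
    (h : v = w ∨ v = sen) : v ∈ (onFlyConst u a (.flyConst d w i sen)).1.addr := by
  have hmem : v ∈ ({sen, w} : Finset V) := by
    simp only [Finset.mem_insert, Finset.mem_singleton]
    tauto
  simp only [onFlyConst]
  refine mem_addr_of_reject hv hmem fun he => ?_
  by_cases hp : (a.1.sc d.opp = [] ∨ (i < (a.1.sc d.opp).length ∧ (a.1.sc d.opp)[i]? ≠ some sen)
      ∨ (i + 1 < (a.1.sc d.opp).length ∧ (a.1.sc d.opp)[i + 1]? ≠ some w))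
  · simp only [if_pos hp] at he
    simp at he
  · simp only [if_neg hp] at he ⊢
    push Not at hp
    have hex : a.1.exit = false := by
      split_ifs at he <;> exact he
    rcases lt_or_ge (a.1.sc d.opp).length (i + 1) with hl | hl
    · have hl' : ¬ (a.1.sc d.opp).length = i + 1 := by omega
      simp only [hex, hl, hl', and_self, if_true, false_and, and_false, if_false]
      exact mem_addr_flush hv hmem
    · have hsen := hp.2.1 (by omega)
      have hl' : ¬ (a.1.sc d.opp).length < i + 1 := by omega
      by_cases hl2 : (a.1.sc d.opp).length = i + 1
      · simp only [hex, hl2, hsen, lt_self_iff_false, and_false, if_false, and_self, if_true]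
        refine mem_addr_of_mem_S (Node.mem_S.2 ⟨d.opp, ?_⟩)
        simp only [Function.update_self, List.mem_append, List.mem_singleton]
        rcases h with rfl | rfl
        · exact .inr rfl
        · exact .inl (List.mem_of_getElem? hsen)
      · have hw := hp.2.2 (by omega)
        simp only [hex, hl2, hl', and_false, false_and, if_false]
        refine mem_addr_of_mem_S (Node.mem_S.2 ⟨d.opp, ?_⟩)
        rcases h with rfl | rfl
        · exact List.mem_of_getElem? hw
        · exact List.mem_of_getElem? hsen

theorem closest_mem {l : List V} {d : ℤ} {x : V} (h : closest l d = some x) : x ∈ l := by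
  unfold closest at h
  rw [Option.bind_eq_some_iff] at h
  obtain ⟨i, -, hi⟩ := h
  exact List.mem_of_getElem? hi

theorem nextStop_mem {val : ℤ} {x : V} (h : nextStop s val = some x) : x ∈ s.S := by
  unfold nextStop at h
  split_ifs at h
  · exact Node.mem_S.2 ⟨_, closest_mem h⟩
  · exact Node.mem_S.2 ⟨_, closest_mem h⟩

/-- Forwarding a certificate is the one response by which an id may leave the node. The next stop
then exists, since its absence would have set `exit`. -/
theorem mem_addr_onTestCert {a : Node V × Out V} {val dist : ℤ} (hv : v ≠ u) :
    v ∈ (onTestCert var u a (.testCert v val dist)).1.addr ∨ (propFlyID var u a.1 ∧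
      ∃ x ∈ a.1.S, (x, Msg.testCert v val dist) ∈ (onTestCert var u a (.testCert v val dist)).2) := by
  simp only [onTestCert]
  by_cases hc : (a.1.vID = val ∧ dist - 1 ≠ a.1.cDist) ∨ (a.1.vID ≠ val ∧ nextStop a.1 val = none)
  · simp only [if_pos hc]
    left
    rw [if_pos (.inr trivial)]
    exact mem_addr_flush hv (by simp)
  · simp only [if_neg hc]
    split_ifs with h1 h2 h3
    · exact .inl (mem_addr_flush hv (by simp))
    · left
      simp [Node.addr]
    · right
      refine ⟨h3, ?_⟩
      push Not at hc
      obtain ⟨x, hx⟩ := Option.ne_none_iff_exists'.1 (hc.2 h2)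
      refine ⟨x, nextStop_mem hx, Multiset.mem_add.2 (.inr ?_)⟩
      rw [mem_sendList, hx]
      simp
    · exact .inl (mem_addr_flush hv (by simp))

theorem mem_addr_onTestFlyID {a : Node V × Out V} (hv : v ≠ u) :
    v ∈ (onTestFlyID u a (.testFlyID (some v))).1.addr := by
  simp only [onTestFlyID]
  generalize (if a.1.sc .left ≠ [] ∧ a.1.exit = false ∧ a.1.flyID = u then
        { a.1 with flyID := (some v).getD u } else a.1) = s'
  by_cases hc : (s'.S ≠ ∅ ∧ some s'.flyID ≠ some v) ∨ (s'.S = ∅ ∧ some v ≠ none)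
  · simp only [if_pos hc, if_true]
    exact mem_addr_flush hv (by simp)
  · simp only [if_neg hc]
    split_ifs
    · exact mem_addr_flush hv (by simp)
    · push Not at hc
      have h1 : s'.S ≠ ∅ := fun h => absurd (hc.2 h) (by simp)
      have h2 := Option.some.inj (hc.1 (Finset.nonempty_iff_ne_empty.2 h1))
      simp [Node.addr, h2]

/-- Joining a path overwrites the shortcut lists only when they are empty. -/
theorem mem_localRound_addr (hv : v ∈ (responded var u s ch).1.addr) :
    v ∈ (localRound var u sup s ch).1.addr := by
  obtain ⟨-, h1, h2, h3, -⟩ := localRound_fields (var := var) (u := u) (sup := sup) (s := s)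
    (ch := ch)
  simp only [Node.addr, Finset.mem_union, Finset.mem_singleton] at hv ⊢
  rw [h1, h2]
  rcases hv with ((hv | hv) | hv) | hv
  · rcases localRound_sc (var := var) (u := u) (sup := sup) (s := s) (ch := ch) with h | h
    · rw [Node.S_congr h]
      exact .inl (.inl (.inl hv))
    · rw [h.1] at hv
      exact absurd hv (Finset.notMem_empty v)
  · exact .inl (.inl (.inr hv))
  · exact .inl (.inr hv)
  · exact .inr (h3 hv)

theorem mem_base_of_advised (h : v ∈ (advised var u sup s ch).1.base) :
    v ∈ (localRound var u sup s ch).1.base :=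
  (joinPath_fields _).2.2.2.2.2.2 (transformed_fields.2.2.2.2.2.2.2.1 h)

theorem mem_base_of_intro (hv : v ≠ u) (h : Msg.intro v ∈ ch) :
    v ∈ (localRound var u sup s ch).1.base := by
  apply mem_base_of_advised
  unfold advised
  generalize snapshotReq u sup ch
    (basicChecks2 var (responded var u s ch).1, (responded var u s ch).2) = a
  unfold getAdvice
  simp only [flush, Finset.mem_union, Finset.mem_erase, List.mem_toFinset, List.mem_flatMap]
  exact .inr ⟨hv, _, h, by simp⟩

theorem mem_base_of_testAdvice (hv : v ≠ u) {d : ℤ} (h : Msg.testAdvice d v ∈ ch) :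
    v ∈ (localRound var u sup s ch).1.base := by
  apply (joinPath_fields _).2.2.2.2.2.2
  unfold localTransform
  refine Finset.mem_union_left _ ?_
  unfold certifyTree
  simp only [flush, Finset.mem_union, Finset.mem_erase, List.mem_toFinset, List.mem_map,
    List.mem_flatMap]
  exact .inr ⟨hv, _, ⟨_, h, List.mem_singleton.2 rfl⟩, rfl⟩

/-- The ids collected by LocalTransform. -/
def LT.ids (x : LT V) : Finset V :=
  x.parent.toFinset ∪ x.rsib.toFinset ∪ x.lsib.toFinset ∪ x.children

theorem LT.ids_step (x : LT V) (m : Msg V) : x.ids ⊆ (x.step m).ids ∧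
    ∀ k v, m = .verified k v → v ∈ (x.step m).ids := by
  cases m with
  | verified k w =>
    have key : x.ids ⊆ (x.step (.verified k w)).ids ∧ w ∈ (x.step (.verified k w)).ids := by
      obtain ⟨ig, p, rs, ls, c⟩ := x
      cases ig
      · cases k
        · cases p <;> simp [LT.step, LT.ids, Finset.subset_iff] <;> tauto
        · cases rs <;> simp [LT.step, LT.ids, Finset.subset_iff] <;> tauto
        · cases ls <;> simp [LT.step, LT.ids, Finset.subset_iff] <;> tauto
        · simp [LT.step, LT.ids, Finset.subset_iff]; tauto
      · simp [LT.step, LT.ids, Finset.subset_iff]; tauto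
    refine ⟨key.1, fun k' v' h => ?_⟩
    cases h
    exact key.2
  | _ => exact ⟨subset_rfl, fun k v h => absurd h (by simp)⟩

theorem mem_foldl_lt {k : Kin} (h : Msg.verified k v ∈ ch) (x : LT V) :
    v ∈ (ch.foldl LT.step x).ids := by
  have mono : ∀ (l : List (Msg V)) (x : LT V), x.ids ⊆ (l.foldl LT.step x).ids := by
    intro l
    induction l with
    | nil => exact fun x => subset_rfl
    | cons m l ih => exact fun x => (x.ids_step m).1.trans (ih _)
  obtain ⟨l₁, l₂, rfl⟩ := List.append_of_mem h
  rw [List.foldl_append, List.foldl_cons]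
  exact mono _ _ ((LT.ids_step _ _).2 _ _ rfl)

theorem mem_base_of_verified (hv : v ≠ u) {k : Kin} (h : Msg.verified k v ∈ ch) :
    v ∈ (localRound var u sup s ch).1.base := by
  apply (joinPath_fields _).2.2.2.2.2.2
  unfold localTransform
  exact Finset.mem_union_right _ (Finset.mem_erase.2 ⟨hv, mem_foldl_lt h _⟩)

/-- The ids collected by JoinPath. -/
def JP.ids (x : JP V) : Finset V := (x.fly .left).toFinset ∪ (x.fly .right).toFinset ∪ x.rest

theorem JP.ids_step (s : Node V) (x : JP V) (m : Msg V) : x.ids ⊆ (x.step s m).ids ∧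
    ∀ d v, m = .path d v → v ∈ (x.step s m).ids := by
  cases m with
  | path d w =>
    have key : x.ids ⊆ (x.step s (.path d w)).ids ∧ w ∈ (x.step s (.path d w)).ids := by
      unfold JP.step
      dsimp only
      split_ifs with h
      · simp [JP.ids, Finset.subset_iff]; tauto
      · push Not at h
        have h2 : x.fly d = none := by simpa using h.2.1
        cases d <;> simp [JP.ids, Finset.subset_iff, h2] <;> tauto
    refine ⟨key.1, fun k' v' h => ?_⟩
    cases h
    exact key.2
  | _ => exact ⟨subset_rfl, fun k v h => absurd h (by simp)⟩

theorem mem_foldl_jp {d : Side} (h : Msg.path d v ∈ ch) (x : JP V) :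
    v ∈ (ch.foldl (JP.step s) x).ids := by
  have mono : ∀ (l : List (Msg V)) (x : JP V), x.ids ⊆ (l.foldl (JP.step s) x).ids := by
    intro l
    induction l with
    | nil => exact fun x => subset_rfl
    | cons m l ih => exact fun x => (x.ids_step s m).1.trans (ih _)
  obtain ⟨l₁, l₂, rfl⟩ := List.append_of_mem h
  rw [List.foldl_append, List.foldl_cons]
  exact mono _ _ ((JP.ids_step _ _ _).2 _ _ rfl)

theorem mem_base_of_path (hv : v ≠ u) {d : Side} (h : Msg.path d v ∈ ch) :
    v ∈ (localRound var u sup s ch).1.base := by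
  rw [localRound_eq]
  exact Finset.mem_union_right _ (Finset.mem_erase.2 ⟨hv, mem_foldl_jp h _⟩)

/-- Where an id of another node in the memory of `u` is after the part of a round that precedes the
base algorithm. -/
theorem conservation (hv : v ≠ u) (h : v ∈ s.addr ∪ chIds ch) :
    v ∈ (localRound var u sup s ch).1.S ∪ {(localRound var u sup s ch).1.flyID}
        ∪ (localRound var u sup s ch).1.cIds
    ∨ v ∈ basePool u (localRound var u sup s ch).1 ch
    ∨ (∃ x ws, Msg.rev x ws ∈ ch ∧ v ∈ x :: ws)
    ∨ (propFlyID var u (checked u s ch) ∧ ∃ val d, ∃ x ∈ (localRound var u sup s ch).1.S,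
        (x, Msg.testCert v val d) ∈ (localRound var u sup s ch).2) := by
  have fin : v ∈ (localRound var u sup s ch).1.addr →
      v ∈ (localRound var u sup s ch).1.S ∪ {(localRound var u sup s ch).1.flyID}
        ∪ (localRound var u sup s ch).1.cIds
      ∨ v ∈ basePool u (localRound var u sup s ch).1 ch := by
    intro h
    simp only [Node.addr, basePool, Finset.mem_union, Finset.mem_erase] at h ⊢
    tauto
  have fin' : ∀ b, v ∈ b.1.addr → Ext u b (responded var u s ch) →
      v ∈ (localRound var u sup s ch).1.S ∪ {(localRound var u sup s ch).1.flyID}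
        ∪ (localRound var u sup s ch).1.cIds
      ∨ v ∈ basePool u (localRound var u sup s ch).1 ch :=
    fun b hb hx => fin (mem_localRound_addr (hx.addr hv hb))
  have finb : v ∈ (localRound var u sup s ch).1.base →
      v ∈ (localRound var u sup s ch).1.S ∪ {(localRound var u sup s ch).1.flyID}
        ∪ (localRound var u sup s ch).1.cIds
      ∨ v ∈ basePool u (localRound var u sup s ch).1 ch := by
    intro h
    right
    simp only [basePool, Finset.mem_union, Finset.mem_erase]
    exact ⟨hv, .inl (.inl h)⟩
  have lift : (v ∈ (localRound var u sup s ch).1.S ∪ {(localRound var u sup s ch).1.flyID}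
        ∪ (localRound var u sup s ch).1.cIds
      ∨ v ∈ basePool u (localRound var u sup s ch).1 ch) →
      v ∈ (localRound var u sup s ch).1.S ∪ {(localRound var u sup s ch).1.flyID}
        ∪ (localRound var u sup s ch).1.cIds
      ∨ v ∈ basePool u (localRound var u sup s ch).1 ch
      ∨ (∃ x ws, Msg.rev x ws ∈ ch ∧ v ∈ x :: ws)
      ∨ (propFlyID var u (checked u s ch) ∧ ∃ val d, ∃ x ∈ (localRound var u sup s ch).1.S,
        (x, Msg.testCert v val d) ∈ (localRound var u sup s ch).2) := by
    tauto
  rcases Finset.mem_union.1 h with h | h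
  · exact lift (fin' (tested var u s ch) (checked_addr hv h) ext_responded)
  · simp only [chIds, List.mem_toFinset, List.mem_flatMap] at h
    obtain ⟨m, hm, hvm⟩ := h
    cases m with
    | rejFlyover => simp [Msg.ids] at hvm
    | testvID x => simp [Msg.ids] at hvm
    | testLine d sen =>
      obtain rfl : v = sen := by simpa [Msg.ids] using hvm
      obtain ⟨b, -, hb⟩ := respond_testLine var u (tested var u s ch) hm
      exact lift (fin' _ (mem_addr_onTestLine hv) hb)
    | flyConst d w i sen =>
      obtain ⟨b, -, hb⟩ := respond_flyConst var u (tested var u s ch) hm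
      exact lift (fin' _ (mem_addr_onFlyConst hv (by simpa [Msg.ids] using hvm)) hb)
    | testCert w val d =>
      obtain rfl : v = w := by simpa [Msg.ids] using hvm
      obtain ⟨b, hb1, hbf, hb⟩ := respond_testCert var u (tested var u s ch) hm
      rcases mem_addr_onTestCert (var := var) (a := b) (val := val) (dist := d) hv with
        h | ⟨hp, x, hx, hx'⟩
      · exact lift (fin' _ h hb)
      · refine .inr (.inr (.inr ⟨?_, val, d, x, ?_, localRound_fields.2.2.2.2 _ (hb.out _ hx')⟩))
        · have e1 : b.1.vID = (checked u s ch).vID := hb1.vID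
          have e2 : b.1.flyID = (checked u s ch).flyID := hbf
          have e3 : b.1.S = ∅ ↔ (checked u s ch).S = ∅ := hb1.S_eq_empty
          unfold propFlyID at hp ⊢
          rw [e1, e2, Ne, e3] at hp
          exact hp
        · have hx2 := ((ext_onTestCert var u b (.testCert v val d)).trans hb).S_subset hx
          rcases localRound_sc (var := var) (u := u) (sup := sup) (s := s) (ch := ch) with h | h
          · rw [Node.S_congr h]
            exact hx2
          · have h0 : x ∈ (responded var u s ch).1.S := hx2
            rw [h.1] at h0
            exact absurd h0 (Finset.notMem_empty x)
    | introCert w =>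
      obtain rfl : v = w := by simpa [Msg.ids] using hvm
      obtain ⟨b, -, hb⟩ := respond_introCert var u (tested var u s ch) hm
      exact lift (fin' _ (by simp [onIntroCert, Node.addr]) hb)
    | testFlyID f =>
      obtain rfl : f = some v := by simpa [Msg.ids] using hvm
      obtain ⟨b, -, hb⟩ := respond_testFlyID var u (tested var u s ch) hm
      exact lift (fin' _ (mem_addr_onTestFlyID hv) hb)
    | intro w =>
      obtain rfl : v = w := by simpa [Msg.ids] using hvm
      exact lift (finb (mem_base_of_intro hv hm))
    | testAdvice d w =>
      obtain rfl : v = w := by simpa [Msg.ids] using hvm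
      exact lift (finb (mem_base_of_testAdvice hv hm))
    | verified k w =>
      obtain rfl : v = w := by simpa [Msg.ids] using hvm
      exact lift (finb (mem_base_of_verified hv hm))
    | path d w =>
      obtain rfl : v = w := by simpa [Msg.ids] using hvm
      exact lift (finb (mem_base_of_path hv hm))
    | base ids =>
      refine lift (.inr ?_)
      simp only [basePool, Finset.mem_erase, Finset.mem_union, List.mem_toFinset,
        List.mem_flatMap]
      exact ⟨hv, .inr ⟨_, hm, hvm⟩⟩
    | rev x ws => exact .inr (.inr (.inl ⟨x, ws, hm, hvm⟩))

end Conservation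

/-! ### Ids under the universal primitives -/

/-- The base algorithm preserves connections. -/
theorem BaseRun.rel {u : V} {M M' : Finset V} {out : Out V} (h : BaseRun u M out M')
    {R : V → V → Prop} (hR : Equivalence R) (hM : ∀ x ∈ M', R u x)
    (ho : ∀ y ∈ out, ∀ w ∈ y.2.ids, R y.1 w) : ∀ x ∈ M, R u x := by
  induction h with
  | refl => exact hM
  | introduce v ids _ _ _ ih => exact ih hM fun y hy => ho y (Multiset.mem_cons_of_mem hy)
  | reverse v _ _ ih =>
    intro x hx
    by_cases hxv : x = v
    · subst hxv
      exact hR.symm (ho _ (Multiset.mem_cons_self _ _) _ (by simp [Msg.ids]))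
    · exact ih hM (fun y hy => ho y (Multiset.mem_cons_of_mem hy)) x
        (Finset.mem_erase.2 ⟨hxv, hx⟩)
  | delegate v w ws hv hw _ hkeep _ ih =>
    have ih := ih hM fun y hy => ho y (Multiset.mem_cons_of_mem (Multiset.mem_add.2 (.inr hy)))
    intro x hx
    by_cases hxw : x ∈ w :: ws
    · have h1 := ih v (hkeep v hv fun h => (hw v h).2 rfl)
      refine hR.trans h1 (hR.symm ?_)
      rcases List.mem_cons.1 hxw with rfl | hxw
      · exact ho _ (Multiset.mem_cons_self _ _) v (by simp [Msg.ids])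
      · exact ho (x, .rev v []) (Multiset.mem_cons_of_mem (Multiset.mem_add.2
          (.inl (mem_sendList.2 (List.mem_map.2 ⟨x, hxw, rfl⟩))))) v (by simp [Msg.ids])
    · exact ih x (hkeep x hx hxw)

/-- The base algorithm does not give up all ids of a set without telling some node of the set an id
from outside. -/
theorem BaseRun.exists_mem {u : V} {M M' : Finset V} {out : Out V} (h : BaseRun u M out M')
    {B : Finset V} (hu : u ∉ B) (ho : ∀ y ∈ out, y.1 ∈ B → ∀ w ∈ y.2.ids, w ∈ B)
    (hM : ∃ x ∈ M, x ∈ B) : ∃ x ∈ M', x ∈ B := by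
  induction h with
  | refl => exact hM
  | introduce v ids _ _ _ ih => exact ih (fun y hy => ho y (Multiset.mem_cons_of_mem hy)) hM
  | reverse v _ _ ih =>
    refine ih (fun y hy => ho y (Multiset.mem_cons_of_mem hy)) ?_
    obtain ⟨x, hx, hxB⟩ := hM
    -- Reversing an edge into `B` would send the outside id `u` to a node of `B`.
    refine ⟨x, Finset.mem_erase.2 ⟨?_, hx⟩, hxB⟩
    rintro rfl
    exact hu (ho _ (Multiset.mem_cons_self _ _) hxB _ (by simp [Msg.ids]))
  | delegate v w ws hv hw _ hkeep _ ih =>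
    refine ih (fun y hy => ho y (Multiset.mem_cons_of_mem (Multiset.mem_add.2 (.inr hy)))) ?_
    obtain ⟨x, hx, hxB⟩ := hM
    by_cases hxw : x ∈ w :: ws
    -- A delegated node of `B` learns the target `v`, so `v` lies in `B` and serves as the new
    -- witness.
    · refine ⟨v, hkeep v hv fun h => (hw v h).2 rfl, ?_⟩
      rcases List.mem_cons.1 hxw with rfl | hxw
      · exact ho _ (Multiset.mem_cons_self _ _) hxB v (by simp [Msg.ids])
      · exact ho (x, .rev v []) (Multiset.mem_cons_of_mem (Multiset.mem_add.2
          (.inl (mem_sendList.2 (List.mem_map.2 ⟨x, hxw, rfl⟩))))) hxB v (by simp [Msg.ids])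
    · exact ⟨x, hkeep x hx hxw, hxB⟩

/-! ### Connectivity and edges into a set -/

section Graph

variable [Fintype V] {var : Variant} {sup : ℕ → V → Supervision V} {C : ℕ → Config V}
  {r : ℕ} {u : V}

/-- The ids known to `u` at the beginning of round `r`. -/
def known (C : ℕ → Config V) (r : ℕ) (u : V) : Finset V :=
  ((C r).node u).addr ∪ chIds ((C r).ch u)

theorem mem_known_of_msg {v : V} {m : Msg V} (hm : m ∈ (C r).ch u) (hv : v ∈ m.ids) :
    v ∈ known C r u := by
  refine Finset.mem_union_right _ ?_
  simp only [chIds, List.mem_toFinset, List.mem_flatMap]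
  exact ⟨m, hm, hv⟩

theorem IsExecution.mem_known_succ (hE : IsExecution var sup C) (hr : 1 ≤ r) {v : V}
    (h : v ∈ (roundOf var sup C r u).1.S ∪ {(roundOf var sup C r u).1.flyID}
        ∪ (roundOf var sup C r u).1.cIds) : v ∈ known C (r + 1) u := by
  obtain ⟨h1, -, h2, -, h3, -⟩ := hE.node_succ hr u
  refine Finset.mem_union_left _ ?_
  rw [Node.addr, Node.S_congr h1, h2, h3]
  exact Finset.mem_union_left _ h

theorem reachable_of_mem_known {v : V} (h : v ∈ known C r u) :
    (commGraph (C r)).Reachable u v := by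
  by_cases huv : u = v
  · exact huv ▸ SimpleGraph.Reachable.refl _
  · exact SimpleGraph.Adj.reachable ((SimpleGraph.fromRel_adj _ _ _).2 ⟨huv, .inl h⟩)

/-- Each fate listed in `conservation` leaves a path: the id is kept, or the base algorithm
preserves the connection, or the answer to a Rev message joins `u`, its target and the remaining
ids, or the certificate went to a shortcut that `u` still has. -/
theorem IsExecution.reachable_succ (hE : IsExecution var sup C) (hr : 1 ≤ r) {v : V}
    (h : v ∈ known C r u) : (commGraph (C (r + 1))).Reachable u v := by
  by_cases huv : v = u
  · exact huv ▸ SimpleGraph.Reachable.refl _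
  rcases conservation (var := var) (sup := sup r u) huv h with h | h | ⟨x, ws, hx, hv⟩ |
    ⟨-, val, d, x, hx, hm⟩
  · exact reachable_of_mem_known (hE.mem_known_succ hr h)
  · obtain ⟨out, base', hb, hn, ho⟩ := hE.base_step hr u
    refine hb.rel (commGraph (C (r + 1))).reachable_is_equivalence (fun x hx => ?_)
      (fun y hy w hw => reachable_of_mem_known (mem_known_of_msg (ho y hy) hw)) v h
    refine reachable_of_mem_known (Finset.mem_union_left _ ?_)
    rw [hn]
    exact Finset.mem_union_right _ hx
  · have hm := hE.mem_ch_of_rev hr hx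
    have h1 : (commGraph (C (r + 1))).Reachable x u :=
      reachable_of_mem_known (mem_known_of_msg hm (by simp [Msg.ids]))
    rcases List.mem_cons.1 hv with rfl | hv
    · exact h1.symm
    · exact h1.symm.trans (reachable_of_mem_known (mem_known_of_msg hm (by simp [Msg.ids, hv])))
  · have h1 : (commGraph (C (r + 1))).Reachable u x :=
      reachable_of_mem_known (hE.mem_known_succ hr
        (Finset.mem_union_left _ (Finset.mem_union_left _ hx)))
    exact h1.trans (reachable_of_mem_known
      (mem_known_of_msg (hE.mem_ch_of_round hr hm) (by simp [Msg.ids])))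

/-- The communication graph stays connected. -/
theorem IsExecution.connected_of_le (hE : IsExecution var sup C) (hr : 1 ≤ r) :
    (commGraph (C r)).Connected := by
  induction r, hr using Nat.le_induction with
  | base => exact hE.connected
  | succ r hr ih =>
    have := ih.nonempty
    refine SimpleGraph.Connected.mk fun x y => ?_
    have hxy := (SimpleGraph.reachable_iff_reflTransGen x y).1 (ih.preconnected x y)
    induction hxy with
    | refl => exact SimpleGraph.Reachable.refl _
    | tail _ h ih' =>
      refine ih'.trans ?_
      rcases ((SimpleGraph.fromRel_adj _ _ _).1 h).2 with h | h
      · exact hE.reachable_succ hr h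
      · exact (hE.reachable_succ hr h).symm

/-- There is always an edge between a proper nonempty set of nodes and its complement. -/
theorem IsExecution.exists_crossing (hE : IsExecution var sup C) (hr : 1 ≤ r) {B : Finset V}
    (h1 : B.Nonempty) (h2 : B.card < Fintype.card V) :
    ∃ b ∈ B, ∃ z ∉ B, z ∈ known C r b ∨ b ∈ known C r z := by
  obtain ⟨b, hb⟩ := h1
  obtain ⟨z, hz⟩ : ∃ z, z ∉ B := by
    by_contra! h
    rw [Finset.eq_univ_of_forall h, Finset.card_univ] at h2
    exact lt_irrefl _ h2
  by_contra! hno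
  apply hz
  have hbz := (SimpleGraph.reachable_iff_reflTransGen b z).1
    ((hE.connected_of_le hr).preconnected b z)
  clear hz
  induction hbz with
  | refl => exact hb
  | @tail x y _ h ih =>
    by_contra hy
    rcases ((SimpleGraph.fromRel_adj _ _ _).1 h).2 with h | h
    · exact (hno x ih y hy).1 h
    · exact (hno x ih y hy).2 h

/-- An edge from outside into a set `B` stays where it is, unless the set gets an edge to the
outside. -/
theorem IsExecution.exists_known_succ (hE : IsExecution var sup C) (hr : 2 ≤ r) {B : Finset V}
    (h0 : ∀ b ∈ B, known C r b ⊆ B) (h1 : ∀ b ∈ B, known C (r + 1) b ⊆ B) {z : V} (hz : z ∉ B)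
    (hp : Passes C r z) (hprop : ¬ propFlyID var z ((C r).node z))
    (hb : ∃ b ∈ B, b ∈ known C r z) : ∃ b ∈ B, b ∈ known C (r + 1) z := by
  obtain ⟨b, hbB, hb⟩ := hb
  have hbz : b ≠ z := by rintro rfl; exact hz hbB
  rcases conservation (var := var) (sup := sup r z) hbz hb with h | h | ⟨x, ws, hx, hv⟩ | ⟨h, -⟩
  · exact ⟨b, hbB, hE.mem_known_succ (by omega) h⟩
  · obtain ⟨out, base', hrun, hn, ho⟩ := hE.base_step (r := r) (by omega) z
    obtain ⟨x, hx, hxB⟩ := hrun.exists_mem hz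
      (fun y hy hyB w hw => h1 y.1 hyB (mem_known_of_msg (ho y hy) hw)) ⟨b, h, hbB⟩
    refine ⟨x, hxB, Finset.mem_union_left _ ?_⟩
    rw [hn]
    exact Finset.mem_union_right _ hx
  · exfalso
    have hm := hE.mem_ch_of_rev (r := r) (by omega) hx
    -- The answer to the Rev message tells `x` the id `z`, which is outside `B`.
    have hxB : x ∉ B := fun hxB => hz (h1 x hxB (mem_known_of_msg hm (by simp [Msg.ids])))
    rcases List.mem_cons.1 hv with rfl | hv
    · exact hxB hbB
    · obtain ⟨j, rfl⟩ : ∃ j, r = j + 1 := ⟨r - 1, by omega⟩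
      rcases hE.mem_ch (r := j) (by omega) hx with ⟨q, hq⟩ | ⟨_, hq⟩ | ⟨x', ws', hq, hw⟩
      · rcases mem_localRound hq with h' | ⟨-, h'⟩ | ⟨-, _, _, h', -⟩ | ⟨-, -, _, _, h', -⟩
        · exact absurd h' (by simp [Msg.IsTest])
        · exact absurd h' (by simp)
        · exact absurd h' (by simp)
        · exact absurd h' (by simp)
      · exact absurd hq (by simp)
      · simp only [Msg.rev.injEq] at hq
        obtain ⟨rfl, rfl⟩ := hq
        -- The delegation that asked `z` to pass on `b` has also sent the outside id `x` to `b`, and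
        -- `b` has it in its channel in round `r`.
        exact hxB (h0 b hbB (mem_known_of_msg (hw b hv) (by simp [Msg.ids])))
  · rw [hp.checked] at h
    exact absurd h hprop

end Graph

/-! ### Maximal backbones are complete lines -/

/-- The facts about a backbone that do not refer to its enumeration. -/
structure Ends (C : Config V) (B : Finset V) (v w : V) : Prop where
  left_mem : v ∈ B
  right_mem : w ∈ B
  left_end : ∀ x, ((C.node v).sc .left).head? = some x → x ∉ B
  right_end : ∀ x, ((C.node w).sc .right).head? = some x → x ∉ B
  exists_left : ∀ b ∈ B, b ≠ v → ∃ x ∈ B, ((C.node b).sc .left).head? = some x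
  exists_right : ∀ b ∈ B, b ≠ w → ∃ x ∈ B, ((C.node b).sc .right).head? = some x
  S_ne : ∀ b ∈ B, (C.node b).S ≠ ∅

theorem S_ne_of_head? {s : Node V} {d : Side} {x : V} (h : (s.sc d).head? = some x) : s.S ≠ ∅ :=
  Finset.ne_empty_of_mem (Node.mem_S.2 ⟨d, List.mem_of_mem_head? h⟩)

theorem exists_ends {C : Config V} {B : Finset V} {l : List V} (hc : 2 ≤ B.card)
    (hl : l.toFinset = B)
    (h1 : ∀ a ∈ l.head?, ∀ x ∈ ((C.node a).sc .left).head?, x ∉ B)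
    (h2 : ∀ a ∈ l.getLast?, ∀ x ∈ ((C.node a).sc .right).head?, x ∉ B)
    (h3 : l.IsChain fun a b =>
      ((C.node a).sc .right).head? = some b ∧ ((C.node b).sc .left).head? = some a) :
    ∃ v w, l.head? = some v ∧ l.getLast? = some w ∧ Ends C B v w := by
  have hlen : 2 ≤ l.length := by
    rw [← hl] at hc
    exact hc.trans (List.toFinset_card_le l)
  have hch := List.isChain_iff_getElem.1 h3
  have hmem : ∀ i (hi : i < l.length), l[i] ∈ B := fun i hi => by
    rw [← hl, List.mem_toFinset]
    exact List.getElem_mem hi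
  have hv : l.head? = some l[0] := by rw [List.head?_eq_getElem?, List.getElem?_eq_getElem]
  have hw : l.getLast? = some l[l.length - 1] := by
    rw [List.getLast?_eq_getElem?, List.getElem?_eq_getElem]
  have hel : ∀ b ∈ B, b ≠ l[0] → ∃ x ∈ B, ((C.node b).sc .left).head? = some x := by
    intro b hb hne
    rw [← hl, List.mem_toFinset] at hb
    obtain ⟨i, hi, rfl⟩ := List.getElem_of_mem hb
    cases i with
    | zero => exact absurd rfl hne
    | succ i => exact ⟨l[i], hmem _ _, (hch i hi).2⟩
  have her : ∀ b ∈ B, b ≠ l[l.length - 1] → ∃ x ∈ B, ((C.node b).sc .right).head? = some x := by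
    intro b hb hne
    rw [← hl, List.mem_toFinset] at hb
    obtain ⟨i, hi, rfl⟩ := List.getElem_of_mem hb
    have hi' : i + 1 < l.length := by
      by_contra hi'
      obtain rfl : i = l.length - 1 := by omega
      exact hne rfl
    exact ⟨l[i + 1], hmem _ _, (hch i hi').1⟩
  refine ⟨l[0], l[l.length - 1], hv, hw, hmem _ _, hmem _ _, h1 _ hv, h2 _ hw, hel, her, ?_⟩
  intro b hb
  by_cases hb0 : b = l[0]
  · rw [hb0]
    exact S_ne_of_head? (hch 0 (by omega)).1
  · obtain ⟨x, -, hx⟩ := hel b hb hb0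
    exact S_ne_of_head? hx

section Main

variable [Fintype V] {var : Variant} {sup : ℕ → V → Supervision V} {C : ℕ → Config V}
  {r b : ℕ} {B : Finset V}

/-- A maximal backbone that lives long enough is a whole line. -/
theorem IsExecution.exists_line (hE : IsExecution var sup C)
    (hj : var.joinLimit = 0 ∨ var.joinLimit = 1) (hr : 5 ≤ r) (hB : IsMaximalBackbone (C r) B)
    (hb : r + 2 * (Nat.log 2 (Fintype.card V) + 1) + 4 ≤ b) (ha : ∀ x ∈ B, AliveOn C r b x) :
    ∃ v w, Ends (C r) B v w ∧ ((C r).node v).sc .left = [] ∧ ((C r).node w).sc .right = [] := by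
  obtain ⟨⟨hcard, l, hnd, hl, h1, h2, h3⟩, hmax⟩ := hB
  obtain ⟨v, w, hv, hw, hends⟩ := exists_ends hcard hl h1 h2 h3
  have ha3 : ∀ x ∈ B, AliveOn C r (r + 2) x := fun x hx => (ha x hx).mono le_rfl (by omega)
  have hal : ∀ x ∈ B, ∀ y d, (((C r).node x).sc d).head? = some y →
      (((C r).node y).sc d.opp).head? = some x ∧ AliveOn C r (r + 2) y := by
    intro x hx y d hy
    have h4 := hE.head_symm hj hr (ha3 x hx) hy
    refine ⟨h4, ((ha x hx).of_mem_S hE (by omega)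
      (Node.mem_S.2 ⟨_, List.mem_of_mem_head? h4⟩)).mono le_rfl (by omega)⟩
  have hbig : ∀ y ∉ B, 2 ≤ (insert y B).card := fun y hy => by
    rw [Finset.card_insert_of_notMem hy]; omega
  have hmeml : ∀ y, y ∈ l ↔ y ∈ B := fun y => by rw [← hl, List.mem_toFinset]
  have hleft : ((C r).node v).sc .left = [] := by
    by_contra hne
    obtain ⟨y, hy⟩ : ∃ y, (((C r).node v).sc .left).head? = some y := by
      cases h : ((C r).node v).sc .left with
      | nil => exact absurd h hne
      | cons y l => exact ⟨y, rfl⟩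
    have hyB := hends.left_end y hy
    obtain ⟨hyv, hya⟩ := hal v hends.left_mem y .left hy
    have hyv : (((C r).node y).sc .right).head? = some v := hyv
    -- If `w` is not the left neighbor of `y`, then prepending `y` yields a larger backbone:
    -- symmetry rules out every other contact of the ends with the enlarged set.
    have key : (((C r).node y).sc .left).head? = some w := by
      by_contra hyw
      refine hmax y hyB ⟨hbig y hyB, y :: l, List.nodup_cons.2 ⟨fun h => hyB ((hmeml y).1 h), hnd⟩,
        by rw [List.toFinset_cons, hl], ?_, ?_, ?_⟩
      · intro a haa x hx hxB
        obtain rfl : y = a := by simpa using haa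
        have hxy : (((C r).node x).sc .right).head? = some y := hE.head_symm hj hr hya hx
        rcases Finset.mem_insert.1 hxB with rfl | hxB
        · rw [hyv] at hxy
          exact hyB (Option.some.inj hxy ▸ hends.left_mem)
        · by_cases hxw : x = w
          · exact hyw (hxw ▸ hx)
          · obtain ⟨x', hx'B, hx'⟩ := hends.exists_right x hxB hxw
            rw [hxy] at hx'
            exact hyB (Option.some.inj hx' ▸ hx'B)
      · intro a haa x hx hxB
        obtain rfl : w = a := by
          rw [List.getLast?_cons, hw] at haa
          simpa using haa
        rcases Finset.mem_insert.1 hxB with rfl | hxB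
        · exact hyw (hal w hends.right_mem x .right hx).1
        · exact hends.right_end x hx hxB
      · rw [List.isChain_cons]
        refine ⟨fun x hx => ?_, h3⟩
        rw [hv] at hx
        obtain rfl : v = x := by simpa using hx
        exact ⟨hyv, hy⟩
    -- Now `y` closes the line to a cycle in which every node has a left neighbor, whereas the root
    -- of `v` is reached by going left and has none.
    obtain ⟨ρ, -, hρ, -, hρB, -⟩ := hE.exists_root hj hr (ha v hends.left_mem)
      (hends.S_ne v hends.left_mem) hb
    have hall : ∀ x ∈ insert y B, ∃ x' ∈ insert y B,
        (((C r).node x).sc .left).head? = some x' := by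
      intro x hx
      rcases Finset.mem_insert.1 hx with rfl | hx
      · exact ⟨w, Finset.mem_insert_of_mem hends.right_mem, key⟩
      · by_cases hxv : x = v
        · exact ⟨y, Finset.mem_insert_self _ _, hxv ▸ hy⟩
        · obtain ⟨x', hx', h'⟩ := hends.exists_left x hx hxv
          exact ⟨x', Finset.mem_insert_of_mem hx', h'⟩
    have hρ' := hρB (insert y B) (by
      intro x hx x' hx'
      obtain ⟨x'', h5, h6⟩ := hall x hx
      rw [hx'] at h6
      exact Option.some.inj h6 ▸ h5) (Finset.mem_insert_of_mem hends.left_mem)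
    obtain ⟨x', -, hx'⟩ := hall ρ hρ'
    simp [hρ] at hx'
  refine ⟨v, w, hends, hleft, ?_⟩
  by_contra hne
  obtain ⟨y, hy⟩ : ∃ y, (((C r).node w).sc .right).head? = some y := by
    cases h : ((C r).node w).sc .right with
    | nil => exact absurd h hne
    | cons y l => exact ⟨y, rfl⟩
  have hyB := hends.right_end y hy
  obtain ⟨hyw, hya⟩ := hal w hends.right_mem y .right hy
  have hyw : (((C r).node y).sc .left).head? = some w := hyw
  -- On the right side no cycle can arise, because `v` is already known to have no left neighbor.
  refine hmax y hyB ⟨hbig y hyB, l ++ [y], ?_, ?_, ?_, ?_, ?_⟩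
  · rw [List.nodup_append]
    refine ⟨hnd, List.nodup_singleton y, fun x hx x' hx' => ?_⟩
    rw [List.mem_singleton.1 hx']
    rintro rfl
    exact hyB ((hmeml x).1 hx)
  · rw [List.toFinset_append, hl]
    ext x
    simp
  · intro a haa x hx hxB
    rw [List.head?_append, hv] at haa
    obtain rfl : v = a := by simpa using haa
    simp [hleft] at hx
  · intro a haa x hx hxB
    obtain rfl : y = a := by simpa using haa
    have hxy : (((C r).node x).sc .left).head? = some y := hE.head_symm hj hr hya hx
    rcases Finset.mem_insert.1 hxB with rfl | hxB
    · rw [hyw] at hxy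
      exact hyB (Option.some.inj hxy ▸ hends.right_mem)
    · by_cases hxv : x = v
      · rw [hxv, hleft] at hxy
        simp at hxy
      · obtain ⟨x', hx'B, hx'⟩ := hends.exists_left x hxB hxv
        rw [hxy] at hx'
        exact hyB (Option.some.inj hx' ▸ hx'B)
  · rw [List.isChain_append]
    refine ⟨h3, List.isChain_singleton y, fun x hx x' hx' => ?_⟩
    rw [hw] at hx
    obtain rfl : w = x := by simpa using hx
    obtain rfl : y = x' := by simpa using hx'
    exact ⟨hy, hyw⟩

/-! ### Isolation of a settled flyover -/

/-- From round `lo` to round `hi`, `B` is a complete living flyover with root `ρ`. -/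
structure Settled (C : ℕ → Config V) (B : Finset V) (ρ : V) (lo hi : ℕ) : Prop where
  le : 5 ≤ lo
  mem : ρ ∈ B
  alive : ∀ b ∈ B, AliveOn C lo hi b
  S_ne : ∀ b ∈ B, ∀ t, lo ≤ t → t ≤ hi → ((C t).node b).S ≠ ∅
  closed : ∀ t, lo ≤ t → t ≤ hi → ClosedUnder (C t) .right B
  root : ∀ t, lo ≤ t → t ≤ hi → ((C t).node ρ).vID = 1
  flyID : ∀ b ∈ B, ∀ t, lo ≤ t → t ≤ hi → ((C t).node b).flyID = ρ

/-- Neighbors of living nodes never change, so the line persists. The root of any member lies in `B`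
and has no left neighbor, hence is the left end; all flyover ids therefore coincide. -/
theorem IsExecution.exists_settled (hE : IsExecution var sup C)
    (hj : var.joinLimit = 0 ∨ var.joinLimit = 1) (hr : 5 ≤ r) (hB : IsMaximalBackbone (C r) B)
    (hb : r + 2 * (Nat.log 2 (Fintype.card V) + 1) + 4 ≤ b) (ha : ∀ x ∈ B, AliveOn C r b x) :
    ∃ ρ, Settled C B ρ (r + 4 * (Nat.log 2 (Fintype.card V) + 1))
      (b - 2 * (Nat.log 2 (Fintype.card V) + 1)) := by
  obtain ⟨v, w, hends, hv, hw⟩ := hE.exists_line hj hr hB hb ha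
  set L := Nat.log 2 (Fintype.card V) + 1
  have hS : ∀ x ∈ B, ∀ t, r ≤ t → t ≤ b → ((C t).node x).S ≠ ∅ := fun x hx t h1 h2 =>
    (ha x hx).S_ne hE (by omega) le_rfl h1 (by omega) (hends.S_ne x hx)
  have hhead : ∀ x ∈ B, ∀ t, r ≤ t → t ≤ b → ∀ d,
      (((C t).node x).sc d).head? = (((C r).node x).sc d).head? := fun x hx t h1 h2 d =>
    (head?_of_isPrefix ((ha x hx).sc_isPrefix hE (by omega) le_rfl h1 (by omega) d)
      fun h => (ha x hx).sc_nil hE (by omega) le_rfl h1 (by omega) (hends.S_ne x hx) h).symm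
  have hcl : ClosedUnder (C r) .left B := by
    intro x hx y hy
    by_cases hxv : x = v
    · rw [hxv, hv] at hy
      simp at hy
    · obtain ⟨x', hx', h⟩ := hends.exists_left x hx hxv
      rw [hy] at h
      exact Option.some.inj h ▸ hx'
  refine ⟨v, by omega, hends.left_mem, fun x hx => (ha x hx).mono (by omega) (by omega),
    fun x hx t h1 h2 => hS x hx t (by omega) (by omega), fun t h1 h2 => ?_, fun t h1 h2 => ?_,
    fun x hx t h1 h2 => ?_⟩
  · intro x hx y hy
    rw [hhead x hx t (by omega) (by omega)] at hy
    by_cases hxw : x = w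
    · rw [hxw, hw] at hy
      simp at hy
    · obtain ⟨x', hx', h⟩ := hends.exists_right x hx hxw
      rw [hy] at h
      exact Option.some.inj h ▸ hx'
  · have h3 := ((ha v hends.left_mem).passes (t := t) (by omega) (by omega)).one_le_vID
      (hS v hends.left_mem t (by omega) (by omega))
    have h4 : ((C t).node v).sc .left = [] := (ha v hends.left_mem).sc_nil hE (by omega) le_rfl
      (by omega) (by omega) (hends.S_ne v hends.left_mem) hv
    have h5 : ¬ 1 < ((C t).node v).vID := fun h => h3.2.1.1 h h4
    omega
  · obtain ⟨ρ, -, h3, -, h4, h5⟩ := hE.exists_root hj hr (ha x hx) (hends.S_ne x hx) hb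
    rw [h5 t h1 (by omega)]
    by_contra hne
    obtain ⟨y, -, hy⟩ := hends.exists_left ρ (h4 B hcl hx) hne
    simp [h3] at hy

variable {ρ z : V} {lo hi t : ℕ}

/-- A member with virtual id above 1 is not `ρ`, whose id it carries. As members have shortcuts,
both variants of the condition are met. -/
theorem Settled.prop (h : Settled C B ρ lo hi) {x : V} (hx : x ∈ B) (h1 : lo ≤ t) (h2 : t ≤ hi) :
    propFlyID var x ((C t).node x) := by
  have hS := h.S_ne x hx t h1 h2
  have hv := (((h.alive x hx).passes h1 h2).one_le_vID hS).1
  by_cases hv1 : ((C t).node x).vID = 1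
  · exact .inl ⟨hv1, fun _ => hS⟩
  · refine .inr ⟨by omega, ?_⟩
    rw [h.flyID x hx t h1 h2]
    rintro rfl
    exact hv1 (h.root t h1 h2)

/-- No node outside a settled flyover has a flyover id from it. -/
theorem IsExecution.not_flyID_mem (hE : IsExecution var sup C)
    (hj : var.joinLimit = 0 ∨ var.joinLimit = 1) (h : Settled C B ρ lo hi) (hz : z ∉ B)
    (h1 : lo ≤ t) (h2 : t + 6 * (Nat.log 2 (Fintype.card V) + 1) + 6 ≤ hi)
    (hS : ((C t).node z).S ≠ ∅) : ((C t).node z).flyID ∉ B := by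
  intro hf
  have hlo := h.le
  have hfz : ((C t).node z).flyID ≠ z := fun e => hz (e ▸ hf)
  -- An exit of `z` would reject its flyover id, a living node of `B`, within two rounds; and a
  -- living `z` keeps a flyover id that is not its own.
  have key : ∀ j, t + j ≤ hi - 2 →
      ((C (t + j)).node z).flyID = ((C t).node z).flyID ∧ ¬ ExitSet C (t + j) z := by
    intro j
    have hex : ∀ j, t + j ≤ hi - 2 → ((C (t + j)).node z).flyID = ((C t).node z).flyID →
        ¬ ExitSet C (t + j) z := by
      intro j hj hfj he
      have hal := h.alive _ hf
      rcases hE.exitSet_of_exitSet (by omega) he (.inr hfj.symm) with h' | h' | h'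
      · exact hal _ (by omega) (by omega) h'
      · exact hal _ (by omega) (by omega) h'
      · exact hal _ (by omega) (by omega) h'
    induction j with
    | zero => exact fun hj => ⟨rfl, hex 0 hj rfl⟩
    | succ j ih =>
      intro hj
      obtain ⟨h3, h4⟩ := ih (by omega)
      have h5 : ((C (t + (j + 1))).node z).flyID = ((C t).node z).flyID := by
        rw [← add_assoc, hE.flyID_persist (by omega) (passes_of_not_exitSet h4) (h3 ▸ hfz), h3]
      exact ⟨h5, hex _ hj h5⟩
  have hal : AliveOn C t (hi - 2) z := by
    intro t' h3 h4
    obtain ⟨j, rfl⟩ := Nat.exists_eq_add_of_le h3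
    exact (key j h4).2
  obtain ⟨ρ', -, -, h3, -, h4⟩ := hE.exists_root hj (by omega) hal hS (by omega)
  -- By now the flyover id is the root of `z`. So that root is in `B`, and closure to the right puts
  -- `z` into `B`.
  have h5 := h4 (t + 4 * (Nat.log 2 (Fintype.card V) + 1)) le_rfl (by omega)
  rw [(key _ (by omega)).1] at h5
  exact hz (h3 B (h.closed t h1 (by omega)) (h5 ▸ hf))

/-- A settled flyover has no edge to the outside. -/
theorem IsExecution.known_subset (hE : IsExecution var sup C)
    (hj : var.joinLimit = 0 ∨ var.joinLimit = 1) (h : Settled C B ρ lo hi)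
    (h1 : lo ≤ t) (h2 : t + 6 * (Nat.log 2 (Fintype.card V) + 1) + 8 ≤ hi) :
    ∀ x ∈ B, known C t x ⊆ B := by
  intro x hx z hzx
  have hlo := h.le
  by_contra hz
  have hf := h.flyID x hx t h1 (by omega)
  have hzρ : z ≠ ρ := by rintro rfl; exact hz h.mem
  have hmem : z ∈ memory x ((C t).node x) ((C t).ch x) :=
    Finset.mem_erase.2 ⟨by rintro rfl; exact hz hx, hzx⟩
  have hm := hE.testFlyID_mem (by omega) ((h.alive x hx).passes h1 (by omega))
    (h.prop hx h1 (by omega)) hmem (hf ▸ hzρ)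
  rw [hf] at hm
  -- Either `z` rejects `ρ`, which would exit, or it has shortcuts and the flyover id `ρ`, which
  -- `not_flyID_mem` forbids.
  obtain ⟨h3, h4⟩ := hE.flyID_of_testFlyID_of_alive (by omega) hm
    (h.alive ρ h.mem (t + 1 + 1) (by omega) (by omega)) hzρ.symm
  exact hE.not_flyID_mem hj h hz (by omega) (by omega) h3 (h4 ▸ h.mem)

/-- A node outside a settled flyover that knows a node of it has passed its checks, is not known to
be free, and does not propagate a flyover id. -/
theorem IsExecution.of_known (hE : IsExecution var sup C)
    (hj : var.joinLimit = 0 ∨ var.joinLimit = 1) (h : Settled C B ρ lo hi) (hz : z ∉ B)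
    (h1 : lo ≤ t) (h2 : t + 6 * (Nat.log 2 (Fintype.card V) + 1) + 9 ≤ hi)
    (hk : ∃ x ∈ B, x ∈ known C t z) :
    Passes C t z ∧ ¬ (((C t).node z).S = ∅ ∧ ((C t).node z).vID = 0) ∧
      ¬ propFlyID var z ((C t).node z) ∧ ∃ x ∈ B, x ∈ known C (t + 1) z := by
  obtain ⟨x, hx, hxz⟩ := hk
  have hlo := h.le
  have hmem : x ∈ memory z ((C t).node z) ((C t).ch z) :=
    Finset.mem_erase.2 ⟨by rintro rfl; exact hz hx, hxz⟩
  have hno : ¬ (¬ Passes C t z ∨ (((C t).node z).S = ∅ ∧ ((C t).node z).vID = 0)) := by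
    intro hc
    exact h.alive x hx (t + 1) (by omega) (by omega) (hE.exitSet_of_testFlyID_none (by omega)
      (hE.testFlyID_none_mem (by omega) hc hmem) (h.S_ne x hx (t + 1) (by omega) (by omega)))
  rw [not_or, not_not] at hno
  -- A test sent to `x` would have to agree with the flyover id `ρ`; so in any case the flyover id
  -- of `z` would lie in `B`.
  have hprop : ¬ propFlyID var z ((C t).node z) := by
    intro hp
    have hfB : ((C t).node z).flyID ∈ B := by
      by_cases hxf : x = ((C t).node z).flyID
      · exact hxf ▸ hx
      · have hm := hE.testFlyID_mem (by omega) hno.1 hp hmem hxf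
        have h3 := hE.flyID_of_testFlyID (by omega) hm
          (h.alive x hx (t + 1) (by omega) (by omega))
          (h.S_ne x hx (t + 1) (by omega) (by omega)) (Ne.symm hxf)
        rw [h.flyID x hx _ (by omega) (by omega)] at h3
        exact h3 ▸ h.mem
    by_cases hS : ((C t).node z).S = ∅
    · have h3 := (not_checks hno.1).2.2.1
      have h4 : ((C t).node z).flyID = z := by
        by_contra h4
        exact h3 ⟨hS, .inr h4⟩
      exact hz (h4 ▸ hfB)
    · exact hE.not_flyID_mem hj h hz h1 (by omega) hS hfB
  refine ⟨hno.1, hno.2, hprop, ?_⟩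
  exact hE.exists_known_succ (by omega) (hE.known_subset hj h h1 (by omega))
    (hE.known_subset hj h (by omega) (by omega)) hz hno.1 hprop ⟨x, hx, hxz⟩

/-- A node that has shortcuts and is outside a settled flyover knows no node of it. -/
theorem IsExecution.not_known_of_S (hE : IsExecution var sup C)
    (hj : var.joinLimit = 0 ∨ var.joinLimit = 1) (h : Settled C B ρ lo hi) (hz : z ∉ B)
    (h1 : lo ≤ t) (h2 : t + 12 * (Nat.log 2 (Fintype.card V) + 1) + 20 ≤ hi)
    (hS : ((C t).node z).S ≠ ∅) : ¬ ∃ x ∈ B, x ∈ known C t z := by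
  intro hk
  have hlo := h.le
  set L := Nat.log 2 (Fintype.card V) + 1 with hL
  have key : ∀ j, j ≤ 6 * L + 10 →
      ((C (t + j)).node z).S ≠ ∅ ∧ ∃ x ∈ B, x ∈ known C (t + j) z := by
    intro j
    induction j with
    | zero => exact fun _ => ⟨hS, hk⟩
    | succ j ih =>
      intro hjL
      obtain ⟨h3, h4⟩ := ih (by omega)
      obtain ⟨h5, -, -, h6⟩ := hE.of_known hj h hz (t := t + j) (by omega) (by omega) h4
      exact ⟨hE.S_succ (r := t + j) (by omega) h5 h3, h6⟩
  have hpass : ∀ j, j ≤ 6 * L + 10 → Passes C (t + j) z := fun j hjL =>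
    (hE.of_known hj h hz (t := t + j) (by omega) (by omega) (key j hjL).2).1
  -- An exit during the responses would show up in the checks of the following round, which are
  -- passed as well.
  have hal : AliveOn C t (t + 6 * L + 6) z := by
    intro t' h3 h4 h5
    obtain ⟨j, rfl⟩ := Nat.exists_eq_add_of_le h3
    rcases h5 with h5 | h5
    · exact absurd ((hpass j (by omega)).symm.trans h5) (by simp)
    · exact absurd ((not_checks (hpass (j + 1) (by omega))).1.symm.trans h5) (by simp)
  obtain ⟨ρ', h3, -, -, -, h4⟩ := hE.exists_root hj (by omega) hal hS (by omega)
  have h5 := h4 (t + 4 * L) (by omega) (by omega)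
  have hv := hal.vID_eq hE (t' := t + 4 * L) (by omega) le_rfl (by omega) (by omega) hS
  have hv1 := ((hpass 0 (by omega)).one_le_vID hS).1
  simp only [add_zero] at hv1
  obtain ⟨h6, h7⟩ := key (4 * L) (by omega)
  -- After `4L` rounds `z` carries the id of its root and must announce it, contrary to `of_known`.
  refine (hE.of_known hj h hz (t := t + 4 * L) (by omega) (by omega) h7).2.2.1 ?_
  by_cases h8 : ((C t).node z).vID = 1
  · exact .inl ⟨hv.trans h8, fun _ => h6⟩
  · refine .inr ⟨by omega, ?_⟩
    rw [h5]
    rintro rfl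
    exact h8 h3

/-- A node outside a settled flyover knows no node of it. -/
theorem IsExecution.not_known (hE : IsExecution var sup C)
    (hj : var.joinLimit = 0 ∨ var.joinLimit = 1) (h : Settled C B ρ lo hi) (hz : z ∉ B)
    (k : ℕ) : ∀ t, lo ≤ t → t + 12 * (Nat.log 2 (Fintype.card V) + 1) + 21 + k ≤ hi →
      ((C t).node z).t ≤ k + 1 → ¬ ∃ x ∈ B, x ∈ known C t z := by
  have hlo := h.le
  induction k with
  | zero =>
    intro t h1 h2 ht hk
    by_cases hS : ((C t).node z).S = ∅
    · obtain ⟨h3, -, -, h4⟩ := hE.of_known hj h hz h1 (by omega) hk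
      by_cases hS' : ((C (t + 1)).node z).S = ∅
      · refine (hE.of_known hj h hz (t := t + 1) (by omega) (by omega) h4).2.1 ⟨hS', ?_⟩
        rw [(hE.node_succ (by omega) z).2.1, localRound_vID_eq]
        refine advised_vID_zero hj ((h3.ext (var := var)).S_eq_empty.2 hS) ?_
        push_cast at ht
        omega
      · exact hE.not_known_of_S hj h hz (by omega) (by omega) hS' h4
    · exact hE.not_known_of_S hj h hz h1 (by omega) hS hk
  | succ k ih =>
    intro t h1 h2 ht hk
    by_cases hS : ((C t).node z).S = ∅
    · obtain ⟨h3, -, -, h4⟩ := hE.of_known hj h hz h1 (by omega) hk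
      by_cases hS' : ((C (t + 1)).node z).S = ∅
      · by_cases hlim : max 0 (min 5 ((C t).node z).t - 1) ≤ var.joinLimit
        · refine (hE.of_known hj h hz (t := t + 1) (by omega) (by omega) h4).2.1 ⟨hS', ?_⟩
          rw [(hE.node_succ (by omega) z).2.1, localRound_vID_eq]
          exact advised_vID_zero hj ((h3.ext (var := var)).S_eq_empty.2 hS) hlim
        · refine ih (t + 1) (by omega) (by omega) ?_ h4
          have h5 := hE.ticks (r := t) (by omega) z
          unfold Ticks at h5
          push_cast at ht
          omega
      · exact hE.not_known_of_S hj h hz (by omega) (by omega) hS' h4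
    · exact hE.not_known_of_S hj h hz h1 (by omega) hS hk

/-- A settled flyover that lasts long enough contains all nodes. -/
theorem IsExecution.card_le_of_settled (hE : IsExecution var sup C)
    (hj : var.joinLimit = 0 ∨ var.joinLimit = 1) (h : Settled C B ρ lo hi)
    (h1 : lo + 12 * (Nat.log 2 (Fintype.card V) + 1) + 25 ≤ hi) : Fintype.card V ≤ B.card := by
  have hlo := h.le
  by_contra hlt
  obtain ⟨x, hx, z, hz, hk | hk⟩ :=
    hE.exists_crossing (r := lo) (by omega) ⟨ρ, h.mem⟩ (by omega)
  · exact hz (hE.known_subset hj h le_rfl (by omega) x hx hk)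
  -- The value 4 suffices, since a timer is at most 5 after any round.
  · refine hE.not_known hj h hz 4 lo le_rfl (by omega) ?_ ⟨x, hx, hk⟩
    obtain ⟨j, rfl⟩ : ∃ j, lo = j + 1 := ⟨lo - 1, by omega⟩
    have := hE.ticks (r := j) (by omega) z
    unfold Ticks at this
    push_cast
    omega

end Main

end Flyover

theorem mainTheorem5 : ∃ K : ℕ, ∀ (V : Type*) [Fintype V] [LinearOrder V]
    (var : Flyover.Variant) (sup : ℕ → V → Flyover.Supervision V) (C : ℕ → Flyover.Config V),
    (var.joinLimit = 0 ∨ var.joinLimit = 1) → Flyover.IsExecution var sup C →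
    ∀ (r : ℕ) (B : Finset V), 5 < r → Flyover.IsMaximalBackbone (C r) B →
      B.card < Fintype.card V →
      ∃ r', r ≤ r' ∧ r' ≤ r + K * Nat.log 2 (Fintype.card V) ∧ ∃ u ∈ B, Flyover.ExitSet C r' u := by
  -- Settling takes `4L` rounds at the start and `2L` at the end, and isolation needs `12L + 25`
  -- between them. With `L = log n + 1` this is `18 log n + 43`, at most `61 log n` since `n ≥ 2`.
  refine ⟨61, fun V _ _ var sup C hj hE r B hr hB hcard => ?_⟩
  by_contra! hno
  have hlog : 1 ≤ Nat.log 2 (Fintype.card V) := by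
    have := hB.1.1
    exact Nat.log_pos (by norm_num) (by omega)
  have ha : ∀ x ∈ B, Flyover.AliveOn C r (r + 61 * Nat.log 2 (Fintype.card V)) x :=
    fun x hx t h1 h2 => hno t h1 h2 x hx
  obtain ⟨ρ, hρ⟩ := hE.exists_settled hj (by omega) hB (by omega) ha
  have := hE.card_le_of_settled hj hρ (by omega)
  omega
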